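/- Let $E,V$ be real Banach spaces, $T>0$, $\alpha,\gamma\in(0,1)$ with $\rho:=\alpha-\gamma>\frac13$, and let $E\otimes E$ be the completed projective tensor product. All limits $\lim_{|\mathcal P|\to0}$ are over partitions $\mathcal P$ of the indicated interval with mesh tending to $0$, and increments are written $g_{ts}^\tau=g_t^\tau-g_s^\tau$. **Spaces.** For $a,c>0$, a function $g_{ts}^\tau$ of $0\le s<t\le\tau\le T$ belongs to $\mathcal V_2^{(a,c)}$ if, with $\omega_{a,c}(s,t,\tau)=|\tau-t|^{-c}|t-s|^{a}\wedge|\tau-s|^{a-c}$ (read as $|\tau-s|^{a-c}$ when $t=\tau$), there is a constant $C$ such that $|g_{ts}^\tau|\le C\,\omega_{a,c}(s,t,\tau)$ for all $0\le s<t\le\tau\le T$, and $|g_{ts}^{\tau}-g_{ts}^{\tau'}|\le C|\tau-\tau'|^{\eta}|\tau'-t|^{-\eta}\omega_{a,c}(s,t,\tau')$ for all $0\le s<t<\tau'<\tau\le T$ and $\eta\in[0,1]$. A function $w_s^{p,q}$ of $0\le s\le q\le p\le T$ belongs to $\mathcal W_2^{(\alpha,\gamma)}$ if there is a constant $C$ such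 that $|w_t^{\tau,\tau}-w_s^{\tau,\tau}|\le C\,\omega_{\alpha,\gamma}(s,t,\tau)$ for $0\le s<t\le\tau\le T$, and for all $\eta\in[0,1]$ both $|w_s^{r_2,r'}-w_s^{r_1,r'}|$ (for $0\le s<r'<r_1<r_2\le T$) and $|w_s^{r',r_2}-w_s^{r',r_1}|$ (for $0\le s<r_1<r_2<r'\le T$) are at most $C\big(|r_2-r_1|^\eta|r_1-s|^{-\eta}\wedge s^{\rho}\big)$. **Driving noise.** Let $x:[0,T]\to E$ be $\alpha$-Hölder and let $k(\tau,r)\in\mathbb R$, $0\le r<\tau\le T$, satisfy (H): there is a constant $C$ such that for all $0\le s<r<q<\tau\le T$ and $\eta,\beta\in[0,1]$, $$|k(\tau,r)|\le C|\tau-r|^{-\gamma},\quad |k(\tau,r)-k(q,r)|\le C|q-r|^{-\gamma-\eta}|\tau-q|^{\eta},\quad |k(\tau,r)-k(\tau,s)|\le C|\tau-r|^{-\gamma-\eta}|r-s|^{\eta},$$ and $|k(\tau,r)-k(q,r)-k(\tau,s)+k(q,s)|$ is bounded both by $C|q-r|^{-\gamma-\beta}|r-s|^{\beta}$ and by $C|q-r|^{-\gamma-\eta}|\tau-q|^{\eta}$.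 Put $z_t^\tau=\int_0^tk(\tau,r)\,dx_r:=\lim_{|\mathcal P|\to0}\sum_{[u,v]\in\mathcal P}k(\tau,u)x_{vu}$ for $0\le t\le\tau\le T$, and $\mathbf z_{ts}^{1,\tau}=z_{ts}^\tau$. For a function $g$ of one upper variable let $$\mathbf z^{1,\tau}_{tu}\ast g^{\cdot}=\lim_{|\mathcal P|\to0}\sum_{[a,b]\in\mathcal P[u,t]}\mathbf z^{1,\tau}_{ba}\otimes g^{a},$$ where for operator-valued $g$ the tensor product is evaluated, $\mathbf z\otimes g=g(\mathbf z)$. Let $\mathbf z=(1,\mathbf z^1,\mathbf z^2)$ be a second-order Volterra rough path over $z$: $\mathbf z^1\in\mathcal V_2^{(\alpha,\gamma)}$, $\mathbf z^2\in\mathcal V_2^{(2\rho+\gamma,\gamma)}$ with values in $E\otimes E$, and $\mathbf z^{2,\tau}_{ts}-\mathbf z^{2,\tau}_{tu}-\mathbf z^{2,\tau}_{us}=\mathbf z^{1,\tau}_{tu}\ast\mathbf z^{1,\cdot}_{us}$ for $0\le s<u<t\le\tau\le T$. For $\varphi^{p,q}\in\mathcal L(E,\mathcal L(E,V))$, $s\le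 q\le p$, let $$\mathbf z^{2,\tau}_{ts}\ast\varphi^{\cdot_1,\cdot_2}=\lim_{|\mathcal P|\to0}\sum_{[a,b]\in\mathcal P[s,t]}\Big(\mathbf z^{2,\tau}_{ba}\otimes\varphi^{a,a}+\mathbf z^{1,\tau}_{ba}\ast\big(\mathbf z^{1,\cdot_1}_{as}\ast\varphi^{\cdot_1,\cdot_2}\big)\Big),$$ where $(e_1\otimes e_2)\otimes\varphi=\varphi(e_2)(e_1)$. **Controlled paths and integral.** $(y,y')\in\mathscr D_{\mathbf z^1}^{(\alpha,\gamma)}(V)$ means: $y_t^\tau\in V$ for $0\le t\le\tau\le T$, $y_s'^{p,q}\in\mathcal L(E,V)$ for $0\le s\le q\le p\le T$, $y_0^\tau$ and $y_0'^{p,q}$ do not depend on the upper variables, $y'\in\mathcal W_2^{(\alpha,\gamma)}$, and $y_{ts}^\tau=\mathbf z_{ts}^{1,\tau}\ast y_s'^{\tau,\cdot}+R_{ts}^\tau$ with $R\in\mathcal V_2^{(2\rho+\gamma,\gamma)}$. For an $\mathcal L(E,V)$-valued $g$ with derivative $g'$ the rough Volterra integral is $$\int_s^tk(\tau,r)g_r^r\,dx_r=\lim_{|\mathcal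 P|\to0}\sum_{[u,v]\in\mathcal P[s,t]}\Big(\mathbf z_{vu}^{1,\tau}\ast g_u^{\cdot}+\mathbf z_{vu}^{2,\tau}\ast g_u'^{\cdot_1,\cdot_2}\Big).$$ **Theorem.** Let $f\in C_b^4(V;\mathcal L(E,V))$ and $y_0\in V$. Then there is exactly one $(y,y')\in\mathscr D_{\mathbf z^1}^{(\alpha,\gamma)}(V)$ with $y_s'^{p,q}=f(y_s^q)$ such that for all $0\le t\le\tau\le T$ $$y_t^\tau=y_0+\int_0^tk(\tau,r)f(y_r^r)\,dx_r ,$$ where the right-hand side is the rough Volterra integral of $g_t^\tau=f(y_t^\tau)$ with derivative $g_s'^{p,q}=f'(y_s^p)\circ y_s'^{p,q}$; in particular all the limits involved exist. -/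

import Mathlib

open Filter Topology Set
open scoped TensorProduct

namespace RoughVolterra

/-! ### Partitions and limits of Riemann type sums -/

/-- A partition `s = pt 0 < pt 1 < ⋯ < pt n = t` of the interval `[s, t]`
(the values of `pt` beyond the index `n` play no role). -/
structure IntervalPartition (s t : ℝ) where
  n : ℕ
  pt : ℕ → ℝ
  pt_zero : pt 0 = s
  pt_last : pt n = t
  pt_lt : ∀ i, i < n → pt i < pt (i + 1)

/-- The filter `|𝒫| → 0` on the partitions of `[s, t]`. -/
def meshToZero (s t : ℝ) : Filter (IntervalPartition s t) :=
  ⨅ δ ∈ Ioi (0 : ℝ), 𝓟 {P | ∀ i, i < P.n → P.pt (i + 1) - P.pt i < δ}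

/-- The sum `∑_{[u,v] ∈ 𝒫} Ξ u v`. -/
def IntervalPartition.sum {s t : ℝ} {W : Type*} [AddCommMonoid W]
    (P : IntervalPartition s t) (Ξ : ℝ → ℝ → W) : W :=
  ∑ i ∈ Finset.range P.n, Ξ (P.pt i) (P.pt (i + 1))

/-- `L = lim_{|𝒫| → 0} ∑_{[u,v] ∈ 𝒫} Ξ u v`, over the partitions `𝒫` of `[s, t]`; the existence
of the limit is part of the assertion. -/
def HasSewing {W : Type*} [AddCommMonoid W] [TopologicalSpace W]
    (Ξ : ℝ → ℝ → W) (s t : ℝ) (L : W) : Prop :=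
  Tendsto (fun P : IntervalPartition s t => P.sum Ξ) (meshToZero s t) (𝓝 L)

/-! ### The tensor square of a Banach space -/

section Tensor

variable {E W : Type*} [NormedAddCommGroup E] [NormedSpace ℝ E]
  [NormedAddCommGroup W] [NormedSpace ℝ W]

/-- The completed projective tensor product `E ⊗ E`. -/
abbrev TensorSq (E : Type*) [NormedAddCommGroup E] [NormedSpace ℝ E] : Type _ :=
  UniformSpace.Completion (PiTensorProduct ℝ (fun _ : Fin 2 => E))

/-- The elementary tensor `a ⊗ b`, as a continuous linear function of its left factor `a`. -/
noncomputable def tensorRight (b : E) : E →L[ℝ] TensorSq E :=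
  (UniformSpace.Completion.toComplL (𝕜 := ℝ) (E := PiTensorProduct ℝ (fun _ : Fin 2 => E))).comp
    ((PiTensorProduct.tprodL ℝ (E := fun _ : Fin 2 => E)).toContinuousLinearMap ![0, b] 0)

/-- The continuous bilinear map `(a, b) ↦ φ b a` as a multilinear map on `E × E`. -/
noncomputable def swapMultilinear (φ : E →L[ℝ] E →L[ℝ] W) :
    ContinuousMultilinearMap ℝ (fun _ : Fin 2 => E) W where
  toFun m := φ (m 1) (m 0)
  map_update_add' m i x y := by
    fin_cases i <;> simp [Function.update]
  map_update_smul' m i c x := by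
    fin_cases i <;> simp [Function.update]
  cont := by fun_prop

/-- The pairing of a tensor with `φ ∈ 𝓛(E, 𝓛(E, W))`: the continuous linear map on `E ⊗ E` which
sends `a ⊗ b` to `φ b a`. The left tensor factor belongs to the outermost integral, hence it is
fed to `φ` last. -/
noncomputable def tensorPairing [CompleteSpace W] (φ : E →L[ℝ] E →L[ℝ] W) :
    TensorSq E →L[ℝ] W :=
  (PiTensorProduct.liftIsometry ℝ (fun _ : Fin 2 => E) W (swapMultilinear φ)).fromCompletion

theorem tensorPairing_tensorRight [CompleteSpace W] (φ : E →L[ℝ] E →L[ℝ] W) (a b : E) :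
    tensorPairing φ (tensorRight b a) = φ b a := by
  simp [tensorPairing, tensorRight, swapMultilinear]

end Tensor

/-! ### Volterra kernels and Volterra paths -/

/-- `x : [0, T] → E` is Hölder continuous of order `α`. -/
def IsHolderPath {E : Type*} [NormedAddCommGroup E] (T α : ℝ) (x : ℝ → E) : Prop :=
  ∃ C : ℝ, ∀ s t, 0 ≤ s → s < t → t ≤ T → ‖x t - x s‖ ≤ C * (t - s) ^ α

/-- Hypothesis (H): `k` is a Volterra kernel of order `-γ` on `[0, T]`. The constant does not
depend on the time points nor on `η` and `β`. -/
def IsVolterraKernel (T γ : ℝ) (k : ℝ → ℝ → ℝ) : Prop :=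
  ∃ C : ℝ, ∀ s r q τ : ℝ, 0 ≤ s → s < r → r < q → q < τ → τ ≤ T →
    ∀ η ∈ Icc (0 : ℝ) 1, ∀ β ∈ Icc (0 : ℝ) 1,
      |k τ r| ≤ C * (τ - r) ^ (-γ) ∧
      |k τ r - k q r| ≤ C * ((q - r) ^ (-γ - η) * (τ - q) ^ η) ∧
      |k τ r - k τ s| ≤ C * ((τ - r) ^ (-γ - η) * (r - s) ^ η) ∧
      |k τ r - k q r - k τ s + k q s| ≤ C * ((q - r) ^ (-γ - β) * (r - s) ^ β) ∧
      |k τ r - k q r - k τ s + k q s| ≤ C * ((q - r) ^ (-γ - η) * (τ - q) ^ η)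

/-- `z t τ = ∫_0^t k(τ, r) dx_r` for `0 ≤ t ≤ τ ≤ T`, the integral being the limit of the sums of
`k(τ, u) (x_v - x_u)`. -/
def IsVolterraIntegral {E : Type*} [NormedAddCommGroup E] [NormedSpace ℝ E] (T : ℝ)
    (k : ℝ → ℝ → ℝ) (x : ℝ → E) (z : ℝ → ℝ → E) : Prop :=
  ∀ t τ, 0 ≤ t → t ≤ τ → τ ≤ T → HasSewing (fun u v => k τ u • (x v - x u)) 0 t (z t τ)

/-- The increment `z_{ts}^τ = z_t^τ - z_s^τ` in the lower variable, in the argument order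
`(s, t, τ)`. -/
def incr {W : Type*} [AddCommGroup W] (z : ℝ → ℝ → W) (s t τ : ℝ) : W := z t τ - z s τ

/-- The weight `|τ-t|^{-c} |t-s|^a ∧ |τ-s|^{a-c}` for `s < t ≤ τ`; on the diagonal `t = τ` the
first term is infinite and only the second one remains. -/
noncomputable def volterraWeight (a c s t τ : ℝ) : ℝ :=
  if t < τ then min ((τ - t) ^ (-c) * (t - s) ^ a) ((τ - s) ^ (a - c)) else (τ - s) ^ (a - c)

/-- Finiteness of `‖g‖_{(a,c),1}` for a function `g s t τ` (written `g_{ts}^τ`) on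
`0 ≤ s < t ≤ τ ≤ T`. -/
def FiniteNormOne {W : Type*} [NormedAddCommGroup W] (T a c : ℝ) (g : ℝ → ℝ → ℝ → W) : Prop :=
  ∃ C : ℝ, ∀ s t τ, 0 ≤ s → s < t → t ≤ τ → τ ≤ T → ‖g s t τ‖ ≤ C * volterraWeight a c s t τ

/-- Finiteness of `‖g‖_{(a,c),1,2}`: regularity of the increments in the upper variable. -/
def FiniteNormOneTwo {W : Type*} [NormedAddCommGroup W] (T a c : ℝ) (g : ℝ → ℝ → ℝ → W) : Prop :=
  ∃ C : ℝ, ∀ s t τ' τ, 0 ≤ s → s < t → t < τ' → τ' < τ → τ ≤ T → ∀ η ∈ Icc (0 : ℝ) 1,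
    ‖g s t τ - g s t τ'‖ ≤
      C * ((τ - τ') ^ η * (τ' - t) ^ (-η) * volterraWeight a c s t τ')

/-- The space `𝒱_2^{(a,c)}` of three-variable Volterra functions. -/
def MemV {W : Type*} [NormedAddCommGroup W] (T a c : ℝ) (g : ℝ → ℝ → ℝ → W) : Prop :=
  FiniteNormOne T a c g ∧ FiniteNormOneTwo T a c g

/-- The space `𝒲_2^{(a,c)}` of functions `w s p q` (written `w_s^{p,q}`) of a lower variable `s`
and two upper variables, `s ≤ q ≤ p ≤ T`. The three requirements are: regularity in the lower
variable along `p = q = τ`, regularity in the larger upper variable `p`, and regularity in the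
smaller upper variable `q`. -/
def MemW {W : Type*} [NormedAddCommGroup W] (T a c : ℝ) (w : ℝ → ℝ → ℝ → W) : Prop :=
  FiniteNormOne T a c (fun s t τ => w t τ τ - w s τ τ) ∧
  (∃ C : ℝ, ∀ s r' r₁ r₂, 0 ≤ s → s < r' → r' < r₁ → r₁ < r₂ → r₂ ≤ T → ∀ η ∈ Icc (0 : ℝ) 1,
    ‖w s r₂ r' - w s r₁ r'‖ ≤ C * min ((r₂ - r₁) ^ η * (r₁ - s) ^ (-η)) (s ^ (a - c))) ∧
  (∃ C : ℝ, ∀ s r₁ r₂ r', 0 ≤ s → s < r₁ → r₁ < r₂ → r₂ < r' → r' ≤ T → ∀ η ∈ Icc (0 : ℝ) 1,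
    ‖w s r' r₂ - w s r' r₁‖ ≤ C * min ((r₂ - r₁) ^ η * (r₁ - s) ^ (-η)) (s ^ (a - c)))

/-! ### Convolution products -/

section Convolution

variable {E W : Type*} [NormedAddCommGroup E] [NormedSpace ℝ E]
  [NormedAddCommGroup W] [NormedSpace ℝ W]

/-- `L = z_{tu}^τ ∗ g^·`, the limit of the sums of `z_{v'u'}^τ ⊗ g^{u'}` over the partitions of
`[u, t]`. The tensor product is evaluated through `g^r ∈ 𝓛(E, W)`; the choice
`g^r = (a ↦ a ⊗ b^r)` gives the convolution with an `E`-valued function `b`. -/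
def HasConvOne (z : ℝ → ℝ → E) (τ : ℝ) (g : ℝ → E →L[ℝ] W) (u t : ℝ) (L : W) : Prop :=
  HasSewing (fun a b => g a (incr z a b τ)) u t L

/-- `L = z_{ts}^{2,τ} ∗ φ^{·₁,·₂}`, the limit of the sums over the partitions of `[s, t]` of
`z_{ba}^{2,τ} ⊗ φ^{a,a} + (δ_a z_{bs}^{2,τ}) ∗ φ^{·₁,·₂}`, where
`(δ_a z_{bs}^{2,τ}) ∗ φ^{·₁,·₂} = z_{ba}^τ ∗ (z_{as}^{·₁} ∗ φ^{·₁,·₂})`.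
Here `J a p = z_{as}^p ∗ φ^{p,·}` and `D a b = z_{ba}^τ ∗ J a ·`. -/
def HasConvTwo [CompleteSpace W] (z : ℝ → ℝ → E) (z2 : ℝ → ℝ → ℝ → TensorSq E) (τ : ℝ)
    (φ : ℝ → ℝ → E →L[ℝ] E →L[ℝ] W) (s t : ℝ) (L : W) : Prop :=
  ∃ (J : ℝ → ℝ → E →L[ℝ] W) (D : ℝ → ℝ → W),
    (∀ a p, s ≤ a → a ≤ p → p ≤ t → HasConvOne z p (fun q => φ p q) s a (J a p)) ∧
    (∀ a b, s ≤ a → a < b → b ≤ t → HasConvOne z τ (J a) a b (D a b)) ∧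
    HasSewing (fun a b => tensorPairing (φ a a) (z2 a b τ) + D a b) s t L

end Convolution

/-! ### Volterra rough paths, controlled paths and the rough Volterra integral -/

/-- `(1, z_{ts}^τ, z_{ts}^{2,τ})` is a Volterra rough path of regularity `(α, γ)` and order two:
with `ρ = α - γ`, `z ∈ 𝒱^{(α,γ)}` and `z² ∈ 𝒱_2^{(2ρ+γ,γ)}`, and the convolutional Chen relation
`δ_u z_{ts}^{2,τ} = z_{tu}^τ ∗ z_{us}^·` holds. -/
structure IsVolterraRoughPath {E : Type*} [NormedAddCommGroup E] [NormedSpace ℝ E] (T α γ : ℝ)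
    (z : ℝ → ℝ → E) (z2 : ℝ → ℝ → ℝ → TensorSq E) : Prop where
  start : ∃ z₀ : E, ∀ τ, 0 ≤ τ → τ ≤ T → z 0 τ = z₀
  first : MemV T α γ (incr z)
  second : MemV T (2 * (α - γ) + γ) γ z2
  chen : ∀ s u t τ, 0 ≤ s → s < u → u < t → t ≤ τ → τ ≤ T →
    HasConvOne z τ (fun r => tensorRight (incr z s u r)) u t (z2 s t τ - z2 u t τ - z2 s u τ)

/-- `(y, y')` is a Volterra path controlled by `z`, that is `(y, y') ∈ 𝒟_z^{(α,γ)}(Δ₂; W)`. Here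
`y t τ` is `y_t^τ` for `t ≤ τ`, and `y' s p q` is `y'_s^{p,q}` for `s ≤ q ≤ p`. The last field is
the relation `y_{ts}^τ = z_{ts}^τ ∗ y'_s^{τ,·} + R_{ts}^τ` with `R ∈ 𝒱_2^{(2ρ+γ,γ)}`,
`ρ = α - γ`. -/
structure IsControlled {E W : Type*} [NormedAddCommGroup E] [NormedSpace ℝ E]
    [NormedAddCommGroup W] [NormedSpace ℝ W] (T α γ : ℝ) (z : ℝ → ℝ → E)
    (y : ℝ → ℝ → W) (y' : ℝ → ℝ → ℝ → E →L[ℝ] W) : Prop where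
  start : ∃ w₀ : W, ∀ τ, 0 ≤ τ → τ ≤ T → y 0 τ = w₀
  start_deriv : ∃ w₀' : E →L[ℝ] W, ∀ p q, 0 ≤ q → q ≤ p → p ≤ T → y' 0 p q = w₀'
  deriv_mem : MemW T α γ y'
  remainder : ∃ R : ℝ → ℝ → ℝ → W, MemV T (2 * (α - γ) + γ) γ R ∧
    ∀ s t τ, 0 ≤ s → s < t → t ≤ τ → τ ≤ T →
      HasConvOne z τ (fun r => y' s τ r) s t (incr y s t τ - R s t τ)

/-- `I = ∫_s^t k(τ, r) y_r^r dx_r` in the sense of the rough Volterra integral: the limit of the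
sums over the partitions of `[s, t]` of `z_{vu}^{1,τ} ∗ y_u^· + z_{vu}^{2,τ} ∗ y'_u^{·₁,·₂}`.
Here `A u v` and `B u v` are the two convolution products. -/
def HasRoughVolterraIntegral {E V : Type*} [NormedAddCommGroup E] [NormedSpace ℝ E]
    [NormedAddCommGroup V] [NormedSpace ℝ V] [CompleteSpace V]
    (z : ℝ → ℝ → E) (z2 : ℝ → ℝ → ℝ → TensorSq E)
    (y : ℝ → ℝ → E →L[ℝ] V) (y' : ℝ → ℝ → ℝ → E →L[ℝ] E →L[ℝ] V) (s t τ : ℝ) (I : V) : Prop :=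
  ∃ A B : ℝ → ℝ → V,
    (∀ u v, s ≤ u → u < v → v ≤ t →
      HasConvOne z τ (y u) u v (A u v) ∧ HasConvTwo z z2 τ (y' u) u v (B u v)) ∧
    HasSewing (fun u v => A u v + B u v) s t I

/-- `f ∈ C_b^n`: `f` is `n` times continuously differentiable, and `f` and its derivatives up to
order `n` are bounded. -/
def IsCb {V W : Type*} [NormedAddCommGroup V] [NormedSpace ℝ V] [NormedAddCommGroup W]
    [NormedSpace ℝ W] (n : ℕ) (f : V → W) : Prop :=
  ContDiff ℝ n f ∧ ∃ C : ℝ, ∀ j, j ≤ n → ∀ v, ‖iteratedFDeriv ℝ j f v‖ ≤ C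

/-- `(y, y')` solves `y_t^τ = y₀ + ∫_0^t k(τ, r) f(y_r^r) dx_r` in `𝒟_z^{(α,γ)}(Δ₂; V)`.
The Volterra–Gubinelli derivative of a solution is the one produced by the integral,
`y'_t^{τ,p} = f(y_t^p)`, and the integrand `f(y)` carries the derivative
`(s, p, q) ↦ f'(y_s^p) ∘ y'_s^{p,q}` of the composition. -/
structure IsSolution {E V : Type*} [NormedAddCommGroup E] [NormedSpace ℝ E]
    [NormedAddCommGroup V] [NormedSpace ℝ V] [CompleteSpace V] (T α γ : ℝ)
    (z : ℝ → ℝ → E) (z2 : ℝ → ℝ → ℝ → TensorSq E) (f : V → E →L[ℝ] V) (y₀ : V)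
    (y : ℝ → ℝ → V) (y' : ℝ → ℝ → ℝ → E →L[ℝ] V) : Prop where
  controlled : IsControlled T α γ z y y'
  deriv_eq : ∀ s p q, 0 ≤ s → s ≤ q → q ≤ p → p ≤ T → y' s p q = f (y s q)
  equation : ∀ t τ, 0 ≤ t → t ≤ τ → τ ≤ T →
    HasRoughVolterraIntegral z z2 (fun s r => f (y s r))
      (fun s p q => (fderiv ℝ f (y s p)).comp (y' s p q)) 0 t τ (y t τ - y₀)

end RoughVolterra

set_option linter.unusedSectionVars false

namespace RoughVolterra

/-! ### Partitions -/

/-! The Volterra weights are first traded for simpler bounds. With ρ = α - γ, a function of class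
(a, c) has size |t - s|^(a-c) up to the diagonal, and interpolating the exponents η = 0 and η = 1
shows that its increment in the upper variable from p to q is at most that size times (q - p)/(q -
t) (`MemV.upReg`). The ratio never exceeds 1 and equals 1 at p = t: this is a scale invariant
regularity, singular at the lower variable (`UpReg`), and it is stable under sums, products and
smooth functions.

Such a function has no Hölder modulus at its singular point s, yet it can be integrated against a
path of any Hölder order β > 0. The defect of the Riemann sums is at most a multiple of (b-a)/(b-s)
· (b-a)^β, and this is dominated by (F b - F a)^(1+β) for the control F r = (r-s)^(β/(1+β))
(`ratio_mul_rpow_le`), so the sewing lemma applies. As a function of its upper variable the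
convolution is again of class `UpReg` (`InnerDriver.upReg_conv`), hence convolutions can be
iterated; together with Chen's relation this gives the second order convolution (`germ₂_defect`,
`conv₂_chen`). The germ of the rough integral then has a defect of order β + 2ρ, which for β = ρ
exceeds 1 because ρ > 1/3 (`roughGerm_defect_le`).

On a short window the equation is solved by Picard iteration. Taylor coefficients of f, written as
averages over segments, show that f(Y) is an admissible integrand and depends on Y in a Lipschitz
way (`CtrlData.intData`, `CtrlDiff.intData`). Since the paths compared start from the same values,
the solution map gains a power of the window length (`CtrlGap.image`).

The difficulty is to continue the solution: the starting value of a window is a function of the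
upper variable, and the window length must not depend on how it was produced. A solution on [σ, S]
extends to all upper variables up to T, with bounds which depend only on the window
(`upReg_incr_extend`). On a grid of step h = T/N, the starting value at kh is y₀ plus the increments
over earlier cells, and the increment over a cell i cells away contributes only a fraction 1/(i+1)
to the oscillation. The sum is harmonic, so the oscillation is of order h^ρ (1 + log N), which is
small for large N (`upOsc_grid`). One N therefore serves for all windows. Uniqueness follows from
the same contraction, once the two solutions are given a common bound.

Finally these regular solutions are identified with the solutions of the statement. In one direction
the integral is estimated twice, with outer exponent ρ near the diagonal and α away from it, which
recovers the Volterra weights (`le_mul_volterraWeight`); in the other the bounds are read off from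
the remainder and from the constancy of y at time 0. -/

theorem hasBasis_meshToZero (s t : ℝ) : (meshToZero s t).HasBasis (fun δ : ℝ => 0 < δ)
    (fun δ => {P | ∀ i, i < P.n → P.pt (i + 1) - P.pt i < δ}) := by
  refine hasBasis_biInf_principal ?_ ⟨1, mem_Ioi.2 one_pos⟩
  intro a ha b hb
  refine ⟨min a b, mem_Ioi.2 (lt_min ha hb), ?_, ?_⟩
  · intro P hP i hi
    exact (hP i hi).trans_le (min_le_left _ _)
  · intro P hP i hi
    exact (hP i hi).trans_le (min_le_right _ _)

theorem pt_le_pt_of_le {pt : ℕ → ℝ} {n : ℕ} (h : ∀ i, i < n → pt i < pt (i + 1)) {i j : ℕ}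
    (hij : i ≤ j) (hj : j ≤ n) : pt i ≤ pt j := by
  induction j, hij using Nat.le_induction with
  | base => exact le_rfl
  | succ j hij ih => exact (ih (by omega)).trans (h j (by omega)).le

theorem pt_lt_pt_of_lt {pt : ℕ → ℝ} {n : ℕ} (h : ∀ i, i < n → pt i < pt (i + 1)) {i j : ℕ}
    (hij : i < j) (hj : j ≤ n) : pt i < pt j :=
  (h i (by omega)).trans_le (pt_le_pt_of_le h hij hj)

namespace IntervalPartition

variable {s t : ℝ}

theorem start_le (P : IntervalPartition s t) {i : ℕ} (hi : i ≤ P.n) : s ≤ P.pt i := by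
  simpa [P.pt_zero] using pt_le_pt_of_le P.pt_lt (Nat.zero_le i) hi

theorem le_last (P : IntervalPartition s t) {i : ℕ} (hi : i ≤ P.n) : P.pt i ≤ t := by
  simpa [P.pt_last] using pt_le_pt_of_le P.pt_lt hi le_rfl

/-- The partition into equal parts. -/
noncomputable def uniform (h : s < t) (n : ℕ) : IntervalPartition s t where
  n := n + 1
  pt i := s + i * ((t - s) / (n + 1))
  pt_zero := by simp
  pt_last := by
    have : (n : ℝ) + 1 ≠ 0 := by positivity
    push_cast
    field_simp
    ring
  pt_lt i _ := by
    have : 0 < (t - s) / (n + 1) := div_pos (sub_pos.2 h) (by positivity)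
    push_cast
    nlinarith

/-- The partition of a degenerate interval. -/
def trivial (s : ℝ) : IntervalPartition s s where
  n := 0
  pt _ := s
  pt_zero := rfl
  pt_last := rfl
  pt_lt i hi := absurd hi (Nat.not_lt_zero i)

theorem n_eq_zero (P : IntervalPartition s s) : P.n = 0 := by
  by_contra h
  have := pt_lt_pt_of_lt P.pt_lt (Nat.pos_of_ne_zero h) le_rfl
  rw [P.pt_zero, P.pt_last] at this
  exact lt_irrefl _ this

/-- Concatenation of partitions. -/
noncomputable def concat {m : ℝ} (P : IntervalPartition s m) (Q : IntervalPartition m t) :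
    IntervalPartition s t where
  n := P.n + Q.n
  pt i := if i ≤ P.n then P.pt i else Q.pt (i - P.n)
  pt_zero := by simp [P.pt_zero]
  pt_last := by
    by_cases h : Q.n = 0
    · have := Q.pt_last
      rw [h, Q.pt_zero] at this
      simp [h, P.pt_last, this]
    · rw [if_neg (by omega)]
      simp [Q.pt_last]
  pt_lt i hi := by
    by_cases h1 : i + 1 ≤ P.n
    · rw [if_pos (by omega), if_pos h1]
      exact P.pt_lt i (by omega)
    · by_cases h2 : i ≤ P.n
      · have : i = P.n := by omega
        subst this
        have := Q.pt_lt 0 (by omega)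
        rw [Q.pt_zero] at this
        simpa [P.pt_last] using this
      · rw [if_neg h2, if_neg h1, show i + 1 - P.n = i - P.n + 1 by omega]
        exact Q.pt_lt _ (by omega)

theorem concat_pt_left {m : ℝ} (P : IntervalPartition s m) (Q : IntervalPartition m t) {i : ℕ}
    (hi : i ≤ P.n) : (P.concat Q).pt i = P.pt i := by simp [concat, hi]

theorem concat_pt_right {m : ℝ} (P : IntervalPartition s m) (Q : IntervalPartition m t) (i : ℕ) :
    (P.concat Q).pt (P.n + i) = Q.pt i := by
  rcases Nat.eq_zero_or_pos i with rfl | hi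
  · simp [concat, P.pt_last, Q.pt_zero]
  · simp [concat, show ¬ (P.n + i ≤ P.n) by omega]

theorem sum_concat {W : Type*} [AddCommMonoid W] {m : ℝ} (P : IntervalPartition s m)
    (Q : IntervalPartition m t) (Ξ : ℝ → ℝ → W) :
    (P.concat Q).sum Ξ = P.sum Ξ + Q.sum Ξ := by
  unfold IntervalPartition.sum
  rw [show (P.concat Q).n = P.n + Q.n from rfl, Finset.sum_range_add]
  congr 1
  · refine Finset.sum_congr rfl fun i hi => ?_
    rw [Finset.mem_range] at hi
    rw [concat_pt_left _ _ hi.le, concat_pt_left _ _ hi]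
  · refine Finset.sum_congr rfl fun i _ => ?_
    rw [concat_pt_right, add_assoc, concat_pt_right]

end IntervalPartition

open IntervalPartition

theorem meshToZero_neBot {s t : ℝ} (h : s ≤ t) : (meshToZero s t).NeBot := by
  refine (hasBasis_meshToZero s t).neBot_iff.2 fun {δ} hδ => ?_
  rcases h.eq_or_lt with rfl | h
  · refine ⟨IntervalPartition.trivial s, fun i hi => absurd hi (Nat.not_lt_zero i)⟩
  · obtain ⟨n, hn⟩ := exists_nat_gt ((t - s) / δ)
    refine ⟨uniform h n, fun i _ => ?_⟩
    have h1 : (0 : ℝ) < n + 1 := by positivity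
    have : (uniform h n).pt (i + 1) - (uniform h n).pt i = (t - s) / (n + 1) := by
      simp only [uniform]
      push_cast
      ring
    rw [this, div_lt_iff₀ h1]
    rw [div_lt_iff₀ hδ] at hn
    nlinarith

theorem tendsto_concat (s m t : ℝ) :
    Tendsto (fun p : IntervalPartition s m × IntervalPartition m t => p.1.concat p.2)
      (meshToZero s m ×ˢ meshToZero m t) (meshToZero s t) := by
  refine (((hasBasis_meshToZero s m).prod (hasBasis_meshToZero m t)).tendsto_iff
    (hasBasis_meshToZero s t)).2 fun δ hδ => ⟨(δ, δ), ⟨hδ, hδ⟩, ?_⟩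
  rintro ⟨P, Q⟩ ⟨hP, hQ⟩ i hi
  change i < P.n + Q.n at hi
  change (P.concat Q).pt (i + 1) - (P.concat Q).pt i < δ
  by_cases h : i < P.n
  · rw [concat_pt_left _ _ h, concat_pt_left _ _ h.le]
    exact hP i h
  · obtain ⟨j, rfl⟩ := Nat.exists_eq_add_of_le (not_lt.1 h)
    rw [add_assoc, concat_pt_right, concat_pt_right]
    exact hQ j (show j < Q.n by omega)

/-- `Q` refines `P`, the point of index `i` of `P` being the point of index `σ i` of `Q`. -/
structure IntervalPartition.Refines {s t : ℝ} (Q P : IntervalPartition s t) (σ : ℕ → ℕ) :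
    Prop where
  zero : σ 0 = 0
  last : σ P.n = Q.n
  lt : ∀ i, i < P.n → σ i < σ (i + 1)
  pt_eq : ∀ i, i ≤ P.n → Q.pt (σ i) = P.pt i

/-- Listing `A` in increasing order gives one partition which works for all `P` at once; with `A`
the union of two sets of partition points it is their common refinement. -/
theorem exists_partition_of_finset {s t : ℝ} (A : Finset ℝ) (hs : s ∈ A) (ht : t ∈ A)
    (hA : ∀ a ∈ A, s ≤ a ∧ a ≤ t) :
    ∃ Q : IntervalPartition s t, ∀ P : IntervalPartition s t, (∀ i, i ≤ P.n → P.pt i ∈ A) →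
      ∃ σ, Q.Refines P σ := by
  obtain ⟨N, hN⟩ : ∃ N, A.card = N + 1 :=
    ⟨A.card - 1, (Nat.succ_pred_eq_of_pos (Finset.card_pos.2 ⟨s, hs⟩)).symm⟩
  set e := A.orderEmbOfFin hN with he
  have hmem : ∀ i, e i ∈ A := fun i => Finset.orderEmbOfFin_mem A hN i
  have hsurj : ∀ a ∈ A, ∃ i, e i = a := by
    intro a ha
    have := Finset.range_orderEmbOfFin A hN
    have h2 : a ∈ Set.range e := by rw [this]; exact ha
    exact h2
  have h0 : e ⟨0, by omega⟩ = s := by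
    obtain ⟨i, hi⟩ := hsurj s hs
    refine le_antisymm ?_ (hA _ (hmem _)).1
    rw [← hi]
    exact e.monotone (Fin.mk_le_of_le_val (Nat.zero_le _))
  have hl : e ⟨N, by omega⟩ = t := by
    obtain ⟨i, hi⟩ := hsurj t ht
    refine le_antisymm (hA _ (hmem _)).2 ?_
    rw [← hi]
    exact e.monotone (Fin.le_def.2 (Nat.lt_succ_iff.1 i.2))
  let Q : IntervalPartition s t :=
    { n := N
      pt := fun i => if h : i < N + 1 then e ⟨i, h⟩ else 0
      pt_zero := by simpa using h0
      pt_last := by simpa using hl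
      pt_lt := fun i hi => by
        rw [dif_pos (by omega), dif_pos (by omega)]
        exact e.strictMono (Fin.mk_lt_mk.2 (Nat.lt_succ_self i)) }
  refine ⟨Q, fun P hP => ?_⟩
  -- Indices beyond `P.n` get the dummy value 0, so that `choose` yields a total map `σ`.
  have hidx : ∀ i, ∃ j, j ≤ N ∧ (i ≤ P.n → Q.pt j = P.pt i) := by
    intro i
    by_cases hi : i ≤ P.n
    · obtain ⟨j, hj⟩ := hsurj _ (hP i hi)
      refine ⟨j, Nat.lt_succ_iff.1 j.2, fun _ => ?_⟩
      simp only [Q]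
      rw [dif_pos j.2]
      exact hj
    · exact ⟨0, Nat.zero_le _, fun h => absurd h hi⟩
  choose σ hσN hσ using hidx
  have hinj : ∀ {i j : ℕ}, i ≤ N → j ≤ N → Q.pt i < Q.pt j → i < j := by
    intro i j hi hj h
    by_contra hji
    exact absurd h (not_lt.2 (pt_le_pt_of_le Q.pt_lt (not_lt.1 hji) hi))
  have hinj' : ∀ {i j : ℕ}, i ≤ N → j ≤ N → Q.pt i = Q.pt j → i = j := by
    intro i j hi hj h
    rcases lt_trichotomy i j with hij | hij | hij
    · exact absurd h (pt_lt_pt_of_lt Q.pt_lt hij hj).ne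
    · exact hij
    · exact absurd h (pt_lt_pt_of_lt Q.pt_lt hij hi).ne'
  refine ⟨σ, ⟨hinj' (hσN _) (Nat.zero_le _) ?_, hinj' (hσN _) le_rfl ?_, fun i hi => ?_, hσ⟩⟩
  · rw [hσ 0 (Nat.zero_le _), P.pt_zero, Q.pt_zero]
  · rw [hσ P.n le_rfl, P.pt_last]
    exact Q.pt_last.symm
  · refine hinj (hσN _) (hσN _) ?_
    rw [hσ i hi.le, hσ (i + 1) hi]
    exact P.pt_lt i hi

theorem exists_common_refinement {s t : ℝ} (P P' : IntervalPartition s t) :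
    ∃ (Q : IntervalPartition s t) (σ σ' : ℕ → ℕ), Q.Refines P σ ∧ Q.Refines P' σ' := by
  classical
  set A : Finset ℝ := (Finset.range (P.n + 1)).image P.pt ∪ (Finset.range (P'.n + 1)).image P'.pt
  have hP : ∀ i, i ≤ P.n → P.pt i ∈ A := fun i hi =>
    Finset.mem_union_left _ (Finset.mem_image_of_mem _ (Finset.mem_range.2 (by omega)))
  have hP' : ∀ i, i ≤ P'.n → P'.pt i ∈ A := fun i hi =>
    Finset.mem_union_right _ (Finset.mem_image_of_mem _ (Finset.mem_range.2 (by omega)))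
  obtain ⟨Q, hQ⟩ := exists_partition_of_finset (s := s) (t := t) A
    (by simpa [P.pt_zero] using hP 0 (Nat.zero_le _)) (by simpa [P.pt_last] using hP P.n le_rfl)
    (by
      intro a ha
      rcases Finset.mem_union.1 ha with h | h
      · obtain ⟨i, hi, rfl⟩ := Finset.mem_image.1 h
        have hi' : i ≤ P.n := by rw [Finset.mem_range] at hi; omega
        exact ⟨P.start_le hi', P.le_last hi'⟩
      · obtain ⟨i, hi, rfl⟩ := Finset.mem_image.1 h
        have hi' : i ≤ P'.n := by rw [Finset.mem_range] at hi; omega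
        exact ⟨P'.start_le hi', P'.le_last hi'⟩)
  obtain ⟨σ, hσ⟩ := hQ P hP
  obtain ⟨σ', hσ'⟩ := hQ P' hP'
  exact ⟨Q, σ, σ', hσ, hσ'⟩

theorem IntervalPartition.Refines.sum_eq {W : Type*} [AddCommMonoid W] {s t : ℝ}
    {Q P : IntervalPartition s t} {σ : ℕ → ℕ} (h : Q.Refines P σ) (Ξ : ℝ → ℝ → W) :
    Q.sum Ξ = ∑ i ∈ Finset.range P.n,
      ∑ l ∈ Finset.Ico (σ i) (σ (i + 1)), Ξ (Q.pt l) (Q.pt (l + 1)) := by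
  have key : ∀ k, k ≤ P.n → ∑ l ∈ Finset.range (σ k), Ξ (Q.pt l) (Q.pt (l + 1)) =
      ∑ i ∈ Finset.range k, ∑ l ∈ Finset.Ico (σ i) (σ (i + 1)), Ξ (Q.pt l) (Q.pt (l + 1)) := by
    intro k
    induction k with
    | zero => intro _; simp [h.zero]
    | succ k ih =>
      intro hk
      rw [Finset.sum_range_succ, ← ih (by omega), Finset.range_eq_Ico, Finset.range_eq_Ico,
        Finset.sum_Ico_consecutive _ (Nat.zero_le _) (h.lt k (by omega)).le]
  have := key P.n le_rfl
  rw [h.last] at this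
  exact this

/-! ### The sewing lemma -/

/-- The constant of the maximal inequality for almost additive functions. -/
noncomputable def youngC (κ : ℝ) : ℝ := 2 / (1 - 2 ^ (1 - κ))

theorem two_rpow_lt_one {κ : ℝ} (hκ : 1 < κ) : (2 : ℝ) ^ (1 - κ) < 1 :=
  Real.rpow_lt_one_of_one_lt_of_neg one_lt_two (by linarith)

theorem youngC_pos {κ : ℝ} (hκ : 1 < κ) : 0 < youngC κ :=
  div_pos two_pos (sub_pos.2 (two_rpow_lt_one hκ))

/-- This fixed point equation defines the constant: it closes the induction in
`norm_sum_Ico_sub_le`, where a block of size x is cut into two blocks of size at most x/2 at the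
cost of two defects. -/
theorem youngC_eq {κ : ℝ} (hκ : 1 < κ) (x : ℝ) (hx : 0 ≤ x) :
    2 * (youngC κ * (x / 2) ^ κ + x ^ κ) = youngC κ * x ^ κ := by
  have h1 := sub_pos.2 (two_rpow_lt_one hκ)
  have h2 : (x / 2) ^ κ = x ^ κ * (2 ^ (1 - κ) / 2) := by
    rw [Real.div_rpow hx two_pos.le, Real.rpow_sub two_pos, Real.rpow_one]
    field_simp
  rw [h2, youngC]
  field_simp
  ring

section Sewing

variable {W : Type*} [NormedAddCommGroup W]

/-- Stop at the first index `m` where more than half of the total increment of `F` has been used,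
and take `k = m - 1`: the blocks before and after the cell from `k` to `k + 1` each carry at most
half. -/
theorem exists_half_index {pt : ℕ → ℝ} {F : ℝ → ℝ} {i j : ℕ} (hij : i < j)
    (hmono : F (pt i) ≤ F (pt j)) :
    ∃ k, i ≤ k ∧ k < j ∧ F (pt k) - F (pt i) ≤ (F (pt j) - F (pt i)) / 2 ∧
      F (pt j) - F (pt (k + 1)) ≤ (F (pt j) - F (pt i)) / 2 := by
  classical
  have hex : ∃ m, i < m ∧ (m = j ∨ (F (pt j) - F (pt i)) / 2 < F (pt m) - F (pt i)) :=
    ⟨j, hij, Or.inl rfl⟩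
  set m := Nat.find hex with hm
  obtain ⟨him, hmj⟩ := Nat.find_spec hex
  have hmj' : m ≤ j := Nat.find_min' hex ⟨hij, Or.inl rfl⟩
  refine ⟨m - 1, by omega, by omega, ?_, ?_⟩
  · by_cases h : m - 1 = i
    · rw [h]; linarith
    · have := Nat.find_min hex (m := m - 1) (by omega)
      push Not at this
      exact (this (by omega)).2
  · rw [show m - 1 + 1 = m by omega]
    rcases hmj with h | h
    · rw [← hm] at h
      rw [h]; linarith
    · rw [← hm] at h
      linarith

/-- Young's maximal inequality, by induction on the number of cells. Isolate the cell which contains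
the midpoint of the control; the blocks on both sides have control at most ω/2, gluing them to that
cell costs two defects of size at most `K * ω ^ κ`, and `youngC_eq` closes the recursion. -/
theorem norm_sum_Ico_sub_le {Ξ : ℝ → ℝ → W} {F : ℝ → ℝ} {K κ s t : ℝ} (hκ : 1 < κ) (hK : 0 ≤ K)
    (hF : MonotoneOn F (Icc s t))
    (hδ : ∀ a m b, s ≤ a → a < m → m < b → b ≤ t →
      ‖Ξ a b - Ξ a m - Ξ m b‖ ≤ K * (F b - F a) ^ κ)
    {pt : ℕ → ℝ} {n : ℕ} (hlt : ∀ i, i < n → pt i < pt (i + 1)) (h0 : s ≤ pt 0) (hn : pt n ≤ t)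
    {i j : ℕ} (hij : i < j) (hj : j ≤ n) :
    ‖∑ l ∈ Finset.Ico i j, Ξ (pt l) (pt (l + 1)) - Ξ (pt i) (pt j)‖ ≤
      youngC κ * K * (F (pt j) - F (pt i)) ^ κ := by
  have hY := youngC_pos hκ
  have hmem : ∀ i, i ≤ n → pt i ∈ Icc s t := fun i hi =>
    ⟨h0.trans (pt_le_pt_of_le hlt (Nat.zero_le i) hi), (pt_le_pt_of_le hlt hi le_rfl).trans hn⟩
  have hFm : ∀ {i j}, i ≤ j → j ≤ n → F (pt i) ≤ F (pt j) := fun {i j} hij hj =>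
    hF (hmem i (hij.trans hj)) (hmem j hj) (pt_le_pt_of_le hlt hij hj)
  induction hd : j - i using Nat.strong_induction_on generalizing i j with
  | _ d ih =>
    set ω := F (pt j) - F (pt i) with hω
    have hω0 : 0 ≤ ω := sub_nonneg.2 (hFm hij.le hj)
    by_cases h1 : j = i + 1
    · subst h1
      simp only [Nat.Ico_succ_singleton, Finset.sum_singleton, sub_self, norm_zero]
      positivity
    obtain ⟨k, hik, hkj, hk1, hk2⟩ := exists_half_index (pt := pt) (F := F) hij (hFm hij.le hj)
    -- The left block together with the middle cell; the block is empty when `k = i`.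
    have hA : ‖∑ l ∈ Finset.Ico i (k + 1), Ξ (pt l) (pt (l + 1)) - Ξ (pt i) (pt (k + 1))‖ ≤
        K * (youngC κ * (ω / 2) ^ κ + ω ^ κ) := by
      rcases hik.eq_or_lt with rfl | hik
      · simp only [Nat.Ico_succ_singleton, Finset.sum_singleton, sub_self, norm_zero]
        positivity
      · have e1 := ih (k - i) (by omega) hik (by omega) rfl
        have e2 := hδ (pt i) (pt k) (pt (k + 1)) (hmem i (by omega)).1
          (pt_lt_pt_of_lt hlt hik (by omega)) (hlt k (by omega)) (hmem _ (by omega)).2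
        have e3 : (F (pt k) - F (pt i)) ^ κ ≤ (ω / 2) ^ κ :=
          Real.rpow_le_rpow (sub_nonneg.2 (hFm hik.le (by omega))) hk1 (by linarith)
        have e4 : (F (pt (k + 1)) - F (pt i)) ^ κ ≤ ω ^ κ :=
          Real.rpow_le_rpow (sub_nonneg.2 (hFm (by omega) (by omega)))
            (by rw [hω]; linarith [hFm (i := k + 1) (j := j) (by omega) hj]) (by linarith)
        rw [Finset.sum_Ico_succ_top hik.le]
        calc _ = ‖(∑ l ∈ Finset.Ico i k, Ξ (pt l) (pt (l + 1)) - Ξ (pt i) (pt k)) -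
              (Ξ (pt i) (pt (k + 1)) - Ξ (pt i) (pt k) - Ξ (pt k) (pt (k + 1)))‖ := by
              congr 1; abel
          _ ≤ youngC κ * K * (F (pt k) - F (pt i)) ^ κ + K * (F (pt (k + 1)) - F (pt i)) ^ κ :=
              (norm_sub_le _ _).trans (add_le_add e1 e2)
          _ ≤ youngC κ * K * (ω / 2) ^ κ + K * ω ^ κ := by gcongr
          _ = _ := by ring
    -- The right block, empty when `k + 1 = j`, and the defect which joins it to everything on its
    -- left.
    have hB : ‖∑ l ∈ Finset.Ico (k + 1) j, Ξ (pt l) (pt (l + 1)) + Ξ (pt i) (pt (k + 1)) -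
        Ξ (pt i) (pt j)‖ ≤ K * (youngC κ * (ω / 2) ^ κ + ω ^ κ) := by
      rcases (Nat.succ_le_of_lt hkj).eq_or_lt with h | hkj
      · rw [← h]
        simp only [Nat.succ_eq_add_one, Finset.Ico_self, Finset.sum_empty, zero_add, sub_self,
          norm_zero]
        positivity
      · have e1 := ih (j - (k + 1)) (by omega) hkj hj rfl
        have e2 := hδ (pt i) (pt (k + 1)) (pt j) (hmem i (by omega)).1
          (pt_lt_pt_of_lt hlt (by omega) (by omega)) (pt_lt_pt_of_lt hlt hkj hj) (hmem _ hj).2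
        have e3 : (F (pt j) - F (pt (k + 1))) ^ κ ≤ (ω / 2) ^ κ :=
          Real.rpow_le_rpow (sub_nonneg.2 (hFm hkj.le hj)) hk2 (by linarith)
        calc _ = ‖(∑ l ∈ Finset.Ico (k + 1) j, Ξ (pt l) (pt (l + 1)) - Ξ (pt (k + 1)) (pt j)) -
              (Ξ (pt i) (pt j) - Ξ (pt i) (pt (k + 1)) - Ξ (pt (k + 1)) (pt j))‖ := by
              congr 1; abel
          _ ≤ youngC κ * K * (F (pt j) - F (pt (k + 1))) ^ κ + K * ω ^ κ :=
              (norm_sub_le _ _).trans (add_le_add e1 e2)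
          _ ≤ youngC κ * K * (ω / 2) ^ κ + K * ω ^ κ := by gcongr
          _ = _ := by ring
    rw [← Finset.sum_Ico_consecutive _ (show i ≤ k + 1 by omega) (show k + 1 ≤ j by omega)]
    calc _ = ‖(∑ l ∈ Finset.Ico i (k + 1), Ξ (pt l) (pt (l + 1)) - Ξ (pt i) (pt (k + 1))) +
          (∑ l ∈ Finset.Ico (k + 1) j, Ξ (pt l) (pt (l + 1)) + Ξ (pt i) (pt (k + 1)) -
            Ξ (pt i) (pt j))‖ := by congr 1; abel
      _ ≤ K * (youngC κ * (ω / 2) ^ κ + ω ^ κ) + K * (youngC κ * (ω / 2) ^ κ + ω ^ κ) :=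
          (norm_add_le _ _).trans (add_le_add hA hB)
      _ = K * (2 * (youngC κ * (ω / 2) ^ κ + ω ^ κ)) := by ring
      _ = _ := by rw [youngC_eq hκ ω hω0]; ring

theorem exists_pos_mul_rpow_lt {c p e : ℝ} (hc : 0 ≤ c) (hp : 0 < p) (he : 0 < e) :
    ∃ ε, 0 < ε ∧ c * ε ^ p < e := by
  refine ⟨(e / (c + 1)) ^ (1 / p), by positivity, ?_⟩
  rw [← Real.rpow_mul (by positivity), one_div_mul_cancel hp.ne', Real.rpow_one,
    mul_div_assoc', div_lt_iff₀ (by positivity)]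
  nlinarith

/-- Pull out the power κ - 1 of the largest increment; what remains telescopes. -/
theorem sum_rpow_le {P : ℕ → ℝ} {n : ℕ} {ε κ : ℝ} (hκ : 1 < κ)
    (h0 : ∀ i, i < n → P i ≤ P (i + 1)) (hε : ∀ i, i < n → P (i + 1) - P i ≤ ε) :
    ∑ i ∈ Finset.range n, (P (i + 1) - P i) ^ κ ≤ ε ^ (κ - 1) * (P n - P 0) := by
  rw [← Finset.sum_range_sub, Finset.mul_sum]
  refine Finset.sum_le_sum fun i hi => ?_
  rw [Finset.mem_range] at hi
  have h1 := sub_nonneg.2 (h0 i hi)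
  rcases h1.eq_or_lt with h | h
  · rw [← h, Real.zero_rpow (by linarith)]; simp
  · calc (P (i + 1) - P i) ^ κ = (P (i + 1) - P i) ^ (κ - 1) * (P (i + 1) - P i) := by
          rw [← Real.rpow_add_one h.ne', sub_add_cancel]
      _ ≤ _ := mul_le_mul_of_nonneg_right
          (Real.rpow_le_rpow h.le (hε i hi) (by linarith)) h.le

/-- The maximal inequality is applied inside each cell of `P`, and the errors are summed by
`sum_rpow_le`. The bound vanishes with the oscillation `ε` of the control over the cells. -/
theorem norm_sum_sub_sum_le_of_refines {Ξ : ℝ → ℝ → W} {F : ℝ → ℝ} {K κ s t ε : ℝ} (hκ : 1 < κ)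
    (hK : 0 ≤ K) (hF : MonotoneOn F (Icc s t))
    (hδ : ∀ a m b, s ≤ a → a < m → m < b → b ≤ t →
      ‖Ξ a b - Ξ a m - Ξ m b‖ ≤ K * (F b - F a) ^ κ)
    {P Q : IntervalPartition s t} {σ : ℕ → ℕ} (h : Q.Refines P σ)
    (hε : ∀ i, i < P.n → F (P.pt (i + 1)) - F (P.pt i) ≤ ε) :
    ‖Q.sum Ξ - P.sum Ξ‖ ≤ youngC κ * K * (ε ^ (κ - 1) * (F t - F s)) := by
  have hY := youngC_pos hκ
  rw [h.sum_eq, IntervalPartition.sum, ← Finset.sum_sub_distrib]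
  have hσ : ∀ i, i ≤ P.n → σ i ≤ Q.n := by
    intro i hi
    rw [← h.last]
    induction hi using Nat.decreasingInduction with
    | self => exact le_rfl
    | of_succ k hk ih => exact (h.lt k hk).le.trans ih
  have h1 : ∀ i ∈ Finset.range P.n,
      ‖∑ l ∈ Finset.Ico (σ i) (σ (i + 1)), Ξ (Q.pt l) (Q.pt (l + 1)) -
        Ξ (P.pt i) (P.pt (i + 1))‖ ≤
      youngC κ * K * (F (P.pt (i + 1)) - F (P.pt i)) ^ κ := by
    intro i hi
    rw [Finset.mem_range] at hi
    have := norm_sum_Ico_sub_le hκ hK hF hδ Q.pt_lt Q.pt_zero.ge Q.pt_last.le (h.lt i hi)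
      (hσ (i + 1) hi)
    rwa [h.pt_eq i hi.le, h.pt_eq (i + 1) hi] at this
  refine (norm_sum_le_of_le _ h1).trans ?_
  rw [← Finset.mul_sum]
  refine mul_le_mul_of_nonneg_left ?_ (by positivity)
  have := sum_rpow_le (P := fun i => F (P.pt i)) (n := P.n) hκ (fun i hi =>
    hF ⟨P.start_le hi.le, P.le_last hi.le⟩ ⟨P.start_le hi, P.le_last hi⟩ (P.pt_lt i hi).le) hε
  simpa only [P.pt_last, P.pt_zero] using this

/-- Two fine partitions are compared through a common refinement. Uniform continuity of the control
turns small mesh into small oscillation, so the sums are Cauchy along the filter. -/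
theorem exists_hasSewing [CompleteSpace W] {Ξ : ℝ → ℝ → W} {F : ℝ → ℝ} {K κ s t : ℝ}
    (hst : s < t) (hκ : 1 < κ) (hK : 0 ≤ K) (hF : MonotoneOn F (Icc s t))
    (hFc : ContinuousOn F (Icc s t))
    (hδ : ∀ a m b, s ≤ a → a < m → m < b → b ≤ t →
      ‖Ξ a b - Ξ a m - Ξ m b‖ ≤ K * (F b - F a) ^ κ) :
    ∃ L, HasSewing Ξ s t L ∧ ‖L - Ξ s t‖ ≤ youngC κ * K * (F t - F s) ^ κ := by
  have hY := youngC_pos hκ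
  have hFst : 0 ≤ F t - F s :=
    sub_nonneg.2 (hF (left_mem_Icc.2 hst.le) (right_mem_Icc.2 hst.le) hst.le)
  have := meshToZero_neBot hst.le
  have hU := isCompact_Icc.uniformContinuousOn_of_continuous hFc
  rw [Metric.uniformContinuousOn_iff] at hU
  have hC : Cauchy (map (fun P : IntervalPartition s t => P.sum Ξ) (meshToZero s t)) := by
    rw [Metric.cauchy_iff]
    refine ⟨inferInstance, fun e he => ?_⟩
    obtain ⟨ε, hε, hlt⟩ := exists_pos_mul_rpow_lt (c := 2 * (youngC κ * K * (F t - F s)))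
      (p := κ - 1) (by positivity) (by linarith) he
    obtain ⟨δ, hδ0, hδ1⟩ := hU ε hε
    refine ⟨_, image_mem_map ((hasBasis_meshToZero s t).mem_of_mem hδ0), ?_⟩
    rintro _ ⟨P, hP, rfl⟩ _ ⟨P', hP', rfl⟩
    have hosc : ∀ P : IntervalPartition s t, (∀ i, i < P.n → P.pt (i + 1) - P.pt i < δ) →
        ∀ i, i < P.n → F (P.pt (i + 1)) - F (P.pt i) ≤ ε := by
      intro P hP i hi
      have := hδ1 _ ⟨P.start_le (i := i + 1) hi, P.le_last hi⟩ _
        ⟨P.start_le hi.le, P.le_last hi.le⟩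
        (by rw [Real.dist_eq, abs_of_pos (sub_pos.2 (P.pt_lt i hi))]; exact hP i hi)
      exact (le_abs_self _).trans this.le
    obtain ⟨Q, σ, σ', h, h'⟩ := exists_common_refinement P P'
    have e1 := norm_sum_sub_sum_le_of_refines hκ hK hF hδ h (hosc P hP)
    have e2 := norm_sum_sub_sum_le_of_refines hκ hK hF hδ h' (hosc P' hP')
    calc dist (P.sum Ξ) (P'.sum Ξ) = ‖(Q.sum Ξ - P'.sum Ξ) - (Q.sum Ξ - P.sum Ξ)‖ := by
          rw [dist_eq_norm]; congr 1; abel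
      _ ≤ _ := (norm_sub_le _ _).trans (add_le_add e2 e1)
      _ = 2 * (youngC κ * K * (F t - F s)) * ε ^ (κ - 1) := by ring
      _ < e := hlt
  obtain ⟨L, hL⟩ := CompleteSpace.complete hC
  refine ⟨L, hL, ?_⟩
  have hL' : Tendsto (fun P : IntervalPartition s t => P.sum Ξ) (meshToZero s t) (𝓝 L) := hL
  refine le_of_tendsto (hL'.sub_const (Ξ s t)).norm (Eventually.of_forall fun P => ?_)
  have hn : 0 < P.n := by
    by_contra h0
    have := P.pt_last
    rw [show P.n = 0 by omega, P.pt_zero] at this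
    exact hst.ne this
  have := norm_sum_Ico_sub_le hκ hK hF hδ P.pt_lt P.pt_zero.ge P.pt_last.le hn le_rfl
  rw [P.pt_zero, P.pt_last] at this
  simpa only [IntervalPartition.sum, Finset.range_eq_Ico] using this

theorem hasSewing_self (Ξ : ℝ → ℝ → W) (s : ℝ) : HasSewing Ξ s s 0 := by
  refine tendsto_const_nhds.congr fun P => ?_
  simp [IntervalPartition.sum, P.n_eq_zero]

theorem HasSewing.congr {Ξ Ξ' : ℝ → ℝ → W} {s t : ℝ} {L : W} (h : HasSewing Ξ s t L)
    (hΞ : ∀ a b, s ≤ a → a < b → b ≤ t → Ξ a b = Ξ' a b) : HasSewing Ξ' s t L := by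
  refine Tendsto.congr (fun P => ?_) h
  refine Finset.sum_congr rfl fun i hi => ?_
  rw [Finset.mem_range] at hi
  exact hΞ _ _ (P.start_le hi.le) (P.pt_lt i hi) (P.le_last hi)

theorem HasSewing.unique {Ξ : ℝ → ℝ → W} {s t : ℝ} {L L' : W} (hst : s ≤ t)
    (h : HasSewing Ξ s t L) (h' : HasSewing Ξ s t L') : L = L' :=
  have := meshToZero_neBot hst
  tendsto_nhds_unique h h'

theorem HasSewing.add {Ξ Ξ' : ℝ → ℝ → W} {s t : ℝ} {L L' : W} (h : HasSewing Ξ s t L)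
    (h' : HasSewing Ξ' s t L') : HasSewing (fun a b => Ξ a b + Ξ' a b) s t (L + L') := by
  refine Tendsto.congr (fun P => ?_) (Tendsto.add h h')
  simp only [IntervalPartition.sum, Finset.sum_add_distrib]

theorem HasSewing.sub {Ξ Ξ' : ℝ → ℝ → W} {s t : ℝ} {L L' : W} (h : HasSewing Ξ s t L)
    (h' : HasSewing Ξ' s t L') : HasSewing (fun a b => Ξ a b - Ξ' a b) s t (L - L') := by
  refine Tendsto.congr (fun P => ?_) (Tendsto.sub h h')
  simp only [IntervalPartition.sum, Finset.sum_sub_distrib]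

theorem HasSewing.map {W' : Type*} [NormedAddCommGroup W'] [NormedSpace ℝ W] [NormedSpace ℝ W']
    {Ξ : ℝ → ℝ → W} {s t : ℝ} {L : W} (h : HasSewing Ξ s t L) (A : W →L[ℝ] W') :
    HasSewing (fun a b => A (Ξ a b)) s t (A L) := by
  refine Tendsto.congr (fun P => ?_) ((A.continuous.tendsto L).comp h)
  simp only [IntervalPartition.sum, Function.comp, map_sum]

theorem HasSewing.concat {Ξ : ℝ → ℝ → W} {s m t : ℝ} {L L₁ L₂ : W} (hsm : s ≤ m) (hmt : m ≤ t)
    (h : HasSewing Ξ s t L) (h₁ : HasSewing Ξ s m L₁) (h₂ : HasSewing Ξ m t L₂) :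
    L = L₁ + L₂ := by
  have := meshToZero_neBot hsm
  have := meshToZero_neBot hmt
  refine tendsto_nhds_unique (h.comp (tendsto_concat s m t)) ?_
  refine Tendsto.congr (fun p => ?_) ((h₁.comp tendsto_fst).add (h₂.comp tendsto_snd))
  simp only [Function.comp, sum_concat]

theorem hasSewing_increment (G : ℝ → W) (s t : ℝ) :
    HasSewing (fun a b => G b - G a) s t (G t - G s) := by
  refine tendsto_const_nhds.congr fun P => ?_
  simp only [IntervalPartition.sum]
  rw [Finset.sum_range_sub (fun i => G (P.pt i)), P.pt_last, P.pt_zero]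

/-- The limit of the Riemann type sums of `Ξ`. -/
noncomputable def sew (Ξ : ℝ → ℝ → W) (s t : ℝ) : W :=
  limUnder (meshToZero s t) (fun P : IntervalPartition s t => P.sum Ξ)

theorem HasSewing.sew_eq {Ξ : ℝ → ℝ → W} {s t : ℝ} {L : W} (hst : s ≤ t)
    (h : HasSewing Ξ s t L) : sew Ξ s t = L :=
  have := meshToZero_neBot hst
  Tendsto.limUnder_eq h

theorem sew_self (Ξ : ℝ → ℝ → W) (s : ℝ) : sew Ξ s s = 0 :=
  (hasSewing_self Ξ s).sew_eq le_rfl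

theorem sew_congr {Ξ Ξ' : ℝ → ℝ → W} {s t : ℝ}
    (hΞ : ∀ a b, s ≤ a → a < b → b ≤ t → Ξ a b = Ξ' a b) : sew Ξ s t = sew Ξ' s t := by
  unfold sew
  congr 1
  funext P
  refine Finset.sum_congr rfl fun i hi => ?_
  rw [Finset.mem_range] at hi
  exact hΞ _ _ (P.start_le hi.le) (P.pt_lt i hi) (P.le_last hi)

theorem hasSewing_sew_of_regular [CompleteSpace W] {Ξ : ℝ → ℝ → W} {K κ s t : ℝ}
    (hst : s < t) (hκ : 1 < κ) (hK : 0 ≤ K)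
    (hδ : ∀ a m b, s ≤ a → a < m → m < b → b ≤ t →
      ‖Ξ a b - Ξ a m - Ξ m b‖ ≤ K * (b - a) ^ κ) :
    HasSewing Ξ s t (sew Ξ s t) ∧ ‖sew Ξ s t - Ξ s t‖ ≤ youngC κ * K * (t - s) ^ κ := by
  obtain ⟨L, hL, hb⟩ := exists_hasSewing (F := id) hst hκ hK (fun _ _ _ _ h => h)
    continuousOn_id hδ
  rw [hL.sew_eq hst.le]
  exact ⟨hL, hb⟩

/-- The constant of the sewing lemma for germs which are singular at the left end point. -/
noncomputable def singC (β : ℝ) : ℝ := youngC (1 + β) * ((1 + β) / β) ^ (1 + β)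

theorem singC_nonneg {β : ℝ} (hβ : 0 < β) : 0 ≤ singC β :=
  mul_nonneg (youngC_pos (by linarith)).le (by positivity)

/-- The singular weight is dominated by a power of a genuine control. With μ = β/(1+β) and l =
(b-a)/(b-s), Bernoulli's inequality (1-l)^μ ≤ 1 - μl bounds the increment of r ↦ (r-s)^μ from below
by μl(b-s)^μ, and the power 1+β of l(b-s)^μ is l(b-a)^β. -/
theorem ratio_mul_rpow_le {β s a b : ℝ} (hβ : 0 < β) (hsa : s ≤ a) (hab : a < b) :
    (b - a) / (b - s) * (b - a) ^ β ≤
      ((1 + β) / β) ^ (1 + β) *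
        ((b - s) ^ (β / (1 + β)) - (a - s) ^ (β / (1 + β))) ^ (1 + β) := by
  have hbs : 0 < b - s := by linarith
  have hba : 0 < b - a := by linarith
  set μ := β / (1 + β) with hμ
  have hμ0 : 0 < μ := by positivity
  have hμ1 : μ ≤ 1 := by rw [hμ, div_le_one (by positivity)]; linarith
  set l := (b - a) / (b - s) with hl
  have hl0 : 0 < l := by positivity
  have hl1 : l ≤ 1 := by rw [hl, div_le_one hbs]; linarith
  have e1 : (a - s) ^ μ ≤ (b - s) ^ μ * (1 - μ * l) := by
    have : a - s = (b - s) * (1 - l) := by rw [hl]; field_simp; ring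
    rw [this, Real.mul_rpow hbs.le (by linarith)]
    refine mul_le_mul_of_nonneg_left ?_ (by positivity)
    have := rpow_one_add_le_one_add_mul_self (s := -l) (by linarith) hμ0.le hμ1
    simpa [sub_eq_add_neg] using this
  have e2 : (b - s) ^ μ * (μ * l) ≤ (b - s) ^ μ - (a - s) ^ μ := by linarith
  have e3 : ((b - s) ^ μ * (μ * l)) ^ (1 + β) ≤ ((b - s) ^ μ - (a - s) ^ μ) ^ (1 + β) :=
    Real.rpow_le_rpow (by positivity) e2 (by linarith)
  have e4 : ((1 + β) / β) ^ (1 + β) * ((b - s) ^ μ * (μ * l)) ^ (1 + β) = l * (b - a) ^ β := by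
    rw [← Real.mul_rpow (by positivity) (by positivity)]
    have h1 : (1 + β) / β * ((b - s) ^ μ * (μ * l)) = (b - s) ^ μ * l := by
      rw [hμ]; field_simp
    have h2 : b - a = (b - s) * l := by rw [hl]; field_simp
    rw [h1, Real.mul_rpow (by positivity) hl0.le, ← Real.rpow_mul hbs.le,
      show μ * (1 + β) = β by rw [hμ]; field_simp, Real.rpow_add hl0, Real.rpow_one, h2,
      Real.mul_rpow hbs.le hl0.le]
    ring
  rw [← e4]
  exact mul_le_mul_of_nonneg_left e3 (by positivity)

theorem hasSewing_sew_of_singular [CompleteSpace W] {Ξ : ℝ → ℝ → W} {K β s t : ℝ}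
    (hst : s < t) (hβ : 0 < β) (hK : 0 ≤ K)
    (hδ : ∀ a m b, s ≤ a → a < m → m < b → b ≤ t →
      ‖Ξ a b - Ξ a m - Ξ m b‖ ≤ K * ((b - a) / (b - s) * (b - a) ^ β)) :
    HasSewing Ξ s t (sew Ξ s t) ∧ ‖sew Ξ s t - Ξ s t‖ ≤ singC β * K * (t - s) ^ β := by
  have hμ0 : 0 < β / (1 + β) := by positivity
  obtain ⟨L, hL, hb⟩ := exists_hasSewing (F := fun r => (r - s) ^ (β / (1 + β)))
    (K := K * ((1 + β) / β) ^ (1 + β)) hst (show 1 < 1 + β by linarith) (by positivity)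
    (fun a ha b _ h => Real.rpow_le_rpow (sub_nonneg.2 ha.1) (by linarith) hμ0.le)
    ((continuousOn_id.sub continuousOn_const).rpow_const fun _ _ => Or.inr hμ0.le)
    (fun a m b ha ham hmb hb => (hδ a m b ha ham hmb hb).trans (by
      rw [mul_assoc]
      exact mul_le_mul_of_nonneg_left (ratio_mul_rpow_le hβ ha (ham.trans hmb)) hK))
  rw [hL.sew_eq hst.le]
  refine ⟨hL, hb.trans (le_of_eq ?_)⟩
  rw [sub_self, Real.zero_rpow hμ0.ne', sub_zero, ← Real.rpow_mul (by linarith),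
    div_mul_cancel₀ _ (by positivity), singC]
  ring

end Sewing

/-! ### Functions of upper variables, singular at the lower variable -/

theorem ratio_nonneg {s p q : ℝ} (hs : s ≤ p) (hpq : p < q) : 0 ≤ (q - p) / (q - s) :=
  div_nonneg (by linarith) (by linarith)

theorem ratio_le_one {s p q : ℝ} (hs : s ≤ p) (hpq : p < q) : (q - p) / (q - s) ≤ 1 := by
  rw [div_le_one (by linarith)]
  linarith

theorem ratio_mono_start {s s' p q : ℝ} (hs : s ≤ s') (hs' : s' ≤ p) (hpq : p < q) :
    (q - p) / (q - s) ≤ (q - p) / (q - s') :=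
  div_le_div_of_nonneg_left (by linarith) (by linarith) (by linarith)

theorem ratio_mono_end {s a m b : ℝ} (hs : s ≤ a) (ham : a < m) (hmb : m ≤ b) :
    (m - a) / (m - s) ≤ (b - a) / (b - s) := by
  rw [div_le_div_iff₀ (by linarith) (by linarith)]
  nlinarith

theorem ratio_eq_mul {s a p q : ℝ} (hs : s ≤ a) (ha : a ≤ p) (hpq : p < q) :
    (q - p) / (q - s) = (q - p) / (q - a) * ((q - a) / (q - s)) := by
  have h1 : q - a ≠ 0 := by linarith
  have h2 : q - s ≠ 0 := by linarith
  field_simp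

section UpReg

variable {W : Type*} [NormedAddCommGroup W]

/-- The oscillation bound `‖Q q - Q p‖ ≤ M (q - p) / (q - s)` on `[s, U]`. -/
def UpOsc (s U M : ℝ) (Q : ℝ → W) : Prop :=
  ∀ p q, s ≤ p → p < q → q ≤ U → ‖Q q - Q p‖ ≤ M * ((q - p) / (q - s))

/-- Boundedness and regularity on `[s, U]` of a function which is singular at `s`. -/
structure UpReg (s U M : ℝ) (Q : ℝ → W) : Prop where
  bound : ∀ p, s ≤ p → p ≤ U → ‖Q p‖ ≤ M
  osc : UpOsc s U M Q

variable {s s' U U' M M' : ℝ} {Q Q' : ℝ → W}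

theorem UpOsc.mono (h : UpOsc s U M Q) (hM : M ≤ M') : UpOsc s U M' Q := fun p q hp hpq hq =>
  (h p q hp hpq hq).trans (mul_le_mul_of_nonneg_right hM (ratio_nonneg hp hpq))

theorem UpReg.mono (h : UpReg s U M Q) (hM : M ≤ M') : UpReg s U M' Q :=
  ⟨fun p hp hq => (h.bound p hp hq).trans hM, h.osc.mono hM⟩

theorem UpReg.nonneg (h : UpReg s U M Q) (hs : s ≤ U) : 0 ≤ M :=
  (norm_nonneg _).trans (h.bound s le_rfl hs)

theorem UpOsc.restrict (h : UpOsc s U M Q) (hM : 0 ≤ M) (hs : s ≤ s') (hU : U' ≤ U) :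
    UpOsc s' U' M Q := fun p q hp hpq hq =>
  (h p q (hs.trans hp) hpq (hq.trans hU)).trans
    (mul_le_mul_of_nonneg_left (ratio_mono_start hs hp hpq) hM)

theorem UpReg.restrict (h : UpReg s U M Q) (hs : s ≤ s') (hU : U' ≤ U) : UpReg s' U' M Q := by
  rcases le_or_gt s U with hsU | hsU
  · exact ⟨fun p hp hq => h.bound p (hs.trans hp) (hq.trans hU),
      h.osc.restrict (h.nonneg hsU) hs hU⟩
  · exact ⟨fun p hp hq => absurd (hp.trans hq) (by linarith),
      fun p q hp hpq hq => absurd (hp.trans (hpq.le.trans hq)) (by linarith)⟩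

theorem UpOsc.congr (h : UpOsc s U M Q) (hQ : ∀ p, s ≤ p → p ≤ U → Q p = Q' p) :
    UpOsc s U M Q' := fun p q hp hpq hq => by
  rw [← hQ p hp (by linarith), ← hQ q (by linarith) hq]
  exact h p q hp hpq hq

theorem UpReg.congr (h : UpReg s U M Q) (hQ : ∀ p, s ≤ p → p ≤ U → Q p = Q' p) :
    UpReg s U M Q' :=
  ⟨fun p hp hq => by rw [← hQ p hp hq]; exact h.bound p hp hq, h.osc.congr hQ⟩

theorem UpOsc.add (h : UpOsc s U M Q) (h' : UpOsc s U M' Q') :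
    UpOsc s U (M + M') (fun p => Q p + Q' p) := fun p q hp hpq hq => by
  rw [add_sub_add_comm, add_mul]
  exact norm_add_le_of_le (h p q hp hpq hq) (h' p q hp hpq hq)

theorem UpReg.add (h : UpReg s U M Q) (h' : UpReg s U M' Q') :
    UpReg s U (M + M') (fun p => Q p + Q' p) :=
  ⟨fun p hp hq => norm_add_le_of_le (h.bound p hp hq) (h'.bound p hp hq), h.osc.add h'.osc⟩

theorem UpReg.neg (h : UpReg s U M Q) : UpReg s U M (fun p => -Q p) :=
  ⟨fun p hp hq => by rw [norm_neg]; exact h.bound p hp hq, fun p q hp hpq hq => by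
    rw [← neg_sub_neg, neg_neg, neg_neg, ← norm_neg, neg_sub]
    exact h.osc p q hp hpq hq⟩

theorem UpReg.sub (h : UpReg s U M Q) (h' : UpReg s U M' Q') :
    UpReg s U (M + M') (fun p => Q p - Q' p) :=
  (h.add h'.neg).congr fun _ _ _ => (sub_eq_add_neg _ _).symm

theorem UpReg.zero (hM : 0 ≤ M) : UpReg s U M (fun _ => (0 : W)) :=
  ⟨fun _ _ _ => by simpa using hM, fun _ _ hp hpq _ => by
    simpa using mul_nonneg hM (ratio_nonneg hp hpq)⟩

theorem UpReg.const (w : W) : UpReg s U ‖w‖ (fun _ => w) :=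
  ⟨fun _ _ _ => le_rfl, fun p q hp hpq _ => by
    simpa using mul_nonneg (norm_nonneg w) (ratio_nonneg hp hpq)⟩

variable [NormedSpace ℝ W] {E V : Type*} [NormedAddCommGroup E] [NormedSpace ℝ E]
  [NormedAddCommGroup V] [NormedSpace ℝ V]

/-- Leibniz rule; the factor 2 counts the two terms of the oscillation. -/
theorem UpReg.clm_apply {P : ℝ → W →L[ℝ] V} (hP : UpReg s U M P) (hQ : UpReg s U M' Q) :
    UpReg s U (2 * M * M') (fun p => P p (Q p)) := by
  -- On an empty interval the constants may be negative, but everything is vacuous.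
  rcases lt_or_ge U s with hs | hs
  · exact ⟨fun p hp hq => absurd (hp.trans hq) (by linarith),
      fun p q hp hpq hq => absurd (hp.trans (hpq.le.trans hq)) (by linarith)⟩
  have hM := hP.nonneg hs
  have hM' := hQ.nonneg hs
  refine ⟨fun p hp hq => ?_, fun p q hp hpq hq => ?_⟩
  · have h1 : ‖P p (Q p)‖ ≤ M * M' := (P p).le_of_opNorm_le_of_le (hP.bound p hp hq)
      (hQ.bound p hp hq)
    nlinarith [mul_nonneg hM hM']
  · have e : P q (Q q) - P p (Q p) = P q (Q q - Q p) + (P q - P p) (Q p) := by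
      simp only [map_sub, sub_apply]; abel
    rw [e]
    have h1 : ‖P q (Q q - Q p)‖ ≤ M * (M' * ((q - p) / (q - s))) :=
      (P q).le_of_opNorm_le_of_le (hP.bound q (by linarith) hq) (hQ.osc p q hp hpq hq)
    have h2 : ‖(P q - P p) (Q p)‖ ≤ M * ((q - p) / (q - s)) * M' :=
      (P q - P p).le_of_opNorm_le_of_le (hP.osc p q hp hpq hq) (hQ.bound p hp (by linarith))
    calc _ ≤ _ := norm_add_le_of_le h1 h2
      _ = _ := by ring

/-- Regularity in two upper variables `q ≤ p`, including the mixed increments. -/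
structure UpReg₂ (s U M : ℝ) (φ : ℝ → ℝ → W) : Prop where
  upper : ∀ p, s ≤ p → p ≤ U → UpReg s p M (φ p)
  diff : ∀ p q, s ≤ p → p < q → q ≤ U →
    UpReg s p (M * ((q - p) / (q - s))) (fun r => φ q r - φ p r)

variable {φ φ' : ℝ → ℝ → W}

theorem UpReg₂.nonneg (h : UpReg₂ s U M φ) (hs : s ≤ U) : 0 ≤ M :=
  (h.upper s le_rfl hs).nonneg le_rfl

theorem UpReg₂.mono (h : UpReg₂ s U M φ) (hM : M ≤ M') : UpReg₂ s U M' φ :=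
  ⟨fun p hp hq => (h.upper p hp hq).mono hM, fun p q hp hpq hq => (h.diff p q hp hpq hq).mono
    (mul_le_mul_of_nonneg_right hM (ratio_nonneg hp hpq))⟩

theorem UpReg₂.restrict (h : UpReg₂ s U M φ) (hs : s ≤ s') (hU : U' ≤ U) : UpReg₂ s' U' M φ := by
  refine ⟨fun p hp hq => (h.upper p (hs.trans hp) (hq.trans hU)).restrict hs le_rfl,
    fun p q hp hpq hq => ((h.diff p q (hs.trans hp) hpq (hq.trans hU)).restrict hs le_rfl).mono
      (mul_le_mul_of_nonneg_left (ratio_mono_start hs hp hpq) (h.nonneg (by linarith)))⟩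

theorem UpReg₂.add (h : UpReg₂ s U M φ) (h' : UpReg₂ s U M' φ') :
    UpReg₂ s U (M + M') (fun p q => φ p q + φ' p q) :=
  ⟨fun p hp hq => (h.upper p hp hq).add (h'.upper p hp hq), fun p q hp hpq hq => by
    rw [add_mul]
    exact ((h.diff p q hp hpq hq).add (h'.diff p q hp hpq hq)).congr fun r _ _ => by abel⟩

theorem UpReg₂.congr (h : UpReg₂ s U M φ)
    (hφ : ∀ p q, s ≤ q → q ≤ p → p ≤ U → φ p q = φ' p q) : UpReg₂ s U M φ' :=
  ⟨fun p hp hq => (h.upper p hp hq).congr fun q h1 h2 => hφ p q h1 h2 hq,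
    fun p q hp hpq hq => (h.diff p q hp hpq hq).congr fun r h1 h2 => by
      rw [hφ q r h1 (by linarith) hq, hφ p r h1 h2 (by linarith)]⟩

/-- The two upper variables sit in different factors, so a mixed increment is the product of the two
increments. -/
theorem UpReg.comp₂ {P : ℝ → W →L[ℝ] V} {Q : ℝ → E →L[ℝ] W} (hP : UpReg s U M P)
    (hQ : UpReg s U M' Q) : UpReg₂ s U (M * M') (fun p q => (P p).comp (Q q)) := by
  refine ⟨fun p hp hq => ⟨fun r hr hrp => ?_, fun r r' hr hrr hrp => ?_⟩,
    fun p p' hp hpp hq => ⟨fun r hr hrp => ?_, fun r r' hr hrr hrp => ?_⟩⟩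
  · exact (ContinuousLinearMap.opNorm_comp_le _ _).trans (mul_le_mul (hP.bound p hp hq)
      (hQ.bound r hr (by linarith)) (norm_nonneg _) (hP.nonneg (by linarith)))
  · rw [← ContinuousLinearMap.comp_sub, mul_assoc]
    exact (ContinuousLinearMap.opNorm_comp_le _ _).trans (mul_le_mul (hP.bound p hp hq)
      (hQ.osc r r' hr hrr (by linarith)) (norm_nonneg _) (hP.nonneg (by linarith)))
  · rw [← ContinuousLinearMap.sub_comp, mul_right_comm]
    exact (ContinuousLinearMap.opNorm_comp_le _ _).trans (mul_le_mul (hP.osc p p' hp hpp hq)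
      (hQ.bound r hr (by linarith)) (norm_nonneg _)
      (mul_nonneg (hP.nonneg (by linarith)) (ratio_nonneg hp hpp)))
  · rw [← ContinuousLinearMap.sub_comp, ← ContinuousLinearMap.sub_comp,
      ← ContinuousLinearMap.comp_sub, mul_right_comm M, mul_assoc]
    exact (ContinuousLinearMap.opNorm_comp_le _ _).trans (mul_le_mul (hP.osc p p' hp hpp hq)
      (hQ.osc r r' hr hrr (by linarith)) (norm_nonneg _)
      (mul_nonneg (hP.nonneg (by linarith)) (ratio_nonneg hp hpp)))

theorem UpReg₂.norm_sub_diag_le (h : UpReg₂ s U M φ) {a b p q : ℝ} (hs : s ≤ a) (haq : a ≤ q)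
    (hqp : q ≤ p) (hpb : p ≤ b) (hab : a < b) (hb : b ≤ U) :
    ‖φ p q - φ a a‖ ≤ 2 * M * ((b - a) / (b - s)) := by
  have hM := h.nonneg (by linarith)
  have h0 : 0 ≤ M * ((b - a) / (b - s)) := mul_nonneg hM (ratio_nonneg hs hab)
  have h1 : ‖φ p q - φ p a‖ ≤ M * ((b - a) / (b - s)) := by
    rcases haq.eq_or_lt with rfl | haq
    · simpa using h0
    · exact ((h.upper p (by linarith) (by linarith)).osc a q hs haq hqp).trans
        (mul_le_mul_of_nonneg_left (ratio_mono_end hs haq (by linarith)) hM)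
  have h2 : ‖φ p a - φ a a‖ ≤ M * ((b - a) / (b - s)) := by
    rcases (haq.trans hqp).eq_or_lt with rfl | hap
    · simpa using h0
    · exact ((h.diff a p hs hap (by linarith)).bound a hs le_rfl).trans
        (mul_le_mul_of_nonneg_left (ratio_mono_end hs hap (by linarith)) hM)
  calc _ = ‖(φ p q - φ p a) + (φ p a - φ a a)‖ := by congr 1; abel
    _ ≤ _ := norm_add_le_of_le h1 h2
    _ = _ := by ring

/-- Subtracting the diagonal value moves the singularity from `s` to `a` and gains the factor
(b-a)/(b-s), because (q-p)/(q-s) is the product of (q-p)/(q-a) and (q-a)/(q-s). This gain makes the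
second order germ summable. -/
theorem UpReg₂.sub_diag (h : UpReg₂ s U M φ) {a b : ℝ} (hs : s ≤ a) (hab : a < b) (hb : b ≤ U) :
    UpReg₂ a b (2 * M * ((b - a) / (b - s))) (fun p q => φ p q - φ a a) := by
  have hM := h.nonneg (by linarith)
  have h0 : 0 ≤ M * ((b - a) / (b - s)) := mul_nonneg hM (ratio_nonneg hs hab)
  have key : ∀ p q, a ≤ p → p < q → q ≤ b →
      M * ((q - p) / (q - s)) ≤ 2 * M * ((b - a) / (b - s)) * ((q - p) / (q - a)) := by
    intro p q hp hpq hq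
    rw [ratio_eq_mul hs hp hpq]
    have h1 := ratio_mono_end (b := b) hs (show a < q by linarith) hq
    have h2 := ratio_nonneg hp hpq
    calc M * ((q - p) / (q - a) * ((q - a) / (q - s)))
        ≤ M * ((q - p) / (q - a) * ((b - a) / (b - s))) := by gcongr
      _ = 1 * (M * ((b - a) / (b - s)) * ((q - p) / (q - a))) := by ring
      _ ≤ 2 * (M * ((b - a) / (b - s)) * ((q - p) / (q - a))) :=
        mul_le_mul_of_nonneg_right one_le_two (mul_nonneg h0 h2)
      _ = _ := by ring
  refine ⟨fun p hp hpb => ⟨fun q hq hqp => h.norm_sub_diag_le hs hq hqp hpb hab hb,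
    fun q q' hq hqq hqp => ?_⟩, fun p p' hp hpp hpb => ⟨fun q hq hqp => ?_,
      fun q q' hq hqq hqp => ?_⟩⟩
  · rw [sub_sub_sub_cancel_right]
    exact ((h.upper p (by linarith) (by linarith)).osc q q' (by linarith) hqq hqp).trans
      (key q q' hq hqq (by linarith))
  · rw [sub_sub_sub_cancel_right]
    exact ((h.diff p p' (by linarith) hpp (by linarith)).bound q (by linarith) hqp).trans
      (key p p' hp hpp hpb)
  · simp only [sub_sub_sub_cancel_right]
    refine ((h.diff p p' (by linarith) hpp (by linarith)).osc q q' (by linarith) hqq hqp).trans ?_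
    exact mul_le_mul (key p p' hp hpp hpb) (ratio_mono_start hs hq hqq)
      (ratio_nonneg (by linarith) hqq) (mul_nonneg (mul_nonneg (by positivity)
        (ratio_nonneg hs hab)) (ratio_nonneg hp hpp))

end UpReg

/-! ### First order convolutions -/

section Conv

variable {E W : Type*} [NormedAddCommGroup E] [NormedSpace ℝ E]
  [NormedAddCommGroup W] [NormedSpace ℝ W]

/-- `ζ` is Hölder continuous on `[s, t]` of order `β`, with constant `Z`. -/
structure HolderInc (ζ : ℝ → E) (s t β Z : ℝ) : Prop where
  nonneg : 0 ≤ Z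
  bound : ∀ a b, s ≤ a → a < b → b ≤ t → ‖ζ b - ζ a‖ ≤ Z * (b - a) ^ β

theorem HolderInc.restrict {ζ : ℝ → E} {s t s' t' β Z : ℝ} (h : HolderInc ζ s t β Z)
    (hs : s ≤ s') (ht : t' ≤ t) : HolderInc ζ s' t' β Z :=
  ⟨h.nonneg, fun a b ha hab hb => h.bound a b (hs.trans ha) hab (hb.trans ht)⟩

/-- The convolution `∫_s^t Q dζ`. -/
noncomputable def conv (ζ : ℝ → E) (Q : ℝ → E →L[ℝ] W) (s t : ℝ) : W :=
  sew (fun a b => Q a (ζ b - ζ a)) s t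

/-- The inner convolution `z_{as}^p ∗ φ^{p,·}`. -/
noncomputable def innerConv (z : ℝ → ℝ → E) (φ : ℝ → ℝ → E →L[ℝ] W) (s a p : ℝ) : W :=
  conv (fun r => z r p) (φ p) s a

/-- The constant in the bound of a convolution. -/
noncomputable def convC (β : ℝ) : ℝ := 1 + singC β

theorem convC_pos {β : ℝ} (hβ : 0 < β) : 0 < convC β := by
  have := singC_nonneg hβ
  unfold convC
  linarith

theorem conv_self (ζ : ℝ → E) (Q : ℝ → E →L[ℝ] W) (s : ℝ) : conv ζ Q s s = 0 := sew_self _ _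

theorem conv_congr {ζ ζ' : ℝ → E} {Q Q' : ℝ → E →L[ℝ] W} {s t : ℝ}
    (hζ : ∀ a b, s ≤ a → a < b → b ≤ t → ζ b - ζ a = ζ' b - ζ' a)
    (hQ : ∀ a, s ≤ a → a ≤ t → Q a = Q' a) : conv ζ Q s t = conv ζ' Q' s t :=
  sew_congr fun a b ha hab hb => by rw [hζ a b ha hab hb, hQ a ha (by linarith)]

variable [CompleteSpace W] {ζ ζ' : ℝ → E} {Q Q' : ℝ → E →L[ℝ] W} {s t β Z Z' M M' : ℝ}

/-- The defect of the germ is `-(Q m - Q a) (ζ b - ζ m)`, of size (b-a)/(b-s) · (b-a)^β, which is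
what the singular sewing lemma accepts. No lower bound on β other than positivity is needed. -/
theorem conv_spec (hβ : 0 < β) (hst : s ≤ t) (hζ : HolderInc ζ s t β Z) (hQ : UpReg s t M Q) :
    HasSewing (fun a b => Q a (ζ b - ζ a)) s t (conv ζ Q s t) ∧
      ‖conv ζ Q s t‖ ≤ convC β * (M * Z * (t - s) ^ β) := by
  have hM := hQ.nonneg hst
  have hZ := hζ.nonneg
  rcases hst.eq_or_lt with rfl | hst
  · rw [conv_self]
    refine ⟨hasSewing_self _ _, ?_⟩
    rw [norm_zero, sub_self, Real.zero_rpow hβ.ne']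
    simp
  have key := hasSewing_sew_of_singular (Ξ := fun a b => Q a (ζ b - ζ a)) (K := M * Z) hst hβ
    (by positivity) (by
      intro a m b ha ham hmb hb
      have e : Q a (ζ b - ζ a) - Q a (ζ m - ζ a) - Q m (ζ b - ζ m) =
          -((Q m - Q a) (ζ b - ζ m)) := by
        simp only [map_sub, sub_apply]; abel
      rw [e, norm_neg]
      have h1 : ‖Q m - Q a‖ ≤ M * ((b - a) / (b - s)) :=
        (hQ.osc a m ha ham (by linarith)).trans
          (mul_le_mul_of_nonneg_left (ratio_mono_end ha ham hmb.le) hM)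
      have h2 : ‖ζ b - ζ m‖ ≤ Z * (b - a) ^ β :=
        (hζ.bound m b (by linarith) hmb hb).trans (mul_le_mul_of_nonneg_left
          (Real.rpow_le_rpow (by linarith) (by linarith) hβ.le) hZ)
      calc _ ≤ _ := (Q m - Q a).le_of_opNorm_le_of_le h1 h2
        _ = _ := by ring)
  refine ⟨key.1, ?_⟩
  have h1 : ‖Q s (ζ t - ζ s)‖ ≤ M * (Z * (t - s) ^ β) :=
    (Q s).le_of_opNorm_le_of_le (hQ.bound s le_rfl hst.le) (hζ.bound s t le_rfl hst le_rfl)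
  calc ‖conv ζ Q s t‖ = ‖(conv ζ Q s t - Q s (ζ t - ζ s)) + Q s (ζ t - ζ s)‖ := by
        rw [sub_add_cancel]
    _ ≤ _ := norm_add_le_of_le key.2 h1
    _ = _ := by rw [convC]; ring

theorem norm_conv_le (hβ : 0 < β) (hst : s ≤ t) (hζ : HolderInc ζ s t β Z) (hQ : UpReg s t M Q) :
    ‖conv ζ Q s t‖ ≤ convC β * (M * Z * (t - s) ^ β) := (conv_spec hβ hst hζ hQ).2

theorem conv_sub_right (hβ : 0 < β) (hst : s ≤ t) (hζ : HolderInc ζ s t β Z)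
    (hQ : UpReg s t M Q) (hQ' : UpReg s t M' Q') :
    conv ζ (fun p => Q p - Q' p) s t = conv ζ Q s t - conv ζ Q' s t :=
  HasSewing.sew_eq hst (((conv_spec hβ hst hζ hQ).1.sub (conv_spec hβ hst hζ hQ').1).congr
    fun a b _ _ _ => by simp)

theorem conv_sub_left (hβ : 0 < β) (hst : s ≤ t) (hζ : HolderInc ζ s t β Z)
    (hζ' : HolderInc ζ' s t β Z') (hQ : UpReg s t M Q) :
    conv (fun r => ζ r - ζ' r) Q s t = conv ζ Q s t - conv ζ' Q s t :=
  HasSewing.sew_eq hst (((conv_spec hβ hst hζ hQ).1.sub (conv_spec hβ hst hζ' hQ).1).congr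
    fun a b _ _ _ => by simp only [map_sub]; abel)

theorem conv_const (ζ : ℝ → E) (A : E →L[ℝ] W) (hst : s ≤ t) :
    conv ζ (fun _ => A) s t = A (ζ t - ζ s) :=
  HasSewing.sew_eq hst ((hasSewing_increment ζ s t).map A)

theorem conv_concat {m : ℝ} (hβ : 0 < β) (hsm : s ≤ m) (hmt : m ≤ t)
    (hζ : HolderInc ζ s t β Z) (hQ : UpReg s t M Q) :
    conv ζ Q s t = conv ζ Q s m + conv ζ Q m t :=
  (conv_spec hβ (hsm.trans hmt) hζ hQ).1.concat hsm hmt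
    (conv_spec hβ hsm (hζ.restrict le_rfl hmt) (hQ.restrict le_rfl hmt)).1
    (conv_spec hβ hmt (hζ.restrict hsm le_rfl) (hQ.restrict hsm le_rfl)).1

theorem clm_conv {W' : Type*} [NormedAddCommGroup W'] [NormedSpace ℝ W'] (hβ : 0 < β)
    (hst : s ≤ t) (hζ : HolderInc ζ s t β Z) (hQ : UpReg s t M Q) (A : W →L[ℝ] W') :
    conv ζ (fun q => A.comp (Q q)) s t = A (conv ζ Q s t) :=
  HasSewing.sew_eq hst ((conv_spec hβ hst hζ hQ).1.map A)

/-- Regularity of a Volterra path `z`, whose increments are of order `ρ` up to the diagonal. -/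
structure InnerDriver (z : ℝ → ℝ → E) (T ρ Z : ℝ) : Prop where
  exp_pos : 0 < ρ
  nonneg : 0 ≤ Z
  reg : ∀ a b, 0 ≤ a → a < b → b ≤ T → UpReg b T (Z * (b - a) ^ ρ) (incr z a b)

variable {z : ℝ → ℝ → E} {T ρ Z₀ : ℝ}

theorem InnerDriver.holder (hz : InnerDriver z T ρ Z₀) {p : ℝ} (hs : 0 ≤ s) (htp : t ≤ p)
    (hp : p ≤ T) : HolderInc (fun r => z r p) s t ρ Z₀ :=
  ⟨hz.nonneg, fun a b ha hab hb => (hz.reg a b (by linarith) hab (by linarith)).bound p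
    (by linarith) hp⟩

/-- Regularity in the upper variable becomes smallness of a Hölder constant: a change of upper
variable is a change of driver, to which the same convolution estimates apply. -/
theorem InnerDriver.holder_sub (hz : InnerDriver z T ρ Z₀) {p q : ℝ} (hs : 0 ≤ s) (htp : t ≤ p)
    (hpq : p < q) (hq : q ≤ T) :
    HolderInc (fun r => z r q - z r p) s t ρ (Z₀ * ((q - p) / (q - t))) := by
  refine ⟨mul_nonneg hz.nonneg (ratio_nonneg htp hpq), fun a b ha hab hb => ?_⟩
  have h := (hz.reg a b (by linarith) hab (by linarith)).osc p q (by linarith) hpq hq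
  have e : z b q - z b p - (z a q - z a p) = incr z a b q - incr z a b p := by
    simp only [incr]; abel
  rw [e]
  refine h.trans ?_
  have h1 := ratio_mono_start hb htp hpq
  have h2 : 0 ≤ (b - a) ^ ρ := Real.rpow_nonneg (by linarith) _
  have h3 := hz.nonneg
  calc _ ≤ Z₀ * (b - a) ^ ρ * ((q - p) / (q - t)) := by gcongr
    _ = _ := by ring

/-- The increment in the upper variable splits into a change of driver and a change of integrand,
each carrying the factor (q-p)/(q-m). The convolution is thus singular only at its right end `m`,
and can be integrated again over an interval starting there. -/
theorem InnerDriver.upReg_conv (hz : InnerDriver z T ρ Z₀) {a m U : ℝ}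
    {ψ : ℝ → ℝ → E →L[ℝ] W} (ha : 0 ≤ a) (ham : a ≤ m) (hU : U ≤ T)
    (hψ : ∀ p, m ≤ p → p ≤ U → UpReg a m M (ψ p))
    (hψ' : ∀ p q, m ≤ p → p < q → q ≤ U →
      UpReg a m (M * ((q - p) / (q - m))) (fun r => ψ q r - ψ p r)) :
    UpReg m U (2 * convC ρ * Z₀ * M * (m - a) ^ ρ)
      (fun p => conv (fun r => z r p) (ψ p) a m) := by
  have hρ := hz.exp_pos
  have hC := convC_pos hρ
  have hZ := hz.nonneg
  have hma : 0 ≤ (m - a) ^ ρ := Real.rpow_nonneg (by linarith) _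
  refine ⟨fun p hp hpU => ?_, fun p q hp hpq hq => ?_⟩
  · have hM := (hψ p hp hpU).nonneg ham
    refine (norm_conv_le hρ ham (hz.holder ha hp (by linarith)) (hψ p hp hpU)).trans ?_
    have : 0 ≤ convC ρ * (M * Z₀ * (m - a) ^ ρ) := by positivity
    linarith
  · have hM := (hψ q (by linarith) hq).nonneg ham
    have e : conv (fun r => z r q) (ψ q) a m - conv (fun r => z r p) (ψ p) a m =
        conv (fun r => z r q - z r p) (ψ q) a m +
          conv (fun r => z r p) (fun r => ψ q r - ψ p r) a m := by
      rw [conv_sub_left hρ ham (hz.holder ha (by linarith) (by linarith))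
        (hz.holder ha hp (by linarith)) (hψ q (by linarith) hq),
        conv_sub_right hρ ham (hz.holder ha hp (by linarith)) (hψ q (by linarith) hq)
          (hψ p hp (by linarith))]
      abel
    rw [e]
    refine (norm_add_le_of_le
      (norm_conv_le hρ ham (hz.holder_sub ha hp hpq (by linarith)) (hψ q (by linarith) hq))
      (norm_conv_le hρ ham (hz.holder ha hp (by linarith)) (hψ' p q hp hpq hq))).trans
        (le_of_eq ?_)
    ring

theorem InnerDriver.upReg_conv_const (hz : InnerDriver z T ρ Z₀) {a m U : ℝ} (ha : 0 ≤ a)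
    (ham : a ≤ m) (hU : U ≤ T) (hQ : UpReg a m M Q) :
    UpReg m U (2 * convC ρ * Z₀ * M * (m - a) ^ ρ) (fun p => conv (fun r => z r p) Q a m) :=
  hz.upReg_conv ha ham hU (fun _ _ _ => hQ) fun p q hp hpq _ => by
    simpa using UpReg.zero (mul_nonneg (hQ.nonneg ham) (ratio_nonneg hp hpq))

theorem InnerDriver.upReg_conv₂ (hz : InnerDriver z T ρ Z₀) {a m U : ℝ}
    {ψ : ℝ → ℝ → E →L[ℝ] W} (ha : 0 ≤ a) (ham : a ≤ m) (hU : U ≤ T) (hψ : UpReg₂ a U M ψ) :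
    UpReg m U (2 * convC ρ * Z₀ * M * (m - a) ^ ρ) (innerConv z ψ a m) :=
  hz.upReg_conv ha ham hU (fun p hp hpU => (hψ.upper p (by linarith) hpU).restrict le_rfl hp)
    fun p q hp hpq hq => ((hψ.diff p q (by linarith) hpq hq).restrict le_rfl hp).mono
      (mul_le_mul_of_nonneg_left (ratio_mono_start ham hp hpq) (hψ.nonneg (by linarith)))

end Conv

/-! ### The pairing with a tensor -/

section Pairing

variable {E W : Type*} [NormedAddCommGroup E] [NormedSpace ℝ E]
  [NormedAddCommGroup W] [NormedSpace ℝ W] [CompleteSpace W]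

/-- For the projective norm the lift of a multilinear map is isometric; density carries the bound to
the completion. -/
theorem norm_tensorPairing_apply_le (φ : E →L[ℝ] E →L[ℝ] W) (x : TensorSq E) :
    ‖tensorPairing φ x‖ ≤ ‖φ‖ * ‖x‖ := by
  have h1 : ‖swapMultilinear φ‖ ≤ ‖φ‖ := by
    refine ContinuousMultilinearMap.opNorm_le_bound φ.opNorm_nonneg fun m => ?_
    refine (φ.le_opNorm₂ (m 1) (m 0)).trans (le_of_eq ?_)
    rw [Fin.prod_univ_two]
    ring
  induction x using UniformSpace.Completion.induction_on with
  | hp => exact isClosed_le (by fun_prop) (by fun_prop)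
  | ih a =>
    rw [tensorPairing, ContinuousLinearMap.fromCompletion_apply_coe,
      UniformSpace.Completion.norm_coe]
    refine (ContinuousLinearMap.le_opNorm _ _).trans ?_
    rw [LinearIsometryEquiv.norm_map]
    exact mul_le_mul_of_nonneg_right h1 (norm_nonneg _)

theorem tensorPairing_sub_apply (φ ψ : E →L[ℝ] E →L[ℝ] W) (x : TensorSq E) :
    tensorPairing (φ - ψ) x = tensorPairing φ x - tensorPairing ψ x := by
  have h1 : swapMultilinear (φ - ψ) = swapMultilinear φ - swapMultilinear ψ := by
    ext m
    rfl
  induction x using UniformSpace.Completion.induction_on with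
  | hp => exact isClosed_eq (by fun_prop) (by fun_prop)
  | ih a =>
    simp only [tensorPairing, ContinuousLinearMap.fromCompletion_apply_coe, h1, map_sub,
      sub_apply]

end Pairing

/-! ### Second order convolutions -/

section ConvTwo

variable {E W : Type*} [NormedAddCommGroup E] [NormedSpace ℝ E]
  [NormedAddCommGroup W] [NormedSpace ℝ W]

/-- A pair `(ζ, ζ₂)` on `[s, t]` of orders `β` and `β + ρ` which satisfies the convolutional Chen
relation with the Volterra path `z`. -/
structure OuterDriver (z : ℝ → ℝ → E) (ρ s t β Z : ℝ) (ζ : ℝ → E) (ζ₂ : ℝ → ℝ → TensorSq E) :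
    Prop where
  holder : HolderInc ζ s t β Z
  bound₂ : ∀ a b, s ≤ a → a < b → b ≤ t → ‖ζ₂ a b‖ ≤ Z * (b - a) ^ (β + ρ)
  chen : ∀ a m b, s ≤ a → a < m → m < b → b ≤ t →
    HasSewing (fun u v => tensorRight (incr z a m u) (ζ v - ζ u)) m b
      (ζ₂ a b - ζ₂ m b - ζ₂ a m)

theorem OuterDriver.restrict {z : ℝ → ℝ → E} {ρ s t s' t' β Z : ℝ} {ζ : ℝ → E}
    {ζ₂ : ℝ → ℝ → TensorSq E} (h : OuterDriver z ρ s t β Z ζ ζ₂) (hs : s ≤ s') (ht : t' ≤ t) :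
    OuterDriver z ρ s' t' β Z ζ ζ₂ :=
  ⟨h.holder.restrict hs ht, fun a b ha hab hb => h.bound₂ a b (hs.trans ha) hab (hb.trans ht),
    fun a m b ha ham hmb hb => h.chen a m b (hs.trans ha) ham hmb (hb.trans ht)⟩

variable [CompleteSpace W]

/-- The germ of the second order convolution. -/
noncomputable def germ₂ (z : ℝ → ℝ → E) (ζ : ℝ → E) (ζ₂ : ℝ → ℝ → TensorSq E)
    (φ : ℝ → ℝ → E →L[ℝ] E →L[ℝ] W) (s a b : ℝ) : W :=
  tensorPairing (φ a a) (ζ₂ a b) + conv ζ (innerConv z φ s a) a b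

/-- The second order convolution. -/
noncomputable def conv₂ (z : ℝ → ℝ → E) (ζ : ℝ → E) (ζ₂ : ℝ → ℝ → TensorSq E)
    (φ : ℝ → ℝ → E →L[ℝ] E →L[ℝ] W) (s t : ℝ) : W :=
  sew (germ₂ z ζ ζ₂ φ s) s t

/-- The constant in the bound of a second order convolution. -/
noncomputable def conv₂C (β ρ Z₀ : ℝ) : ℝ :=
  1 + singC (β + ρ) * (2 + 4 * convC β * convC ρ * Z₀)

theorem conv₂C_pos {β ρ Z₀ : ℝ} (hβ : 0 < β) (hρ : 0 < ρ) (hZ : 0 ≤ Z₀) : 0 < conv₂C β ρ Z₀ := by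
  have h1 := singC_nonneg (add_pos hβ hρ)
  have h2 := convC_pos hβ
  have h3 := convC_pos hρ
  unfold conv₂C
  positivity

variable {z : ℝ → ℝ → E} {T ρ Z₀ : ℝ} {s t β Z Z' M M' : ℝ} {ζ ζ' : ℝ → E}
  {ζ₂ ζ₂' : ℝ → ℝ → TensorSq E} {φ φ' : ℝ → ℝ → E →L[ℝ] E →L[ℝ] W}

theorem innerConv_concat {φ : ℝ → ℝ → E →L[ℝ] W} (hz : InnerDriver z T ρ Z₀) (hs : 0 ≤ s)
    {a m p : ℝ} (hsa : s ≤ a) (ham : a ≤ m) (hmp : m ≤ p) (hp : p ≤ T)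
    (hφ : UpReg s m M (φ p)) :
    innerConv z φ s m p = innerConv z φ s a p + innerConv z φ a m p :=
  conv_concat hz.exp_pos hsa ham (hz.holder hs hmp hp) hφ

/-- Chen's relation, paired with the frozen value `φ a a`, produces exactly the convolution that
would appear if `φ` were constant on [a, m]. Only the deviations of `φ` from `φ a a` survive. -/
theorem germ₂_defect (hz : InnerDriver z T ρ Z₀) (hβ : 0 < β) (hs : 0 ≤ s) (ht : t ≤ T)
    (hζ : OuterDriver z ρ s t β Z ζ ζ₂) (hφ : UpReg₂ s t M φ) {a m b : ℝ} (ha : s ≤ a)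
    (ham : a < m) (hmb : m < b) (hb : b ≤ t) :
    germ₂ z ζ ζ₂ φ s a b - germ₂ z ζ ζ₂ φ s a m - germ₂ z ζ ζ₂ φ s m b =
      -tensorPairing (φ m m - φ a a) (ζ₂ m b) -
        conv ζ (innerConv z (fun p q => φ p q - φ a a) a m) m b := by
  have hρ := hz.exp_pos
  have hsa := hz.upReg_conv₂ (m := a) hs ha (by linarith) (hφ.restrict le_rfl hb)
  have hsm := hz.upReg_conv₂ (m := m) hs (by linarith) (by linarith) (hφ.restrict le_rfl hb)
  have hζab : HolderInc ζ a b β Z := hζ.holder.restrict ha hb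
  have hζmb : HolderInc ζ m b β Z := hζ.holder.restrict (by linarith) hb
  have hinc : UpReg m b _ (incr z a m) :=
    (hz.reg a m (by linarith) ham (by linarith)).restrict le_rfl (by linarith)
  have hcst : UpReg m b _ (fun p => φ a a (incr z a m p)) := (UpReg.const (φ a a)).clm_apply hinc
  -- Chen's relation, mapped through the pairing with the frozen value.
  have e1 : tensorPairing (φ a a) (ζ₂ a b - ζ₂ m b - ζ₂ a m) =
      conv ζ (fun p => φ a a (incr z a m p)) m b := by
    refine (HasSewing.sew_eq hmb.le ?_).symm
    refine ((hζ.chen a m b ha ham hmb hb).map (tensorPairing (φ a a))).congr ?_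
    intro u v _ _ _
    exact tensorPairing_tensorRight _ _ _
  have e2 : conv ζ (innerConv z φ s a) a b = conv ζ (innerConv z φ s a) a m +
      conv ζ (innerConv z φ s a) m b := conv_concat hβ ham.le hmb.le hζab hsa
  -- The inner convolution over [s, m] minus that over [s, a] is the one over [a, m], from which the
  -- frozen part is removed.
  have e3 : conv ζ (innerConv z (fun p q => φ p q - φ a a) a m) m b =
      conv ζ (innerConv z φ s m) m b - conv ζ (innerConv z φ s a) m b -
        conv ζ (fun p => φ a a (incr z a m p)) m b := by
    have hsa' : UpReg m b _ (innerConv z φ s a) := hsa.restrict ham.le le_rfl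
    rw [← conv_sub_right hβ hmb.le hζmb hsm hsa',
      ← conv_sub_right hβ hmb.le hζmb (hsm.sub hsa') hcst]
    refine conv_congr (fun _ _ _ _ _ => rfl) fun p hp hpb => ?_
    have hpU := hφ.upper p (by linarith) (by linarith)
    rw [innerConv, conv_sub_right hρ ham.le (hz.holder (by linarith) hp (by linarith))
      (hpU.restrict ha hp) (UpReg.const (φ a a)), conv_const _ _ ham.le]
    have := innerConv_concat (φ := φ) hz hs ha ham.le hp (by linarith) (hpU.restrict le_rfl hp)
    rw [this]
    simp only [incr, innerConv]
    abel
  rw [e3, ← e1]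
  simp only [germ₂]
  rw [e2, tensorPairing_sub_apply, map_sub, map_sub]
  abel

/-- Both terms of the defect contain a deviation from the diagonal, hence the factor (b-a)/(b-s);
the powers of the drivers multiply to order β + ρ. -/
theorem germ₂_defect_le (hz : InnerDriver z T ρ Z₀) (hβ : 0 < β) (hs : 0 ≤ s) (ht : t ≤ T)
    (hζ : OuterDriver z ρ s t β Z ζ ζ₂) (hφ : UpReg₂ s t M φ) {a m b : ℝ} (ha : s ≤ a)
    (ham : a < m) (hmb : m < b) (hb : b ≤ t) :
    ‖germ₂ z ζ ζ₂ φ s a b - germ₂ z ζ ζ₂ φ s a m - germ₂ z ζ ζ₂ φ s m b‖ ≤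
      ((2 + 4 * convC β * convC ρ * Z₀) * (M * Z)) *
        ((b - a) / (b - s) * (b - a) ^ (β + ρ)) := by
  have hρ := hz.exp_pos
  have hZ₀ := hz.nonneg
  have hZ := hζ.holder.nonneg
  have hM := hφ.nonneg (by linarith)
  have hCβ := convC_pos hβ
  have hCρ := convC_pos hρ
  have hl := ratio_nonneg ha (ham.trans hmb)
  have hba : 0 < b - a := by linarith
  rw [germ₂_defect hz hβ hs ht hζ hφ ha ham hmb hb, ← neg_add', norm_neg]
  have h1 : ‖tensorPairing (φ m m - φ a a) (ζ₂ m b)‖ ≤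
      2 * M * ((b - a) / (b - s)) * (Z * (b - a) ^ (β + ρ)) := by
    refine (norm_tensorPairing_apply_le _ _).trans (mul_le_mul
      (hφ.norm_sub_diag_le ha ham.le le_rfl hmb.le (ham.trans hmb) hb)
      ((hζ.bound₂ m b (by linarith) hmb hb).trans (mul_le_mul_of_nonneg_left
        (Real.rpow_le_rpow (by linarith) (by linarith) (by positivity)) hZ))
      (norm_nonneg _) (by positivity))
  have hψ := hφ.sub_diag ha (ham.trans hmb) hb
  have h2 := norm_conv_le hβ hmb.le (hζ.holder.restrict (by linarith) hb)
    (hz.upReg_conv₂ (m := m) (by linarith) ham.le (by linarith) hψ)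
  have h3 : (m - a) ^ ρ * (b - m) ^ β ≤ (b - a) ^ (β + ρ) := by
    rw [Real.rpow_add hba, mul_comm]
    exact mul_le_mul (Real.rpow_le_rpow (by linarith) (by linarith) hβ.le)
      (Real.rpow_le_rpow (by linarith) (by linarith) hρ.le)
      (Real.rpow_nonneg (by linarith) _) (by positivity)
  calc _ ≤ _ := norm_add_le_of_le h1 h2
    _ = 2 * M * ((b - a) / (b - s)) * (Z * (b - a) ^ (β + ρ)) +
        4 * convC β * convC ρ * Z₀ * (M * Z) * ((b - a) / (b - s)) *
          ((m - a) ^ ρ * (b - m) ^ β) := by ring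
    _ ≤ 2 * M * ((b - a) / (b - s)) * (Z * (b - a) ^ (β + ρ)) +
        4 * convC β * convC ρ * Z₀ * (M * Z) * ((b - a) / (b - s)) * (b - a) ^ (β + ρ) := by
      gcongr
    _ = _ := by ring

theorem innerConv_self (z : ℝ → ℝ → E) (φ : ℝ → ℝ → E →L[ℝ] W) (s p : ℝ) :
    innerConv z φ s s p = 0 := conv_self _ _ _

theorem conv₂_self : conv₂ z ζ ζ₂ φ s s = 0 := sew_self _ _

theorem germ₂_start (hst : s ≤ t) :
    germ₂ z ζ ζ₂ φ s s t = tensorPairing (φ s s) (ζ₂ s t) := by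
  have : conv ζ (innerConv z φ s s) s t = conv ζ (fun _ => 0) s t :=
    conv_congr (fun _ _ _ _ _ => rfl) fun p _ _ => innerConv_self _ _ _ _
  rw [germ₂, this, conv_const _ _ hst]
  simp

theorem conv₂_spec (hz : InnerDriver z T ρ Z₀) (hβ : 0 < β) (hs : 0 ≤ s) (hst : s ≤ t)
    (ht : t ≤ T) (hζ : OuterDriver z ρ s t β Z ζ ζ₂) (hφ : UpReg₂ s t M φ) :
    HasSewing (germ₂ z ζ ζ₂ φ s) s t (conv₂ z ζ ζ₂ φ s t) ∧
      ‖conv₂ z ζ ζ₂ φ s t‖ ≤ conv₂C β ρ Z₀ * (M * Z * (t - s) ^ (β + ρ)) := by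
  have hρ := hz.exp_pos
  have hZ₀ := hz.nonneg
  have hZ := hζ.holder.nonneg
  have hM := hφ.nonneg hst
  have hCβ := convC_pos hβ
  have hCρ := convC_pos hρ
  rcases hst.eq_or_lt with rfl | hst
  · rw [conv₂_self]
    refine ⟨hasSewing_self _ _, ?_⟩
    rw [norm_zero, sub_self, Real.zero_rpow (by positivity)]
    simp
  have key := hasSewing_sew_of_singular (Ξ := germ₂ z ζ ζ₂ φ s)
    (K := (2 + 4 * convC β * convC ρ * Z₀) * (M * Z)) hst (add_pos hβ hρ) (by positivity)
    fun a m b ha ham hmb hb => germ₂_defect_le hz hβ hs ht hζ hφ ha ham hmb hb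
  refine ⟨key.1, ?_⟩
  have h1 : ‖germ₂ z ζ ζ₂ φ s s t‖ ≤ M * (Z * (t - s) ^ (β + ρ)) := by
    rw [germ₂_start hst.le]
    exact (norm_tensorPairing_apply_le _ _).trans (mul_le_mul
      ((hφ.upper s le_rfl hst.le).bound s le_rfl le_rfl) (hζ.bound₂ s t le_rfl hst le_rfl)
      (norm_nonneg _) hM)
  calc ‖conv₂ z ζ ζ₂ φ s t‖
      = ‖(conv₂ z ζ ζ₂ φ s t - germ₂ z ζ ζ₂ φ s s t) + germ₂ z ζ ζ₂ φ s s t‖ := by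
        rw [sub_add_cancel]
    _ ≤ _ := norm_add_le_of_le key.2 h1
    _ = _ := by rw [conv₂C]; ring

theorem innerConv_sub {φ φ' : ℝ → ℝ → E →L[ℝ] W} (hz : InnerDriver z T ρ Z₀) (hs : 0 ≤ s)
    {a p : ℝ} (hsa : s ≤ a) (hap : a ≤ p) (hp : p ≤ T) (hφ : UpReg s a M (φ p))
    (hφ' : UpReg s a M' (φ' p)) :
    innerConv z (fun p q => φ p q - φ' p q) s a p = innerConv z φ s a p - innerConv z φ' s a p :=
  conv_sub_right hz.exp_pos hsa (hz.holder hs hap hp) hφ hφ'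

theorem conv₂_sub (hz : InnerDriver z T ρ Z₀) (hβ : 0 < β) (hs : 0 ≤ s) (hst : s ≤ t)
    (ht : t ≤ T) (hζ : OuterDriver z ρ s t β Z ζ ζ₂) (hφ : UpReg₂ s t M φ)
    (hφ' : UpReg₂ s t M' φ') :
    conv₂ z ζ ζ₂ (fun p q => φ p q - φ' p q) s t =
      conv₂ z ζ ζ₂ φ s t - conv₂ z ζ ζ₂ φ' s t := by
  refine HasSewing.sew_eq hst (((conv₂_spec hz hβ hs hst ht hζ hφ).1.sub
    (conv₂_spec hz hβ hs hst ht hζ hφ').1).congr fun a b ha hab hb => ?_)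
  simp only [germ₂]
  have h1 := hz.upReg_conv₂ (m := a) (U := b) hs ha (by linarith) (hφ.restrict le_rfl hb)
  have h2 := hz.upReg_conv₂ (m := a) (U := b) hs ha (by linarith) (hφ'.restrict le_rfl hb)
  have e : conv ζ (innerConv z (fun p q => φ p q - φ' p q) s a) a b =
      conv ζ (innerConv z φ s a) a b - conv ζ (innerConv z φ' s a) a b := by
    rw [← conv_sub_right hβ hab.le (hζ.holder.restrict ha hb) h1 h2]
    refine conv_congr (fun _ _ _ _ _ => rfl) fun p hp hpb => ?_
    exact innerConv_sub hz hs ha hp (by linarith)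
      ((hφ.upper p (by linarith) (by linarith)).restrict le_rfl hp)
      ((hφ'.upper p (by linarith) (by linarith)).restrict le_rfl hp)
  rw [e, tensorPairing_sub_apply]
  abel

/-- Linearity in the outer pair only, the inner path `z` being fixed. It turns increments in the
outer upper variable into convolutions with a small driver. -/
theorem conv₂_driver_sub (hz : InnerDriver z T ρ Z₀) (hβ : 0 < β) (hs : 0 ≤ s) (hst : s ≤ t)
    (ht : t ≤ T) (hζ : OuterDriver z ρ s t β Z ζ ζ₂) (hζ' : OuterDriver z ρ s t β Z' ζ' ζ₂')
    (hφ : UpReg₂ s t M φ) :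
    conv₂ z (fun r => ζ r - ζ' r) (fun a b => ζ₂ a b - ζ₂' a b) φ s t =
      conv₂ z ζ ζ₂ φ s t - conv₂ z ζ' ζ₂' φ s t := by
  refine HasSewing.sew_eq hst (((conv₂_spec hz hβ hs hst ht hζ hφ).1.sub
    (conv₂_spec hz hβ hs hst ht hζ' hφ).1).congr fun a b ha hab hb => ?_)
  simp only [germ₂]
  have h1 := hz.upReg_conv₂ (m := a) (U := b) hs ha (by linarith) (hφ.restrict le_rfl hb)
  rw [conv_sub_left hβ hab.le (hζ.holder.restrict ha hb) (hζ'.holder.restrict ha hb) h1, map_sub]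
  abel

/-- On [m, t] the germs based at `s` and at `m` differ by `conv ζ (innerConv z φ s m) a b`, which is
additive in the interval and so survives unchanged in the limit. -/
theorem conv₂_chen (hz : InnerDriver z T ρ Z₀) (hβ : 0 < β) (hs : 0 ≤ s) {m : ℝ} (hsm : s ≤ m)
    (hmt : m ≤ t) (ht : t ≤ T) (hζ : OuterDriver z ρ s t β Z ζ ζ₂) (hφ : UpReg₂ s t M φ) :
    conv₂ z ζ ζ₂ φ s t = conv₂ z ζ ζ₂ φ s m + conv₂ z ζ ζ₂ φ m t +
      conv ζ (innerConv z φ s m) m t := by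
  have h1 := hz.upReg_conv₂ (m := m) hs hsm ht hφ
  have h2 : HasSewing (germ₂ z ζ ζ₂ φ s) m t
      (conv₂ z ζ ζ₂ φ m t + conv ζ (innerConv z φ s m) m t) := by
    have k1 := (conv₂_spec hz hβ (hs.trans hsm) hmt ht (hζ.restrict hsm le_rfl)
      (hφ.restrict hsm le_rfl)).1
    -- An additive germ has telescoping sums, all equal to its value on the whole interval.
    have k2 : HasSewing (fun a b => conv ζ (innerConv z φ s m) a b) m t
        (conv ζ (innerConv z φ s m) m t) := by
      have := hasSewing_increment (fun r => conv ζ (innerConv z φ s m) m r) m t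
      rw [conv_self, sub_zero] at this
      refine this.congr fun a b ha hab hb => ?_
      rw [conv_concat (m := a) (t := b) hβ ha hab.le (hζ.holder.restrict hsm hb)
        (h1.restrict le_rfl hb)]
      abel
    refine (k1.add k2).congr fun a b ha hab hb => ?_
    have h3 := hz.upReg_conv₂ (m := a) (U := b) (by linarith) ha (by linarith)
      (hφ.restrict hsm hb)
    have h4 := hz.upReg_conv₂ (m := a) (U := b) hs (by linarith) (by linarith)
      (hφ.restrict le_rfl hb)
    have e : conv ζ (innerConv z φ s m) a b =
        conv ζ (innerConv z φ s a) a b - conv ζ (innerConv z φ m a) a b := by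
      rw [← conv_sub_right hβ hab.le (hζ.holder.restrict (by linarith) hb) h4 h3]
      refine conv_congr (fun _ _ _ _ _ => rfl) fun p hp hpb => ?_
      have := innerConv_concat (φ := φ) hz hs hsm ha hp (by linarith)
        ((hφ.upper p (by linarith) (by linarith)).restrict le_rfl hp)
      rw [this]
      abel
    simp only [germ₂]
    rw [e]
    abel
  have h3 := (conv₂_spec hz hβ hs (hsm.trans hmt) ht hζ hφ).1.concat hsm hmt
    (conv₂_spec hz hβ hs hsm (by linarith) (hζ.restrict le_rfl hmt) (hφ.restrict le_rfl hmt)).1 h2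
  rw [h3]
  abel

end ConvTwo

/-! ### The rough Volterra integral -/

section RoughIntegral

variable {E V : Type*} [NormedAddCommGroup E] [NormedSpace ℝ E]
  [NormedAddCommGroup V] [NormedSpace ℝ V] [CompleteSpace V]

/-- Admissible integrands `(G, φ)` for the rough Volterra integral on `[σ, S]`. The conditions are
linear in `(G, φ)`. -/
structure IntData (z : ℝ → ℝ → E) (ρ σ S N : ℝ) (G : ℝ → ℝ → E →L[ℝ] V)
    (φ : ℝ → ℝ → ℝ → E →L[ℝ] E →L[ℝ] V) : Prop where
  reg : ∀ u, σ ≤ u → u ≤ S → UpReg u S N (G u)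
  reg₂ : ∀ u, σ ≤ u → u ≤ S → UpReg₂ u S N (φ u)
  remainder : ∀ u m, σ ≤ u → u < m → m ≤ S → UpReg m S (N * (m - u) ^ (2 * ρ))
    (fun p => G m p - G u p - innerConv z (φ u) u m p)
  incr₂ : ∀ u m, σ ≤ u → u < m → m ≤ S → UpReg₂ m S (N * (m - u) ^ ρ)
    (fun p q => φ m p q - φ u p q)

/-- The germ of the rough Volterra integral. -/
noncomputable def roughGerm (z : ℝ → ℝ → E) (ζ : ℝ → E) (ζ₂ : ℝ → ℝ → TensorSq E)
    (G : ℝ → ℝ → E →L[ℝ] V) (φ : ℝ → ℝ → ℝ → E →L[ℝ] E →L[ℝ] V) (u v : ℝ) : V :=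
  conv ζ (G u) u v + conv₂ z ζ ζ₂ (φ u) u v

/-- The rough Volterra integral. -/
noncomputable def roughInt (z : ℝ → ℝ → E) (ζ : ℝ → E) (ζ₂ : ℝ → ℝ → TensorSq E)
    (G : ℝ → ℝ → E →L[ℝ] V) (φ : ℝ → ℝ → ℝ → E →L[ℝ] E →L[ℝ] V) (s t : ℝ) : V :=
  sew (roughGerm z ζ ζ₂ G φ) s t

/-- The constant in the remainder bound of the rough Volterra integral. -/
noncomputable def roughC (β ρ Z₀ : ℝ) : ℝ :=
  youngC (β + 2 * ρ) * (convC β + conv₂C β ρ Z₀)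

theorem roughC_pos {β ρ Z₀ : ℝ} (hβ : 0 < β) (hρ : 0 < ρ) (hβρ : 1 < β + 2 * ρ) (hZ : 0 ≤ Z₀) :
    0 < roughC β ρ Z₀ :=
  mul_pos (youngC_pos hβρ) (add_pos (convC_pos hβ) (conv₂C_pos hβ hρ hZ))

variable {z : ℝ → ℝ → E} {T ρ Z₀ : ℝ} {σ S s t β Z Z' N N' : ℝ} {ζ ζ' : ℝ → E}
  {ζ₂ ζ₂' : ℝ → ℝ → TensorSq E} {G G' : ℝ → ℝ → E →L[ℝ] V}
  {φ φ' : ℝ → ℝ → ℝ → E →L[ℝ] E →L[ℝ] V}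

theorem IntData.nonneg (h : IntData z ρ σ S N G φ) (hσ : σ ≤ S) : 0 ≤ N :=
  (h.reg σ le_rfl hσ).nonneg hσ

theorem IntData.restrict (h : IntData z ρ σ S N G φ) (hs : σ ≤ s) (ht : t ≤ S) :
    IntData z ρ s t N G φ :=
  ⟨fun u h1 h2 => (h.reg u (by linarith) (by linarith)).restrict le_rfl ht,
    fun u h1 h2 => (h.reg₂ u (by linarith) (by linarith)).restrict le_rfl ht,
    fun u m h1 h2 h3 => (h.remainder u m (by linarith) h2 (by linarith)).restrict le_rfl ht,
    fun u m h1 h2 h3 => (h.incr₂ u m (by linarith) h2 (by linarith)).restrict le_rfl ht⟩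

/-- The cross term of `conv₂_chen` combines with the increment of `G` into the controlled remainder
of `G`; what else is left is the increment of `φ` under the second order convolution. -/
theorem roughGerm_defect (hz : InnerDriver z T ρ Z₀) (hβ : 0 < β) (hs : 0 ≤ s) (ht : t ≤ T)
    (hζ : OuterDriver z ρ s t β Z ζ ζ₂) (h : IntData z ρ s t N G φ) {u m v : ℝ} (hu : s ≤ u)
    (hum : u < m) (hmv : m < v) (hv : v ≤ t) :
    roughGerm z ζ ζ₂ G φ u v - roughGerm z ζ ζ₂ G φ u m - roughGerm z ζ ζ₂ G φ m v =
      -(conv ζ (fun p => G m p - G u p - innerConv z (φ u) u m p) m v +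
        conv₂ z ζ ζ₂ (fun p q => φ m p q - φ u p q) m v) := by
  have hζuv := hζ.restrict hu hv
  have hζmv := hζ.restrict (s' := m) (t' := v) (by linarith) hv
  have hGu := (h.reg u hu (by linarith)).restrict (le_refl u) hv
  have hGm := (h.reg m (by linarith) (by linarith)).restrict (le_refl m) hv
  have hφu := (h.reg₂ u hu (by linarith)).restrict (le_refl u) hv
  have hφm := (h.reg₂ m (by linarith) (by linarith)).restrict (le_refl m) hv
  have hin := hz.upReg_conv₂ (m := m) (U := v) (by linarith) hum.le (by linarith) hφu
  have hGu' := hGu.restrict hum.le le_rfl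
  rw [conv_sub_right hβ hmv.le hζmv.holder (hGm.sub hGu') hin,
    conv_sub_right hβ hmv.le hζmv.holder hGm hGu',
    conv₂_sub hz hβ (by linarith) hmv.le (by linarith) hζmv hφm (hφu.restrict hum.le le_rfl)]
  simp only [roughGerm]
  rw [conv_concat hβ hum.le hmv.le hζuv.holder hGu,
    conv₂_chen hz hβ (by linarith) hum.le hmv.le (by linarith) hζuv hφu]
  change _ = -(_ - _ - conv ζ (innerConv z (φ u) u m) m v + _)
  abel

/-- A remainder of order 2ρ meets a driver of order β, and an increment of order ρ meets one of
order β + ρ: both terms have order β + 2ρ. -/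
theorem roughGerm_defect_le (hz : InnerDriver z T ρ Z₀) (hβ : 0 < β) (hs : 0 ≤ s) (ht : t ≤ T)
    (hζ : OuterDriver z ρ s t β Z ζ ζ₂) (h : IntData z ρ s t N G φ) {u m v : ℝ} (hu : s ≤ u)
    (hum : u < m) (hmv : m < v) (hv : v ≤ t) :
    ‖roughGerm z ζ ζ₂ G φ u v - roughGerm z ζ ζ₂ G φ u m - roughGerm z ζ ζ₂ G φ m v‖ ≤
      (convC β + conv₂C β ρ Z₀) * (N * Z) * (v - u) ^ (β + 2 * ρ) := by
  have hρ := hz.exp_pos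
  have hZ := hζ.holder.nonneg
  have hN := h.nonneg (by linarith)
  have hζmv := hζ.restrict (s' := m) (t' := v) (by linarith) hv
  have hC1 := convC_pos hβ
  have hC2 := conv₂C_pos hβ hρ hz.nonneg
  have hvu : 0 < v - u := by linarith
  have hpow : ∀ {x y e : ℝ}, 0 ≤ x → x ≤ y → 0 ≤ e → x ^ e ≤ y ^ e := fun h0 hxy he =>
    Real.rpow_le_rpow h0 hxy he
  rw [roughGerm_defect hz hβ hs ht hζ h hu hum hmv hv, norm_neg]
  have h1 := norm_conv_le hβ hmv.le hζmv.holder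
    ((h.remainder u m hu hum (by linarith)).restrict (le_refl m) hv)
  have h2 := (conv₂_spec hz hβ (by linarith) hmv.le (by linarith) hζmv
    ((h.incr₂ u m hu hum (by linarith)).restrict (le_refl m) hv)).2
  have e1 : (m - u) ^ (2 * ρ) * (v - m) ^ β ≤ (v - u) ^ (β + 2 * ρ) := by
    rw [Real.rpow_add hvu, mul_comm]
    exact mul_le_mul (hpow (by linarith) (by linarith) hβ.le)
      (hpow (by linarith) (by linarith) (by positivity)) (Real.rpow_nonneg (by linarith) _)
      (by positivity)
  have e2 : (m - u) ^ ρ * (v - m) ^ (β + ρ) ≤ (v - u) ^ (β + 2 * ρ) := by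
    rw [show β + 2 * ρ = ρ + (β + ρ) by ring, Real.rpow_add hvu]
    exact mul_le_mul (hpow (by linarith) (by linarith) hρ.le)
      (hpow (by linarith) (by linarith) (by positivity)) (Real.rpow_nonneg (by linarith) _)
      (by positivity)
  calc _ ≤ _ := norm_add_le_of_le h1 h2
    _ = convC β * (N * Z) * ((m - u) ^ (2 * ρ) * (v - m) ^ β) +
        conv₂C β ρ Z₀ * (N * Z) * ((m - u) ^ ρ * (v - m) ^ (β + ρ)) := by ring
    _ ≤ convC β * (N * Z) * (v - u) ^ (β + 2 * ρ) +
        conv₂C β ρ Z₀ * (N * Z) * (v - u) ^ (β + 2 * ρ) := by gcongr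
    _ = _ := by ring

theorem roughGerm_self : roughGerm z ζ ζ₂ G φ s s = 0 := by
  rw [roughGerm, conv_self, conv₂_self, add_zero]

theorem roughInt_self : roughInt z ζ ζ₂ G φ s s = 0 := sew_self _ _

theorem roughInt_spec (hz : InnerDriver z T ρ Z₀) (hβ : 0 < β) (hβρ : 1 < β + 2 * ρ)
    (hs : 0 ≤ s) (hst : s ≤ t) (ht : t ≤ T) (hζ : OuterDriver z ρ s t β Z ζ ζ₂)
    (h : IntData z ρ s t N G φ) :
    HasSewing (roughGerm z ζ ζ₂ G φ) s t (roughInt z ζ ζ₂ G φ s t) ∧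
      ‖roughInt z ζ ζ₂ G φ s t - roughGerm z ζ ζ₂ G φ s t‖ ≤
        roughC β ρ Z₀ * (N * Z * (t - s) ^ (β + 2 * ρ)) := by
  have hZ := hζ.holder.nonneg
  have hN := h.nonneg hst
  have hC1 := convC_pos hβ
  have hC2 := conv₂C_pos hβ hz.exp_pos hz.nonneg
  rcases hst.eq_or_lt with rfl | hst
  · rw [roughInt_self, roughGerm_self]
    refine ⟨hasSewing_self _ _, ?_⟩
    rw [sub_self, norm_zero, sub_self, Real.zero_rpow (by linarith)]
    simp
  have key := hasSewing_sew_of_regular (Ξ := roughGerm z ζ ζ₂ G φ)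
    (K := (convC β + conv₂C β ρ Z₀) * (N * Z)) hst hβρ (by positivity)
    fun a m b ha ham hmb hb => roughGerm_defect_le hz hβ hs ht hζ h ha ham hmb hb
  refine ⟨key.1, key.2.trans (le_of_eq ?_)⟩
  rw [roughC]
  ring

theorem roughInt_concat (hz : InnerDriver z T ρ Z₀) (hβ : 0 < β) (hβρ : 1 < β + 2 * ρ) {m : ℝ}
    (hs : 0 ≤ s) (hsm : s ≤ m) (hmt : m ≤ t) (ht : t ≤ T) (hζ : OuterDriver z ρ s t β Z ζ ζ₂)
    (h : IntData z ρ s t N G φ) :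
    roughInt z ζ ζ₂ G φ s t = roughInt z ζ ζ₂ G φ s m + roughInt z ζ ζ₂ G φ m t :=
  (roughInt_spec hz hβ hβρ hs (hsm.trans hmt) ht hζ h).1.concat hsm hmt
    (roughInt_spec hz hβ hβρ hs hsm (hmt.trans ht) (hζ.restrict le_rfl hmt)
      (h.restrict le_rfl hmt)).1
    (roughInt_spec hz hβ hβρ (hs.trans hsm) hmt ht (hζ.restrict hsm le_rfl)
      (h.restrict hsm le_rfl)).1

theorem roughGerm_sub (hz : InnerDriver z T ρ Z₀) (hβ : 0 < β) (hs : 0 ≤ s) (hst : s ≤ t)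
    (ht : t ≤ T) (hζ : OuterDriver z ρ s t β Z ζ ζ₂) (h : IntData z ρ s t N G φ)
    (h' : IntData z ρ s t N' G' φ') :
    roughGerm z ζ ζ₂ (fun u p => G u p - G' u p) (fun u p q => φ u p q - φ' u p q) s t =
      roughGerm z ζ ζ₂ G φ s t - roughGerm z ζ ζ₂ G' φ' s t := by
  simp only [roughGerm]
  rw [conv_sub_right hβ hst hζ.holder (h.reg s le_rfl hst) (h'.reg s le_rfl hst),
    conv₂_sub hz hβ hs hst ht hζ (h.reg₂ s le_rfl hst) (h'.reg₂ s le_rfl hst)]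
  abel

theorem roughInt_sub (hz : InnerDriver z T ρ Z₀) (hβ : 0 < β) (hβρ : 1 < β + 2 * ρ) (hs : 0 ≤ s)
    (hst : s ≤ t) (ht : t ≤ T) (hζ : OuterDriver z ρ s t β Z ζ ζ₂) (h : IntData z ρ s t N G φ)
    (h' : IntData z ρ s t N' G' φ') :
    roughInt z ζ ζ₂ (fun u p => G u p - G' u p) (fun u p q => φ u p q - φ' u p q) s t =
      roughInt z ζ ζ₂ G φ s t - roughInt z ζ ζ₂ G' φ' s t :=
  HasSewing.sew_eq hst (((roughInt_spec hz hβ hβρ hs hst ht hζ h).1.sub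
    (roughInt_spec hz hβ hβρ hs hst ht hζ h').1).congr fun _ _ ha hab hb =>
      (roughGerm_sub hz hβ (hs.trans ha) hab.le (hb.trans ht) (hζ.restrict ha hb)
        (h.restrict ha hb) (h'.restrict ha hb)).symm)

theorem roughGerm_driver_sub (hz : InnerDriver z T ρ Z₀) (hβ : 0 < β) (hs : 0 ≤ s) (hst : s ≤ t)
    (ht : t ≤ T) (hζ : OuterDriver z ρ s t β Z ζ ζ₂) (hζ' : OuterDriver z ρ s t β Z' ζ' ζ₂')
    (h : IntData z ρ s t N G φ) :
    roughGerm z (fun r => ζ r - ζ' r) (fun a b => ζ₂ a b - ζ₂' a b) G φ s t =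
      roughGerm z ζ ζ₂ G φ s t - roughGerm z ζ' ζ₂' G φ s t := by
  simp only [roughGerm]
  rw [conv_sub_left hβ hst hζ.holder hζ'.holder (h.reg s le_rfl hst),
    conv₂_driver_sub hz hβ hs hst ht hζ hζ' (h.reg₂ s le_rfl hst)]
  abel

theorem roughInt_driver_sub (hz : InnerDriver z T ρ Z₀) (hβ : 0 < β) (hβρ : 1 < β + 2 * ρ)
    (hs : 0 ≤ s) (hst : s ≤ t) (ht : t ≤ T) (hζ : OuterDriver z ρ s t β Z ζ ζ₂)
    (hζ' : OuterDriver z ρ s t β Z' ζ' ζ₂') (h : IntData z ρ s t N G φ) :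
    roughInt z (fun r => ζ r - ζ' r) (fun a b => ζ₂ a b - ζ₂' a b) G φ s t =
      roughInt z ζ ζ₂ G φ s t - roughInt z ζ' ζ₂' G φ s t :=
  HasSewing.sew_eq hst (((roughInt_spec hz hβ hβρ hs hst ht hζ h).1.sub
    (roughInt_spec hz hβ hβρ hs hst ht hζ' h).1).congr fun _ _ ha hab hb =>
      (roughGerm_driver_sub hz hβ (hs.trans ha) hab.le (hb.trans ht) (hζ.restrict ha hb)
        (hζ'.restrict ha hb) (h.restrict ha hb)).symm)

end RoughIntegral

/-! ### Composition with smooth functions -/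

section Composition

variable {X W : Type*} [NormedAddCommGroup X] [NormedSpace ℝ X] [NormedAddCommGroup W]
  [NormedSpace ℝ W]

/-- `g` is bounded and Lipschitz, and its second differences are controlled, with constant `L`. -/
structure LipTwo (L : ℝ) (g : X → W) : Prop where
  bound : ∀ x, ‖g x‖ ≤ L
  lip : ∀ x y, ‖g x - g y‖ ≤ L * ‖x - y‖
  second : ∀ x x' w w', ‖g x - g x' - (g w - g w')‖ ≤
    L * (‖x - x' - (w - w')‖ + (‖x - w‖ + ‖x' - w'‖) * ‖w - w'‖)

variable {L : ℝ} {g : X → W}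

theorem LipTwo.nonneg (h : LipTwo L g) : 0 ≤ L := (norm_nonneg _).trans (h.bound 0)

theorem LipTwo.mono {L' : ℝ} (h : LipTwo L g) (hL : L ≤ L') : LipTwo L' g :=
  ⟨fun x => (h.bound x).trans hL,
    fun x y => (h.lip x y).trans (mul_le_mul_of_nonneg_right hL (norm_nonneg _)),
    fun x x' w w' => (h.second x x' w w').trans (mul_le_mul_of_nonneg_right hL (by positivity))⟩

theorem LipTwo.continuous (h : LipTwo L g) : Continuous g :=
  (LipschitzWith.of_dist_le' (K := L) fun x y => by
    simpa only [dist_eq_norm] using h.lip x y).continuous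

theorem LipTwo.upReg_comp (h : LipTwo L g) {s U K : ℝ} (hK : 0 ≤ K) {A : ℝ → X}
    (hA : UpOsc s U K A) : UpReg s U (L * (1 + K)) (fun p => g (A p)) := by
  have hL := h.nonneg
  refine ⟨fun p _ _ => (h.bound _).trans (by nlinarith), fun p q hp hpq hq => ?_⟩
  have hr := ratio_nonneg hp hpq
  calc _ ≤ L * ‖A q - A p‖ := h.lip _ _
    _ ≤ L * (K * ((q - p) / (q - s))) := mul_le_mul_of_nonneg_left (hA p q hp hpq hq) hL
    _ = L * K * ((q - p) / (q - s)) := by ring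
    _ ≤ _ := mul_le_mul_of_nonneg_right (by nlinarith) hr

/-- The oscillation of `g (A p) - g (A' p)` is a second difference of `g` at four points. The bound
`LipTwo.second` keeps it proportional to the distance `d` of the two arguments as well as to the
ratio. -/
theorem LipTwo.upReg_comp_sub (h : LipTwo L g) {s U K d : ℝ} (hK : 0 ≤ K) {A A' : ℝ → X}
    (hA : UpOsc s U K A) (hA' : UpOsc s U K A') (hd : UpReg s U d (fun p => A p - A' p)) :
    UpReg s U (L * (1 + 2 * K) * d) (fun p => g (A p) - g (A' p)) := by
  have hL := h.nonneg
  refine ⟨fun p hp hq => ?_, fun p q hp hpq hq => ?_⟩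
  · have hd0 : 0 ≤ d := (norm_nonneg _).trans (hd.bound p hp hq)
    calc _ ≤ L * ‖A p - A' p‖ := h.lip _ _
      _ ≤ L * d := mul_le_mul_of_nonneg_left (hd.bound p hp hq) hL
      _ ≤ L * d + 2 * (L * d * K) := by nlinarith [mul_nonneg (mul_nonneg hL hd0) hK]
      _ = _ := by ring
  · have hr := ratio_nonneg hp hpq
    have hpU : p ≤ U := by linarith
    have hd0 : 0 ≤ d := (norm_nonneg _).trans (hd.bound p hp hpU)
    refine (h.second (A q) (A' q) (A p) (A' p)).trans ?_
    have h1 := hd.osc p q hp hpq hq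
    have h2 := hA p q hp hpq hq
    have h3 := hA' p q hp hpq hq
    have h4 := hd.bound p hp hpU
    calc _ ≤ L * (d * ((q - p) / (q - s)) + (K * ((q - p) / (q - s)) +
          K * ((q - p) / (q - s))) * d) := by gcongr
      _ = _ := by ring

/-- For second differences, move along the segments from `x'` to `x` and from `w'` to `w`
simultaneously and apply the mean value inequality: the derivative in θ is the derivative of `g` at
the second difference plus a difference of derivatives at `w - w'`. -/
theorem lipTwo_of_fderiv {C : ℝ} (hg : Differentiable ℝ g) (h0 : ∀ x, ‖g x‖ ≤ C)
    (h1 : ∀ x, ‖fderiv ℝ g x‖ ≤ C) (h2 : ∀ x y, ‖fderiv ℝ g x - fderiv ℝ g y‖ ≤ C * ‖x - y‖) :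
    LipTwo C g := by
  have hC : 0 ≤ C := (norm_nonneg _).trans (h0 0)
  refine ⟨h0, fun x y => Convex.norm_image_sub_le_of_norm_fderiv_le (s := univ)
    (fun x _ => hg x) (fun x _ => h1 x) convex_univ (mem_univ y) (mem_univ x), ?_⟩
  intro x x' w w'
  have hline : ∀ (a b : X) (θ : ℝ), HasDerivAt (fun θ : ℝ => g (a + θ • (b - a)))
      (fderiv ℝ g (a + θ • (b - a)) (b - a)) θ := by
    intro a b θ
    have : HasDerivAt (fun θ : ℝ => a + θ • (b - a)) (b - a) θ := by
      simpa using ((hasDerivAt_id θ).smul_const (b - a)).const_add a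
    exact (hg _).hasFDerivAt.comp_hasDerivAt θ this
  have key := norm_image_sub_le_of_norm_deriv_le_segment_01'
    (f := fun θ : ℝ => g (x' + θ • (x - x')) - g (w' + θ • (w - w')))
    (f' := fun θ : ℝ => fderiv ℝ g (x' + θ • (x - x')) (x - x') -
      fderiv ℝ g (w' + θ • (w - w')) (w - w'))
    (C := C * (‖x - x' - (w - w')‖ + (‖x - w‖ + ‖x' - w'‖) * ‖w - w'‖))
    (fun θ _ => ((hline x' x θ).sub (hline w' w θ)).hasDerivWithinAt) (by
      intro θ hθ
      have e : fderiv ℝ g (x' + θ • (x - x')) (x - x') -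
          fderiv ℝ g (w' + θ • (w - w')) (w - w') =
          fderiv ℝ g (x' + θ • (x - x')) (x - x' - (w - w')) +
          (fderiv ℝ g (x' + θ • (x - x')) - fderiv ℝ g (w' + θ • (w - w'))) (w - w') := by
        simp only [map_sub, sub_apply]; abel
      have e1 : ‖x' + θ • (x - x') - (w' + θ • (w - w'))‖ ≤ ‖x - w‖ + ‖x' - w'‖ := by
        have : x' + θ • (x - x') - (w' + θ • (w - w')) =
            θ • (x - w) + (1 - θ) • (x' - w') := by module
        rw [this]
        refine norm_add_le_of_le ?_ ?_
        · rw [norm_smul, Real.norm_of_nonneg hθ.1]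
          exact mul_le_of_le_one_left (norm_nonneg _) hθ.2.le
        · rw [norm_smul, Real.norm_of_nonneg (by linarith [hθ.2])]
          exact mul_le_of_le_one_left (norm_nonneg _) (by linarith [hθ.1])
      rw [e]
      calc _ ≤ C * ‖x - x' - (w - w')‖ + C * (‖x - w‖ + ‖x' - w'‖) * ‖w - w'‖ :=
            norm_add_le_of_le (ContinuousLinearMap.le_of_opNorm_le _ (h1 _) _)
              (ContinuousLinearMap.le_of_opNorm_le _ ((h2 _ _).trans
                (mul_le_mul_of_nonneg_left e1 hC)) _)
        _ = _ := by ring)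
  simp only [one_smul, zero_smul, add_zero, add_sub_cancel] at key
  convert key using 2
  abel

theorem IsCb.fderiv {n : ℕ} {g : X → W} (h : IsCb (n + 1) g) : IsCb n (fderiv ℝ g) := by
  obtain ⟨h1, C, hC⟩ := h
  refine ⟨h1.fderiv_right (by norm_cast), C, fun j hj v => ?_⟩
  rw [norm_iteratedFDeriv_fderiv]
  exact hC (j + 1) (by omega) v

theorem IsCb.lipTwo {n : ℕ} {g : X → W} (hn : 2 ≤ n) (h : IsCb n g) : ∃ L, LipTwo L g := by
  obtain ⟨h1, C, hC⟩ := h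
  have hd : Differentiable ℝ g := h1.differentiable (by norm_cast; omega)
  have hd' : Differentiable ℝ (_root_.fderiv ℝ g) :=
    (h1.fderiv_right (m := 1) (by norm_cast)).differentiable one_ne_zero
  refine ⟨C, lipTwo_of_fderiv hd (fun x => ?_) (fun x => ?_) fun x y => ?_⟩
  · simpa using hC 0 (by omega) x
  · have := hC 1 (by omega) x
    rwa [← norm_iteratedFDeriv_fderiv (n := 0), norm_iteratedFDeriv_zero] at this
  · refine Convex.norm_image_sub_le_of_norm_fderiv_le (𝕜 := ℝ) (s := univ) (fun x _ => hd' x)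
      (fun x _ => ?_) convex_univ (mem_univ y) (mem_univ x)
    have := hC 2 (by omega) x
    rwa [← norm_iteratedFDeriv_fderiv (n := 1), ← norm_iteratedFDeriv_fderiv (n := 0),
      norm_iteratedFDeriv_zero] at this

/-- The weighted average of `g` along the segment from `a` to `a + h`, with `x = (a, h)`. -/
noncomputable def segAvg (w : ℝ → ℝ) (g : X → W) (x : X × X) : W :=
  ∫ θ in (0 : ℝ)..1, w θ • g (x.1 + θ • x.2)

theorem norm_seg_sub_le {θ : ℝ} (hθ : θ ∈ Icc (0 : ℝ) 1) (x : X × X) :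
    ‖x.1 + θ • x.2‖ ≤ 2 * ‖x‖ := by
  have h1 : ‖θ • x.2‖ ≤ ‖x‖ := by
    rw [norm_smul, Real.norm_of_nonneg hθ.1]
    exact (mul_le_of_le_one_left (norm_nonneg _) hθ.2).trans (norm_snd_le x)
  linarith [norm_add_le_of_le (norm_fst_le x) h1]

theorem intervalIntegrable_segment {g : X → W} (hg : Continuous g) {w : ℝ → ℝ}
    (hw : Continuous w) (a h : X) :
    IntervalIntegrable (fun θ : ℝ => w θ • g (a + θ • h)) MeasureTheory.volume 0 1 := by
  apply Continuous.intervalIntegrable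
  fun_prop

/-- The bounds pass under the integral. The map (a, h) ↦ a + θh has norm at most 2 for the maximum
norm on pairs, and the quadratic term of the second difference bound uses this twice, whence the
factor 4. -/
theorem LipTwo.segAvg (h : LipTwo L g) {w : ℝ → ℝ} (hw : Continuous w)
    (hw1 : ∀ θ ∈ Icc (0 : ℝ) 1, |w θ| ≤ 1) : LipTwo (4 * L) (segAvg w g) := by
  have hL := h.nonneg
  have hg := h.continuous
  have hintg := fun x : X × X => intervalIntegrable_segment hg hw x.1 x.2
  have hle : ∀ {F : ℝ → W} {B : ℝ}, (∀ θ ∈ Icc (0 : ℝ) 1, ‖F θ‖ ≤ B) →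
      ‖∫ θ in (0 : ℝ)..1, F θ‖ ≤ B := by
    intro F B hF
    have := intervalIntegral.norm_integral_le_of_norm_le_const (a := (0 : ℝ)) (b := 1) (C := B)
      (f := F) fun θ hθ => by
        rw [uIoc_of_le zero_le_one] at hθ
        exact hF θ ⟨hθ.1.le, hθ.2⟩
    simpa using this
  have hsm : ∀ {θ : ℝ}, θ ∈ Icc (0 : ℝ) 1 → ∀ v : W, ‖w θ • v‖ ≤ ‖v‖ := fun {θ} hθ v => by
    rw [norm_smul]
    exact mul_le_of_le_one_left (norm_nonneg _) (hw1 θ hθ)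
  have hseg : ∀ {θ : ℝ}, θ ∈ Icc (0 : ℝ) 1 → ∀ x y : X × X,
      ‖x.1 + θ • x.2 - (y.1 + θ • y.2)‖ ≤ 2 * ‖x - y‖ := by
    intro θ hθ x y
    have := norm_seg_sub_le hθ (x - y)
    have e : (x - y).1 + θ • (x - y).2 = x.1 + θ • x.2 - (y.1 + θ • y.2) := by
      simp only [Prod.fst_sub, Prod.snd_sub]; module
    rwa [e] at this
  refine ⟨fun x => hle fun θ hθ => ?_, fun x y => ?_, fun x x' v v' => ?_⟩
  · linarith [(hsm hθ (g (x.1 + θ • x.2))).trans (h.bound _)]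
  · simp only [RoughVolterra.segAvg]
    rw [← intervalIntegral.integral_sub (hintg x) (hintg y)]
    refine hle fun θ hθ => ?_
    rw [← smul_sub]
    have h1 := (hsm hθ _).trans ((h.lip (x.1 + θ • x.2) (y.1 + θ • y.2)).trans
      (mul_le_mul_of_nonneg_left (hseg hθ x y) hL))
    nlinarith [mul_nonneg hL (norm_nonneg (x - y))]
  · simp only [RoughVolterra.segAvg]
    rw [← intervalIntegral.integral_sub (hintg x) (hintg x'),
      ← intervalIntegral.integral_sub (hintg v) (hintg v'),
      ← intervalIntegral.integral_sub ((hintg x).sub (hintg x')) ((hintg v).sub (hintg v'))]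
    refine hle fun θ hθ => ?_
    rw [← smul_sub, ← smul_sub, ← smul_sub]
    refine (hsm hθ _).trans ((h.second _ _ _ _).trans ?_)
    have e1 := hseg hθ x v
    have e2 := hseg hθ x' v'
    have e3 := hseg hθ v v'
    have e4 : ‖x.1 + θ • x.2 - (x'.1 + θ • x'.2) - (v.1 + θ • v.2 - (v'.1 + θ • v'.2))‖ ≤
        2 * ‖x - x' - (v - v')‖ := by
      have := hseg hθ (x - x') (v - v')
      convert this using 2
      simp only [Prod.fst_sub, Prod.snd_sub]; module
    calc _ ≤ L * (2 * ‖x - x' - (v - v')‖ + (2 * ‖x - v‖ + 2 * ‖x' - v'‖) *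
          (2 * ‖v - v'‖)) := by gcongr
      _ ≤ L * (4 * ‖x - x' - (v - v')‖ + (2 * ‖x - v‖ + 2 * ‖x' - v'‖) *
          (2 * ‖v - v'‖)) := by gcongr; norm_num
      _ = _ := by ring

theorem hasDerivAt_line {g : X → W} (hg : Differentiable ℝ g) (a h : X) (θ : ℝ) :
    HasDerivAt (fun θ : ℝ => g (a + θ • h)) (fderiv ℝ g (a + θ • h) h) θ := by
  have : HasDerivAt (fun θ : ℝ => a + θ • h) h θ := by
    simpa using ((hasDerivAt_id θ).smul_const h).const_add a
  exact (hg _).hasFDerivAt.comp_hasDerivAt θ this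

variable [CompleteSpace W]

theorem sub_eq_segAvg_apply {g : X → W} (hg : ContDiff ℝ 1 g) (a b : X) :
    g b - g a = segAvg (fun _ => 1) (fderiv ℝ g) (a, b - a) (b - a) := by
  have hc : Continuous (fderiv ℝ g) := hg.continuous_fderiv one_ne_zero
  have h1 : IntervalIntegrable (fun θ : ℝ => (1 : ℝ) • fderiv ℝ g (a + θ • (b - a)))
      MeasureTheory.volume 0 1 := by
    apply Continuous.intervalIntegrable
    fun_prop
  have h2 := intervalIntegral.integral_eq_sub_of_hasDerivAt (a := 0) (b := 1)
    (fun θ _ => hasDerivAt_line (hg.differentiable one_ne_zero) a (b - a) θ) (by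
      apply Continuous.intervalIntegrable
      fun_prop)
  rw [segAvg, ContinuousLinearMap.intervalIntegral_apply h1]
  simp only [one_smul, zero_smul, add_zero, add_sub_cancel] at h2 ⊢
  exact h2.symm

/-- Taylor's formula with integral remainder. -/
theorem taylor_eq_segAvg_apply {g : X → W} (hg : ContDiff ℝ 2 g) (a b : X) :
    g b - g a - fderiv ℝ g a (b - a) =
      segAvg (fun θ => 1 - θ) (fderiv ℝ (fderiv ℝ g)) (a, b - a) (b - a) (b - a) := by
  have hg' : ContDiff ℝ 1 (fderiv ℝ g) := hg.fderiv_right (by norm_cast)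
  have hc : Continuous (fderiv ℝ (fderiv ℝ g)) := hg'.continuous_fderiv one_ne_zero
  have hw : Continuous (fun θ : ℝ => 1 - θ) := by fun_prop
  have h1 := intervalIntegrable_segment (W := X →L[ℝ] X →L[ℝ] W) hc hw a (b - a)
  have h1' : IntervalIntegrable
      (fun θ : ℝ => ((1 - θ) • fderiv ℝ (fderiv ℝ g) (a + θ • (b - a))) (b - a))
      MeasureTheory.volume 0 1 := by
    apply Continuous.intervalIntegrable
    fun_prop
  -- The antiderivative is chosen so that its increment from 0 to 1 is the Taylor remainder: the
  -- weight 1 - θ cancels the first derivative terms.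
  have hd : ∀ θ : ℝ, HasDerivAt
      (fun θ : ℝ => (1 - θ) • fderiv ℝ g (a + θ • (b - a)) (b - a) + g (a + θ • (b - a)))
      (((1 - θ) • fderiv ℝ (fderiv ℝ g) (a + θ • (b - a))) (b - a) (b - a)) θ := by
    intro θ
    have k1 := hasDerivAt_line (hg.differentiable two_ne_zero) a (b - a) θ
    have k2 := (hasDerivAt_line (hg'.differentiable one_ne_zero) a (b - a) θ).clm_apply
      (hasDerivAt_const θ (b - a))
    have k3 := (((hasDerivAt_id θ).const_sub 1).smul k2).add k1
    refine k3.congr_deriv ?_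
    simp only [id, map_zero, add_zero, neg_smul, one_smul, smul_apply]
    abel
  have h2 := intervalIntegral.integral_eq_sub_of_hasDerivAt (a := 0) (b := 1)
    (fun θ _ => hd θ) (by
      apply Continuous.intervalIntegrable
      fun_prop)
  rw [segAvg, ContinuousLinearMap.intervalIntegral_apply h1,
    ContinuousLinearMap.intervalIntegral_apply h1', h2]
  simp only [one_smul, zero_smul, add_zero, add_sub_cancel, sub_self, zero_add, sub_zero]
  abel

/-- Expansions of `f` and of its derivative `f'`, all coefficients being regular. -/
structure Expansion (L : ℝ) (f : X → W) (f' : X → X →L[ℝ] W) (m₁ : X × X → X →L[ℝ] W)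
    (m₂ n : X × X → X →L[ℝ] X →L[ℝ] W) : Prop where
  lip : LipTwo L f
  lip' : LipTwo L f'
  lip_m₁ : LipTwo L m₁
  lip_m₂ : LipTwo L m₂
  lip_n : LipTwo L n
  eq_m₁ : ∀ a b, f b - f a = m₁ (a, b - a) (b - a)
  eq_m₂ : ∀ a b, f' b - f' a = m₂ (a, b - a) (b - a)
  eq_n : ∀ a b, f b - f a - f' a (b - a) = n (a, b - a) (b - a) (b - a)

/-- The coefficients are averages of f' and f'' over segments. Control of second differences of f''
uses two derivatives more, which is where four derivatives of f are spent. -/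
theorem IsCb.exists_expansion {f : X → W} (hf : IsCb 4 f) :
    ∃ L m₁ m₂ n, Expansion L f (_root_.fderiv ℝ f) m₁ m₂ n := by
  obtain ⟨L₀, h0⟩ := hf.lipTwo (by norm_num)
  obtain ⟨L₁, h1⟩ := hf.fderiv.lipTwo (by norm_num)
  obtain ⟨L₂, h2⟩ := hf.fderiv.fderiv.lipTwo (by norm_num)
  have n0 := h0.nonneg
  have n1 := h1.nonneg
  have n2 := h2.nonneg
  have w1 := h1.segAvg (w := fun _ => 1) continuous_const (by simp)
  have w2 := h2.segAvg (w := fun _ => 1) continuous_const (by simp)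
  have w3 := h2.segAvg (w := fun θ => 1 - θ) (by fun_prop) (by
    intro θ hθ
    rw [abs_of_nonneg (by linarith [hθ.2])]
    linarith [hθ.1])
  exact ⟨4 * (L₀ + L₁ + L₂), _, _, _, h0.mono (by linarith), h1.mono (by linarith),
    w1.mono (by linarith), w2.mono (by linarith), w3.mono (by linarith),
    sub_eq_segAvg_apply (hf.1.of_le (by norm_cast)),
    sub_eq_segAvg_apply (hf.fderiv.1.of_le (by norm_cast)),
    taylor_eq_segAvg_apply (hf.1.of_le (by norm_cast))⟩

end Composition

/-! ### Pairs and products of functions of an upper variable -/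

section PairReg

variable {X X' W : Type*} [NormedAddCommGroup X] [NormedAddCommGroup X'] [NormedAddCommGroup W]
  {s U M : ℝ}

theorem UpOsc.prodMk {a : ℝ → X} {b : ℝ → X'} (ha : UpOsc s U M a) (hb : UpOsc s U M b) :
    UpOsc s U M (fun p => (a p, b p)) := fun p q hp hpq hq => by
  rw [Prod.mk_sub_mk, Prod.norm_mk]
  exact max_le (ha p q hp hpq hq) (hb p q hp hpq hq)

theorem UpReg.prodMk {a : ℝ → X} {b : ℝ → X'} (ha : UpReg s U M a) (hb : UpReg s U M b) :
    UpReg s U M (fun p => (a p, b p)) :=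
  ⟨fun p hp hq => by rw [Prod.norm_mk]; exact max_le (ha.bound p hp hq) (hb.bound p hp hq),
    ha.osc.prodMk hb.osc⟩

variable [NormedSpace ℝ X] [NormedSpace ℝ W]

theorem UpReg.clm_apply_sub {P P' : ℝ → X →L[ℝ] W} {H H' : ℝ → X} {dP M' D e : ℝ}
    (hP : UpReg s U dP (fun p => P p - P' p)) (hP' : UpReg s U M' P') (hH : UpReg s U D H)
    (he : UpReg s U e (fun p => H p - H' p)) :
    UpReg s U (2 * dP * D + 2 * M' * e) (fun p => P p (H p) - P' p (H' p)) :=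
  ((hP.clm_apply hH).add (hP'.clm_apply he)).congr fun p _ _ => by
    simp only [sub_apply, map_sub]; abel

end PairReg

/-! ### Controlled paths with upper variables -/

section Controlled

variable {E V : Type*} [NormedAddCommGroup E] [NormedSpace ℝ E]
  [NormedAddCommGroup V] [NormedSpace ℝ V] [CompleteSpace V]

/-- `(Y, Q)` is controlled by `z` on `[σ, S]`, with upper variables in `[σ, U]`. -/
structure CtrlData (z : ℝ → ℝ → E) (ρ σ S U K : ℝ) (Y : ℝ → ℝ → V) (Q : ℝ → ℝ → E →L[ℝ] V) :
    Prop where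
  osc : ∀ s, σ ≤ s → s ≤ S → UpOsc s U K (Y s)
  reg : ∀ s, σ ≤ s → s ≤ S → UpReg s U K (Q s)
  incr : ∀ s t, σ ≤ s → s < t → t ≤ S → UpReg t U (K * (t - s) ^ ρ) (fun p => Q t p - Q s p)
  rem : ∀ s t, σ ≤ s → s < t → t ≤ S → UpReg t U (K * (t - s) ^ (2 * ρ))
    (fun p => Y t p - Y s p - conv (fun r => z r p) (Q s) s t)

/-- The derivative `f'(Y_u^p) ∘ Q_u^q` of `f(Y)`. -/
noncomputable def compDeriv (f' : V → V →L[ℝ] E →L[ℝ] V) (Y : ℝ → ℝ → V)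
    (Q : ℝ → ℝ → E →L[ℝ] V) (u p q : ℝ) : E →L[ℝ] E →L[ℝ] V := (f' (Y u p)).comp (Q u q)

/-- The difference of the controlled paths `(Y, Q)` and `(Y', Q')` is of size `d`. -/
structure CtrlDiff (z : ℝ → ℝ → E) (ρ σ S U d : ℝ) (Y Y' : ℝ → ℝ → V)
    (Q Q' : ℝ → ℝ → E →L[ℝ] V) : Prop where
  val : ∀ s, σ ≤ s → s ≤ S → UpReg s U d (fun p => Y s p - Y' s p)
  reg : ∀ s, σ ≤ s → s ≤ S → UpReg s U d (fun p => Q s p - Q' s p)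
  incr : ∀ s t, σ ≤ s → s < t → t ≤ S → UpReg t U (d * (t - s) ^ ρ)
    (fun p => (Q t p - Q s p) - (Q' t p - Q' s p))
  rem : ∀ s t, σ ≤ s → s < t → t ≤ S → UpReg t U (d * (t - s) ^ (2 * ρ))
    (fun p => (Y t p - Y s p - conv (fun r => z r p) (Q s) s t) -
      (Y' t p - Y' s p - conv (fun r => z r p) (Q' s) s t))

variable {z : ℝ → ℝ → E} {T ρ Z₀ : ℝ} {σ S U K d : ℝ} {Y Y' : ℝ → ℝ → V}
  {Q Q' : ℝ → ℝ → E →L[ℝ] V} {L : ℝ} {f : V → E →L[ℝ] V} {f' : V → V →L[ℝ] E →L[ℝ] V}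
  {m₁ : V × V → V →L[ℝ] E →L[ℝ] V} {m₂ n : V × V → V →L[ℝ] V →L[ℝ] E →L[ℝ] V}

/-- The constant in the bound of the increments of a controlled path. -/
noncomputable def pathC (T ρ Z₀ : ℝ) : ℝ := 2 * convC ρ * Z₀ + T ^ ρ

theorem rpow_two_mul {x ρ : ℝ} (hx : 0 ≤ x) : x ^ (2 * ρ) = x ^ ρ * x ^ ρ := by
  rw [two_mul]
  rcases hx.eq_or_lt with rfl | hx
  · rcases eq_or_ne ρ 0 with rfl | h
    · simp
    · rw [Real.zero_rpow h, Real.zero_rpow (by simpa using h), mul_zero]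
  · exact Real.rpow_add hx _ _

theorem pathC_nonneg (hz : InnerDriver z T ρ Z₀) (hT : 0 ≤ T) : 0 ≤ pathC T ρ Z₀ := by
  have h1 := convC_pos hz.exp_pos
  have h2 := hz.nonneg
  unfold pathC
  positivity

/-- An increment is its remainder plus a first order convolution, and the latter is small with the
derivative `q`. -/
theorem upReg_incr_of_rem (hz : InnerDriver z T ρ Z₀) {s t K K' : ℝ} {y : ℝ → V}
    {q : ℝ → E →L[ℝ] V} (hs : 0 ≤ s) (hst : s < t) (hU : U ≤ T)
    (hq : UpReg s t K q) (hy : UpReg t U K' (fun p => y p - conv (fun r => z r p) q s t)) :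
    UpReg t U (2 * convC ρ * Z₀ * K * (t - s) ^ ρ + K') y :=
  ((hz.upReg_conv_const hs hst.le hU hq).add hy).congr fun p _ _ => by abel

theorem CtrlData.incr_path (hz : InnerDriver z T ρ Z₀) (h : CtrlData z ρ σ S U K Y Q)
    (hσ : 0 ≤ σ) (hSU : S ≤ U) (hU : U ≤ T) {s t : ℝ} (hs : σ ≤ s) (hst : s < t) (ht : t ≤ S) :
    UpReg t U (pathC T ρ Z₀ * K * (t - s) ^ ρ) (fun p => Y t p - Y s p) := by
  have hK := (h.reg s hs (by linarith)).nonneg (by linarith)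
  have hx : 0 ≤ (t - s) ^ ρ := Real.rpow_nonneg (by linarith) _
  have hxT : (t - s) ^ ρ ≤ T ^ ρ := Real.rpow_le_rpow (by linarith) (by linarith) hz.exp_pos.le
  refine (upReg_incr_of_rem hz (by linarith) hst hU
    ((h.reg s hs (by linarith)).restrict le_rfl (by linarith)) (h.rem s t hs hst ht)).mono ?_
  rw [rpow_two_mul (by linarith), pathC]
  nlinarith [mul_nonneg (mul_nonneg hK hx) (sub_nonneg.2 hxT)]

theorem CtrlDiff.incr_path (hz : InnerDriver z T ρ Z₀) (h : CtrlDiff z ρ σ S U d Y Y' Q Q')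
    {K K' : ℝ} (hQ : ∀ s, σ ≤ s → s ≤ S → UpReg s U K (Q s))
    (hQ' : ∀ s, σ ≤ s → s ≤ S → UpReg s U K' (Q' s))
    (hσ : 0 ≤ σ) (hSU : S ≤ U) (hU : U ≤ T) {s t : ℝ} (hs : σ ≤ s) (hst : s < t) (ht : t ≤ S) :
    UpReg t U (pathC T ρ Z₀ * d * (t - s) ^ ρ)
      (fun p => (Y t p - Y s p) - (Y' t p - Y' s p)) := by
  have hd := (h.reg s hs (by linarith)).nonneg (by linarith)
  have hx : 0 ≤ (t - s) ^ ρ := Real.rpow_nonneg (by linarith) _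
  have hxT : (t - s) ^ ρ ≤ T ^ ρ := Real.rpow_le_rpow (by linarith) (by linarith) hz.exp_pos.le
  have hr : UpReg t U (d * (t - s) ^ (2 * ρ)) (fun p => ((Y t p - Y s p) - (Y' t p - Y' s p)) -
      conv (fun r => z r p) (fun r => Q s r - Q' s r) s t) :=
    (h.rem s t hs hst ht).congr fun p hp hpU => by
      rw [conv_sub_right hz.exp_pos hst.le (hz.holder (by linarith) hp (by linarith))
        ((hQ s hs (by linarith)).restrict le_rfl (by linarith))
        ((hQ' s hs (by linarith)).restrict le_rfl (by linarith))]
      abel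
  refine (upReg_incr_of_rem hz (by linarith) hst hU
    ((h.reg s hs (by linarith)).restrict le_rfl (by linarith)) hr).mono ?_
  rw [rpow_two_mul (by linarith), pathC]
  nlinarith [mul_nonneg (mul_nonneg hd hx) (sub_nonneg.2 hxT)]

/-! ### Smooth functions of controlled paths -/

section Increments

variable {s KA D e e₁ : ℝ} {a b a' b' : ℝ → V}

/-- The integral form exhibits the Taylor remainder as a product of three regular factors, so that
its oscillation in the upper variable, and not only its size, is quadratic in `D`. -/
theorem Expansion.upReg_taylor (F : Expansion L f f' m₁ m₂ n) (hKA : 0 ≤ KA)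
    (hA : UpOsc s U KA (fun p => (a p, b p - a p))) (hH : UpReg s U D (fun p => b p - a p)) :
    UpReg s U (4 * (L * (1 + KA)) * D * D)
      (fun p => f (b p) - f (a p) - f' (a p) (b p - a p)) :=
  ((((F.lip_n.upReg_comp hKA hA).clm_apply hH).clm_apply hH).mono (le_of_eq (by ring))).congr
    fun p _ _ => (F.eq_n (a p) (b p)).symm

theorem LipTwo.upReg_apply_sub {W : Type*} [NormedAddCommGroup W] [NormedSpace ℝ W]
    {m : V × V → V →L[ℝ] W} (hm : LipTwo L m) (hKA : 0 ≤ KA)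
    (hA : UpOsc s U KA (fun p => (a p, b p - a p)))
    (hA' : UpOsc s U KA (fun p => (a' p, b' p - a' p)))
    (he : UpReg s U e (fun p => (a p, b p - a p) - (a' p, b' p - a' p)))
    (hH : UpReg s U D (fun p => b p - a p))
    (he₁ : UpReg s U e₁ (fun p => (b p - a p) - (b' p - a' p))) :
    UpReg s U (2 * (L * (1 + 2 * KA) * e) * D + 2 * (L * (1 + KA)) * e₁)
      (fun p => m (a p, b p - a p) (b p - a p) - m (a' p, b' p - a' p) (b' p - a' p)) :=
  (hm.upReg_comp_sub hKA hA hA' he).clm_apply_sub (hm.upReg_comp hKA hA') hH he₁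

theorem Expansion.upReg_taylor_sub (F : Expansion L f f' m₁ m₂ n) (hKA : 0 ≤ KA)
    (hA : UpOsc s U KA (fun p => (a p, b p - a p)))
    (hA' : UpOsc s U KA (fun p => (a' p, b' p - a' p)))
    (he : UpReg s U e (fun p => (a p, b p - a p) - (a' p, b' p - a' p)))
    (hH : UpReg s U D (fun p => b p - a p)) (hH' : UpReg s U D (fun p => b' p - a' p))
    (he₁ : UpReg s U e₁ (fun p => (b p - a p) - (b' p - a' p))) :
    UpReg s U (4 * (L * (1 + 2 * KA)) * e * D * D + 8 * (L * (1 + KA)) * D * e₁)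
      (fun p => (f (b p) - f (a p) - f' (a p) (b p - a p)) -
        (f (b' p) - f (a' p) - f' (a' p) (b' p - a' p))) :=
  (((F.lip_n.upReg_apply_sub hKA hA hA' he hH he₁).clm_apply_sub
    ((F.lip_n.upReg_comp hKA hA').clm_apply hH') hH he₁).mono (le_of_eq (by ring))).congr
    fun p _ _ => by rw [F.eq_n, F.eq_n]

end Increments

theorem upReg₂_compDeriv (F : Expansion L f f' m₁ m₂ n) {K : ℝ} (hK : 0 ≤ K) {u U : ℝ}
    (hY : UpOsc u U K (Y u)) (hQ : UpReg u U K (Q u)) :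
    UpReg₂ u U (L * (1 + K) * K) (compDeriv f' Y Q u) :=
  (F.lip'.upReg_comp hK hY).comp₂ hQ

theorem upReg₂_compDeriv_sub (F : Expansion L f f' m₁ m₂ n) {K e : ℝ} (hK : 0 ≤ K) {u U : ℝ}
    (hY : UpOsc u U K (Y u)) (hY' : UpOsc u U K (Y' u)) (hQ : UpReg u U K (Q u))
    (he : UpReg u U e (fun p => Y u p - Y' u p)) (he' : UpReg u U e (fun p => Q u p - Q' u p)) :
    UpReg₂ u U (L * (1 + 2 * K) * (1 + K) * e)
      (fun p q => compDeriv f' Y Q u p q - compDeriv f' Y' Q' u p q) := by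
  have hL := F.lip.nonneg
  rcases le_or_gt u U with hu | hu
  · have he0 := he.nonneg hu
    refine ((((F.lip'.upReg_comp_sub hK hY hY' he).comp₂ hQ).add
      ((F.lip'.upReg_comp hK hY').comp₂ he')).congr fun p q _ _ _ => ?_).mono ?_
    · simp only [compDeriv, ContinuousLinearMap.sub_comp, ContinuousLinearMap.comp_sub]
      abel
    · nlinarith [mul_nonneg (mul_nonneg hL hK) he0]
  · exact ⟨fun p hp hq => absurd (hp.trans hq) (by linarith),
      fun p q hp hpq hq => absurd (hp.trans (hpq.le.trans hq)) (by linarith)⟩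

/-- The factor f'(Y_u^p) does not depend on the variable of integration, so it leaves the
convolution. This is why the derivative of f(Y) carries two upper variables. -/
theorem innerConv_compDeriv (hz : InnerDriver z T ρ Z₀) {u m p : ℝ} {M : ℝ} (hu : 0 ≤ u)
    (hum : u ≤ m) (hmp : m ≤ p) (hp : p ≤ T) (hQ : UpReg u m M (Q u)) :
    innerConv z (compDeriv f' Y Q u) u m p = f' (Y u p) (conv (fun r => z r p) (Q u) u m) :=
  clm_conv hz.exp_pos hum (hz.holder hu hmp hp) hQ _

/-- The constant for the integrand `f(Y)`. -/
noncomputable def dataC (T ρ Z₀ L K : ℝ) : ℝ :=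
  L * (1 + K) + L * (1 + K) * K +
    (4 * (L * (1 + (K + pathC T ρ Z₀ * K * T ^ ρ))) * (pathC T ρ Z₀ * K) * (pathC T ρ Z₀ * K) +
      2 * (L * (1 + K)) * K) +
    (L * (1 + 2 * K) * (pathC T ρ Z₀ * K) * K + L * (1 + K) * K)

/-- The remainder of f(Y) is the Taylor remainder of f, quadratic in an increment of order ρ, plus
f'(Y_u) applied to the remainder of Y. The increment of the derivative follows from the product
rule. -/
theorem CtrlData.intData (hz : InnerDriver z T ρ Z₀) (F : Expansion L f f' m₁ m₂ n)
    (hK : 0 ≤ K) (hT : 0 ≤ T) (h : CtrlData z ρ σ S U K Y Q) (hσ : 0 ≤ σ) (hSU : S ≤ U)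
    (hU : U ≤ T) :
    IntData z ρ σ S (dataC T ρ Z₀ L K) (fun u p => f (Y u p)) (compDeriv f' Y Q) := by
  have hL := F.lip.nonneg
  have hB : 0 ≤ T ^ ρ := Real.rpow_nonneg hT _
  have hc := pathC_nonneg hz hT
  set D := pathC T ρ Z₀ * K with hD
  have hD0 : 0 ≤ D := mul_nonneg hc hK
  set KA := K + D * T ^ ρ with hKA
  have hKA0 : 0 ≤ KA := by positivity
  have t1 : 0 ≤ L * (1 + K) := by positivity
  have t2 : 0 ≤ L * (1 + K) * K := by positivity
  have t3 : 0 ≤ 4 * (L * (1 + KA)) * D * D + 2 * (L * (1 + K)) * K := by positivity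
  have t4 : 0 ≤ L * (1 + 2 * K) * D * K + L * (1 + K) * K := by positivity
  have hN : dataC T ρ Z₀ L K = L * (1 + K) + L * (1 + K) * K +
    (4 * (L * (1 + KA)) * D * D + 2 * (L * (1 + K)) * K) +
    (L * (1 + 2 * K) * D * K + L * (1 + K) * K) := rfl
  refine ⟨fun u hu huS => ?_, fun u hu huS => ?_, fun u m hu hum hm => ?_,
    fun u m hu hum hm => ?_⟩
  · exact ((F.lip.upReg_comp hK (h.osc u hu huS)).mono (by linarith)).restrict le_rfl hSU
  · exact ((upReg₂_compDeriv F hK (h.osc u hu huS) (h.reg u hu huS)).mono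
      (by linarith)).restrict le_rfl hSU
  · have hx : 0 ≤ (m - u) ^ ρ := Real.rpow_nonneg (by linarith) _
    have hxT : (m - u) ^ ρ ≤ T ^ ρ :=
      Real.rpow_le_rpow (by linarith) (by linarith) hz.exp_pos.le
    have hH := h.incr_path hz hσ hSU hU hu hum hm
    have hYu : UpOsc m U K (Y u) := (h.osc u hu (by linarith)).restrict hK hum.le le_rfl
    have hA : UpOsc m U KA (fun p => (Y u p, Y m p - Y u p)) :=
      (hYu.mono (by rw [hKA]; linarith [mul_nonneg hD0 hB])).prodMk
        (hH.osc.mono (by rw [hKA]; linarith [mul_le_mul_of_nonneg_left hxT hD0]))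
    have k1 := F.upReg_taylor hKA0 hA hH
    have k2 := (F.lip'.upReg_comp hK hYu).clm_apply (h.rem u m hu hum hm)
    refine ((k1.add k2).congr fun p hp hpU => ?_).restrict le_rfl hSU |>.mono ?_
    · rw [innerConv_compDeriv hz (by linarith) hum.le hp (by linarith)
        ((h.reg u hu (by linarith)).restrict le_rfl (by linarith))]
      simp only [map_sub]
      abel
    · rw [rpow_two_mul (by linarith)]
      calc _ = (4 * (L * (1 + KA)) * D * D + 2 * (L * (1 + K)) * K) *
            ((m - u) ^ ρ * (m - u) ^ ρ) := by ring
        _ ≤ _ := mul_le_mul_of_nonneg_right (by linarith) (by positivity)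
  · have hx : 0 ≤ (m - u) ^ ρ := Real.rpow_nonneg (by linarith) _
    have hH := h.incr_path hz hσ hSU hU hu hum hm
    have hYu : UpOsc m U K (Y u) := (h.osc u hu (by linarith)).restrict hK hum.le le_rfl
    have k1 := (F.lip'.upReg_comp_sub hK (h.osc m (by linarith) hm) hYu hH).comp₂
      (h.reg m (by linarith) hm)
    have k2 := (F.lip'.upReg_comp hK hYu).comp₂ (h.incr u m hu hum hm)
    refine ((k1.add k2).congr fun p q _ _ _ => ?_).restrict le_rfl hSU |>.mono ?_
    · simp only [compDeriv, ContinuousLinearMap.sub_comp, ContinuousLinearMap.comp_sub]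
      abel
    · calc _ = (L * (1 + 2 * K) * D * K + L * (1 + K) * K) * (m - u) ^ ρ := by ring
        _ ≤ _ := mul_le_mul_of_nonneg_right (by linarith) hx

/-- The constant for the difference of two integrands `f(Y)` and `f(Y')`. -/
noncomputable def diffC (T ρ Z₀ L K : ℝ) : ℝ :=
  L * (1 + 2 * K) + L * (1 + 2 * K) * (1 + K) +
  (4 * (L * (1 + 2 * (K + pathC T ρ Z₀ * K * T ^ ρ))) * (1 + pathC T ρ Z₀ * T ^ ρ) *
      (pathC T ρ Z₀ * K) * (pathC T ρ Z₀ * K) +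
    8 * (L * (1 + (K + pathC T ρ Z₀ * K * T ^ ρ))) * (pathC T ρ Z₀ * K) * pathC T ρ Z₀ +
    (2 * (L * (1 + 2 * K)) * K + 2 * (L * (1 + K)))) +
  ((2 * (L * (1 + 2 * (K + pathC T ρ Z₀ * K * T ^ ρ)) * (1 + pathC T ρ Z₀ * T ^ ρ)) *
      (pathC T ρ Z₀ * K) +
    2 * (L * (1 + (K + pathC T ρ Z₀ * K * T ^ ρ))) * pathC T ρ Z₀) * K +
    L * (1 + 2 * K) * (pathC T ρ Z₀ * K) + L * (1 + 2 * K) * K + L * (1 + K))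

/-- The decompositions used for one path are subtracted from each other; by multilinearity every
resulting term contains one difference of the two paths, hence a factor `d`. -/
theorem CtrlDiff.intData (hz : InnerDriver z T ρ Z₀) (F : Expansion L f f' m₁ m₂ n)
    (hK : 0 ≤ K) (hT : 0 ≤ T) (hd : 0 ≤ d) (h : CtrlData z ρ σ S U K Y Q)
    (h' : CtrlData z ρ σ S U K Y' Q') (hΔ : CtrlDiff z ρ σ S U d Y Y' Q Q') (hσ : 0 ≤ σ)
    (hSU : S ≤ U) (hU : U ≤ T) :
    IntData z ρ σ S (diffC T ρ Z₀ L K * d) (fun u p => f (Y u p) - f (Y' u p))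
      (fun u p q => compDeriv f' Y Q u p q - compDeriv f' Y' Q' u p q) := by
  have hL := F.lip.nonneg
  have hB : 0 ≤ T ^ ρ := Real.rpow_nonneg hT _
  have hc := pathC_nonneg hz hT
  set c := pathC T ρ Z₀ with hcdef
  set D := c * K with hD
  have hD0 : 0 ≤ D := mul_nonneg hc hK
  set KA := K + D * T ^ ρ with hKA
  have hKA0 : 0 ≤ KA := by positivity
  set N₃ := 4 * (L * (1 + 2 * KA)) * (1 + c * T ^ ρ) * D * D + 8 * (L * (1 + KA)) * D * c +
    (2 * (L * (1 + 2 * K)) * K + 2 * (L * (1 + K))) with hN₃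
  set N₄ := (2 * (L * (1 + 2 * KA) * (1 + c * T ^ ρ)) * D + 2 * (L * (1 + KA)) * c) * K +
    L * (1 + 2 * K) * D + L * (1 + 2 * K) * K + L * (1 + K) with hN₄
  have t1 : 0 ≤ L * (1 + 2 * K) := by positivity
  have t2 : 0 ≤ L * (1 + 2 * K) * (1 + K) := by positivity
  have t3 : 0 ≤ N₃ := by positivity
  have t4 : 0 ≤ N₄ := by positivity
  have hN : diffC T ρ Z₀ L K =
    L * (1 + 2 * K) + L * (1 + 2 * K) * (1 + K) + N₃ + N₄ := rfl
  -- Bounds for the base point, the increment and the pair of both, for the two paths and for their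
  -- difference; they feed the Taylor coefficients below.
  have base : ∀ u m, σ ≤ u → u < m → m ≤ S →
      UpOsc m U K (Y u) ∧ UpOsc m U K (Y' u) ∧
      UpReg m U (D * (m - u) ^ ρ) (fun p => Y m p - Y u p) ∧
      UpReg m U (D * (m - u) ^ ρ) (fun p => Y' m p - Y' u p) ∧
      UpReg m U (c * d * (m - u) ^ ρ) (fun p => (Y m p - Y u p) - (Y' m p - Y' u p)) ∧
      UpOsc m U KA (fun p => (Y u p, Y m p - Y u p)) ∧
      UpOsc m U KA (fun p => (Y' u p, Y' m p - Y' u p)) ∧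
      UpReg m U ((1 + c * T ^ ρ) * d)
        (fun p => (Y u p, Y m p - Y u p) - (Y' u p, Y' m p - Y' u p)) := by
    intro u m hu hum hm
    have hxT : (m - u) ^ ρ ≤ T ^ ρ :=
      Real.rpow_le_rpow (by linarith) (by linarith) hz.exp_pos.le
    have hYu : UpOsc m U K (Y u) := (h.osc u hu (by linarith)).restrict hK hum.le le_rfl
    have hYu' : UpOsc m U K (Y' u) := (h'.osc u hu (by linarith)).restrict hK hum.le le_rfl
    have hH := h.incr_path hz hσ hSU hU hu hum hm
    have hH' := h'.incr_path hz hσ hSU hU hu hum hm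
    have he := hΔ.incr_path hz h.reg h'.reg hσ hSU hU hu hum hm
    have k1 : K ≤ KA := by rw [hKA]; linarith [mul_nonneg hD0 hB]
    have k2 : D * (m - u) ^ ρ ≤ KA := by
      rw [hKA]; linarith [mul_le_mul_of_nonneg_left hxT hD0]
    refine ⟨hYu, hYu', hH, hH', he, (hYu.mono k1).prodMk (hH.osc.mono k2),
      (hYu'.mono k1).prodMk (hH'.osc.mono k2), ?_⟩
    have hcd : 0 ≤ c * d := mul_nonneg hc hd
    refine ((((hΔ.val u hu (by linarith)).restrict hum.le le_rfl).mono ?_).prodMk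
      (he.mono ?_)).congr fun p _ _ => rfl
    · nlinarith [mul_nonneg hcd hB]
    · nlinarith [mul_le_mul_of_nonneg_left hxT hcd]
  refine ⟨fun u hu huS => ?_, fun u hu huS => ?_, fun u m hu hum hm => ?_,
    fun u m hu hum hm => ?_⟩
  · exact ((F.lip.upReg_comp_sub hK (h.osc u hu huS) (h'.osc u hu huS)
      (hΔ.val u hu huS)).mono (mul_le_mul_of_nonneg_right (by linarith) hd)).restrict le_rfl hSU
  · exact ((upReg₂_compDeriv_sub F hK (h.osc u hu huS) (h'.osc u hu huS) (h.reg u hu huS)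
      (hΔ.val u hu huS) (hΔ.reg u hu huS)).mono
        (mul_le_mul_of_nonneg_right (by linarith) hd)).restrict le_rfl hSU
  · obtain ⟨hYu, hYu', hH, hH', he, hA, hA', hAA⟩ := base u m hu hum hm
    have hx : 0 ≤ (m - u) ^ ρ := Real.rpow_nonneg (by linarith) _
    have k1 := F.upReg_taylor_sub hKA0 hA hA' hAA hH hH' he
    have k2 := (F.lip'.upReg_comp_sub hK hYu hYu'
      ((hΔ.val u hu (by linarith)).restrict hum.le le_rfl)).clm_apply_sub
      (F.lip'.upReg_comp hK hYu') (h.rem u m hu hum hm) (hΔ.rem u m hu hum hm)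
    refine ((k1.add k2).congr fun p hp hpU => ?_).restrict le_rfl hSU |>.mono ?_
    · have hQ := (h.reg u hu (by linarith)).restrict (le_refl u) (show m ≤ U by linarith)
      have hQ' := (h'.reg u hu (by linarith)).restrict (le_refl u) (show m ≤ U by linarith)
      have e := innerConv_sub (φ := compDeriv f' Y Q u) (φ' := compDeriv f' Y' Q' u) hz
        (by linarith : 0 ≤ u) hum.le hp (by linarith)
        (((upReg₂_compDeriv F hK (h.osc u hu (by linarith)) (h.reg u hu (by linarith))).upper p
          (by linarith) hpU).restrict le_rfl hp)
        (((upReg₂_compDeriv F hK (h'.osc u hu (by linarith)) (h'.reg u hu (by linarith))).upper p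
          (by linarith) hpU).restrict le_rfl hp)
      rw [e, innerConv_compDeriv hz (by linarith) hum.le hp (by linarith) hQ,
        innerConv_compDeriv hz (by linarith) hum.le hp (by linarith) hQ']
      simp only [map_sub]
      abel
    · rw [rpow_two_mul (by linarith)]
      calc _ = N₃ * d * ((m - u) ^ ρ * (m - u) ^ ρ) := by rw [hN₃]; ring
        _ ≤ _ := mul_le_mul_of_nonneg_right (mul_le_mul_of_nonneg_right (by linarith) hd)
          (by positivity)
  · obtain ⟨hYu, hYu', hH, hH', he, hA, hA', hAA⟩ := base u m hu hum hm
    have hx : 0 ≤ (m - u) ^ ρ := Real.rpow_nonneg (by linarith) _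
    -- Writing the increments of f'(Y) through `m₂` keeps the factor `d` and the factor `(m - u) ^
    -- ρ` at the same time; the Lipschitz bound of f' alone would give only one of them.
    have k1 := (F.lip_m₂.upReg_apply_sub hKA0 hA hA' hAA hH he).comp₂ (h.reg m (by linarith) hm)
    have k2 := (F.lip'.upReg_comp_sub hK (h'.osc m (by linarith) hm) hYu' hH').comp₂
      (hΔ.reg m (by linarith) hm)
    have k3 := (F.lip'.upReg_comp_sub hK hYu hYu'
      ((hΔ.val u hu (by linarith)).restrict hum.le le_rfl)).comp₂ (h.incr u m hu hum hm)
    have k4 := (F.lip'.upReg_comp hK hYu').comp₂ (hΔ.incr u m hu hum hm)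
    refine ((((k1.add k2).add k3).add k4).congr fun p q _ _ _ => ?_).restrict le_rfl hSU
      |>.mono ?_
    · rw [← F.eq_m₂, ← F.eq_m₂]
      simp only [compDeriv, ContinuousLinearMap.sub_comp, ContinuousLinearMap.comp_sub]
      abel
    · calc _ = N₄ * d * (m - u) ^ ρ := by rw [hN₄]; ring
        _ ≤ _ := mul_le_mul_of_nonneg_right (mul_le_mul_of_nonneg_right (by linarith) hd) hx

end Controlled

/-! ### The rough integral as a function of its upper variable -/

section SolutionMap

variable {E V : Type*} [NormedAddCommGroup E] [NormedSpace ℝ E]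
  [NormedAddCommGroup V] [NormedSpace ℝ V] [CompleteSpace V]

/-- The bounds of order `ρ` which a second order Volterra rough path satisfies. -/
structure RoughDriver (z : ℝ → ℝ → E) (z2 : ℝ → ℝ → ℝ → TensorSq E) (T ρ Z₀ : ℝ) : Prop where
  inner : InnerDriver z T ρ Z₀
  exp_gt : 1 < ρ + 2 * ρ
  outer : ∀ s t p, 0 ≤ s → t ≤ p → p ≤ T →
    OuterDriver z ρ s t ρ Z₀ (fun r => z r p) (fun a b => z2 a b p)
  outer_sub : ∀ s t p q, 0 ≤ s → t ≤ p → p < q → q ≤ T →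
    OuterDriver z ρ s t ρ (Z₀ * ((q - p) / (q - t))) (fun r => z r q - z r p)
      (fun a b => z2 a b q - z2 a b p)

/-- The rough Volterra integral with upper variable `p`. -/
noncomputable def volInt (z : ℝ → ℝ → E) (z2 : ℝ → ℝ → ℝ → TensorSq E)
    (G : ℝ → ℝ → E →L[ℝ] V) (φ : ℝ → ℝ → ℝ → E →L[ℝ] E →L[ℝ] V) (s t p : ℝ) : V :=
  roughInt z (fun r => z r p) (fun a b => z2 a b p) G φ s t

variable {z : ℝ → ℝ → E} {z2 : ℝ → ℝ → ℝ → TensorSq E} {T ρ Z₀ : ℝ} {σ S U K d N M : ℝ}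
  {G G' : ℝ → ℝ → E →L[ℝ] V} {φ φ' : ℝ → ℝ → ℝ → E →L[ℝ] E →L[ℝ] V}

/-- Passing from `p` to `q` replaces the driver by the difference of two slices, whose constant
contains (q-p)/(q-t). -/
theorem RoughDriver.upReg_conv₂_upper (hz : RoughDriver z z2 T ρ Z₀) {s t : ℝ}
    {φ : ℝ → ℝ → E →L[ℝ] E →L[ℝ] V} (hs : 0 ≤ s) (hst : s ≤ t) (hU : U ≤ T)
    (hφ : UpReg₂ s t M φ) :
    UpReg t U (conv₂C ρ ρ Z₀ * (M * Z₀) * (t - s) ^ (2 * ρ))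
      (fun p => conv₂ z (fun r => z r p) (fun a b => z2 a b p) φ s t) := by
  have hρ := hz.inner.exp_pos
  refine ⟨fun p hp hpU => ?_, fun p q hp hpq hq => ?_⟩
  · refine ((conv₂_spec hz.inner hρ hs hst (by linarith) (hz.outer s t p hs hp (by linarith))
      hφ).2).trans (le_of_eq ?_)
    rw [two_mul]
    ring
  · rw [← conv₂_driver_sub hz.inner hρ hs hst (by linarith)
      (hz.outer s t q hs (by linarith) (by linarith)) (hz.outer s t p hs hp (by linarith)) hφ]
    refine ((conv₂_spec hz.inner hρ hs hst (by linarith)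
      (hz.outer_sub s t p q hs hp hpq (by linarith)) hφ).2).trans (le_of_eq ?_)
    rw [two_mul]
    ring

theorem RoughDriver.upReg_volInt_sub_germ (hz : RoughDriver z z2 T ρ Z₀) {s t : ℝ} (hs : 0 ≤ s)
    (hst : s ≤ t) (hU : U ≤ T) (h : IntData z ρ s t N G φ) :
    UpReg t U (roughC ρ ρ Z₀ * (N * Z₀) * (t - s) ^ (ρ + 2 * ρ))
      (fun p => volInt z z2 G φ s t p -
        roughGerm z (fun r => z r p) (fun a b => z2 a b p) G φ s t) := by
  have hρ := hz.inner.exp_pos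
  refine ⟨fun p hp hpU => ?_, fun p q hp hpq hq => ?_⟩
  · refine ((roughInt_spec hz.inner hρ hz.exp_gt hs hst (by linarith)
      (hz.outer s t p hs hp (by linarith)) h).2).trans (le_of_eq (by ring))
  · have hq' := hz.outer s t q hs (by linarith) (by linarith)
    have hp' := hz.outer s t p hs hp (by linarith)
    have e := roughInt_driver_sub hz.inner hρ hz.exp_gt hs hst (by linarith) hq' hp' h
    have e' := roughGerm_driver_sub hz.inner hρ hs hst (by linarith) hq' hp' h
    have k := (roughInt_spec hz.inner hρ hz.exp_gt hs hst (by linarith)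
      (hz.outer_sub s t p q hs hp hpq (by linarith)) h).2
    rw [e, e'] at k
    simp only [volInt]
    rw [sub_sub_sub_comm]
    exact k.trans (le_of_eq (by ring))

theorem RoughDriver.upReg_volInt_sub_conv (hz : RoughDriver z z2 T ρ Z₀) {s t : ℝ} (hs : 0 ≤ s)
    (hst : s ≤ t) (hU : U ≤ T) (h : IntData z ρ s t N G φ) (hφ : UpReg₂ s t M (φ s)) :
    UpReg t U ((conv₂C ρ ρ Z₀ * (M * Z₀) + roughC ρ ρ Z₀ * (N * Z₀) * (t - s) ^ ρ) *
        (t - s) ^ (2 * ρ))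
      (fun p => volInt z z2 G φ s t p - conv (fun r => z r p) (G s) s t) := by
  have h1 := (hz.upReg_volInt_sub_germ hs hst hU h).add (hz.upReg_conv₂_upper hs hst hU hφ)
  refine (h1.congr fun p _ _ => ?_).mono (le_of_eq ?_)
  · simp only [roughGerm]
    abel
  · have e : (t - s) ^ (ρ + 2 * ρ) = (t - s) ^ ρ * (t - s) ^ (2 * ρ) := by
      have hρ := hz.inner.exp_pos
      rcases hst.eq_or_lt with rfl | hlt
      · rw [sub_self, Real.zero_rpow hρ.ne', Real.zero_rpow (by positivity), zero_mul]
      · exact Real.rpow_add (by linarith) _ _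
    rw [e]
    ring

theorem RoughDriver.volInt_concat (hz : RoughDriver z z2 T ρ Z₀) {s m t p : ℝ} (hs : 0 ≤ s)
    (hsm : s ≤ m) (hmt : m ≤ t) (htp : t ≤ p) (hp : p ≤ T) (h : IntData z ρ s t N G φ) :
    volInt z z2 G φ s t p = volInt z z2 G φ s m p + volInt z z2 G φ m t p :=
  roughInt_concat hz.inner hz.inner.exp_pos hz.exp_gt hs hsm hmt (by linarith)
    (hz.outer s t p hs htp hp) h

theorem volInt_self (s p : ℝ) : volInt z z2 G φ s s p = 0 := roughInt_self

theorem conv₂_congr {ζ : ℝ → E} {ζ₂ : ℝ → ℝ → TensorSq E} {φ φ' : ℝ → ℝ → E →L[ℝ] E →L[ℝ] V}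
    {s t : ℝ} (hφ : ∀ p q, s ≤ q → q ≤ p → p ≤ t → φ p q = φ' p q) :
    conv₂ z ζ ζ₂ φ s t = conv₂ z ζ ζ₂ φ' s t :=
  sew_congr fun a b ha hab hb => by
    rw [germ₂, germ₂, hφ a a ha le_rfl (by linarith)]
    congr 1
    exact conv_congr (fun _ _ _ _ _ => rfl) fun p hp hpb =>
      conv_congr (fun _ _ _ _ _ => rfl) fun q hq hqa => hφ p q hq (by linarith) (by linarith)

theorem volInt_congr {s t p : ℝ} (hG : ∀ u q, s ≤ u → u ≤ q → q ≤ t → G u q = G' u q)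
    (hφ : ∀ u q r, s ≤ u → u ≤ r → r ≤ q → q ≤ t → φ u q r = φ' u q r) :
    volInt z z2 G φ s t p = volInt z z2 G' φ' s t p :=
  sew_congr fun a b ha hab hb => by
    rw [roughGerm, roughGerm, conv_congr (fun _ _ _ _ _ => rfl) fun q hq hqb =>
      hG a q ha hq (by linarith), conv₂_congr fun q r h1 h2 h3 =>
      hφ a q r ha h1 h2 (by linarith)]

/-- The increments of `Y` are the rough Volterra integrals of `(G, φ)`. -/
def IsPrimitive (z : ℝ → ℝ → E) (z2 : ℝ → ℝ → ℝ → TensorSq E) (σ S U : ℝ)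
    (G : ℝ → ℝ → E →L[ℝ] V) (φ : ℝ → ℝ → ℝ → E →L[ℝ] E →L[ℝ] V) (Y : ℝ → ℝ → V) : Prop :=
  ∀ s t p, σ ≤ s → s < t → t ≤ S → t ≤ p → p ≤ U → Y t p - Y s p = volInt z z2 G φ s t p

theorem RoughDriver.isPrimitive (hz : RoughDriver z z2 T ρ Z₀) (hσ : 0 ≤ σ) (hU : U ≤ T)
    (h : IntData z ρ σ S N G φ) (ξ : ℝ → V) :
    IsPrimitive z z2 σ S U G φ (fun t p => ξ p + volInt z z2 G φ σ t p) := by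
  intro s t p hs hst ht htp hp
  beta_reduce
  rw [hz.volInt_concat hσ hs hst.le htp (by linarith) (h.restrict le_rfl ht)]
  abel

variable {Y Y' Ys Ys' : ℝ → ℝ → V} {Q Q' : ℝ → ℝ → E →L[ℝ] V} {L : ℝ} {f : V → E →L[ℝ] V}
  {f' : V → V →L[ℝ] E →L[ℝ] V} {m₁ : V × V → V →L[ℝ] E →L[ℝ] V}
  {m₂ n : V × V → V →L[ℝ] V →L[ℝ] E →L[ℝ] V}

theorem RoughDriver.upReg_rem_of_isPrimitive (hz : RoughDriver z z2 T ρ Z₀) (hσ : 0 ≤ σ)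
    (hU : U ≤ T) (h : IntData z ρ σ S N G φ)
    (hY : IsPrimitive z z2 σ S U G φ Y) {s t : ℝ} (hs : σ ≤ s) (hst : s < t) (ht : t ≤ S)
    (hφ : UpReg₂ s S M (φ s)) :
    UpReg t U ((conv₂C ρ ρ Z₀ * (M * Z₀) + roughC ρ ρ Z₀ * (N * Z₀) * (t - s) ^ ρ) *
        (t - s) ^ (2 * ρ))
      (fun p => Y t p - Y s p - conv (fun r => z r p) (G s) s t) :=
  (hz.upReg_volInt_sub_conv (hσ.trans hs) hst.le hU (h.restrict hs ht)
    (hφ.restrict le_rfl ht)).congr fun p hp hpU => by rw [hY s t p hs hst ht hp hpU]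

/-- Two controlled paths with the same initial values, whose difference is of size `d`. -/
structure CtrlGap (z : ℝ → ℝ → E) (ρ σ S U d : ℝ) (Y Y' : ℝ → ℝ → V)
    (Q Q' : ℝ → ℝ → E →L[ℝ] V) : Prop where
  start : ∀ p, σ ≤ p → p ≤ U → Y σ p = Y' σ p
  start' : ∀ p, σ ≤ p → p ≤ U → Q σ p = Q' σ p
  incr : ∀ s t, σ ≤ s → s < t → t ≤ S → UpReg t U (d * (t - s) ^ ρ)
    (fun p => (Q t p - Q s p) - (Q' t p - Q' s p))
  rem : ∀ s t, σ ≤ s → s < t → t ≤ S → UpReg t U (d * (t - s) ^ (2 * ρ))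
    (fun p => (Y t p - Y s p - conv (fun r => z r p) (Q s) s t) -
      (Y' t p - Y' s p - conv (fun r => z r p) (Q' s) s t))

/-! ### Lipschitz dependence of the solution map on short windows -/

section Gap

variable {H : ℝ}

/-- The derivatives agree at σ, so their difference at `s` is an increment from σ and gains the
factor `H`. -/
theorem CtrlGap.upReg_deriv (h : CtrlGap z ρ σ S U d Y Y' Q Q') (hd : 0 ≤ d)
    (hρ : 0 < ρ) (hH : (S - σ) ^ ρ ≤ H) (hH0 : 0 ≤ H) {s : ℝ} (hs : σ ≤ s) (hsS : s ≤ S) :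
    UpReg s U (d * H) (fun p => Q s p - Q' s p) := by
  rcases hs.eq_or_lt with rfl | hs
  · exact (UpReg.zero (mul_nonneg hd hH0)).congr fun p hp hpU => by
      rw [h.start' p hp hpU, sub_self]
  · refine ((h.incr σ s le_rfl hs hsS).mono (mul_le_mul_of_nonneg_left
      ((Real.rpow_le_rpow (by linarith) (by linarith) hρ.le).trans hH) hd)).congr
        fun p hp hpU => ?_
    rw [h.start' p (by linarith) hpU]
    abel

/-- The convolution part is governed by the difference of derivatives, already of size `d * H`, and
one of the two powers of `t - s` in the remainder supplies the same `H`. -/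
theorem CtrlGap.upReg_incr (hz : InnerDriver z T ρ Z₀) (h : CtrlGap z ρ σ S U d Y Y' Q Q')
    (hd : 0 ≤ d) (hH : (S - σ) ^ ρ ≤ H) (hH0 : 0 ≤ H)
    {K K' : ℝ} (hQ : ∀ s, σ ≤ s → s ≤ S → UpReg s U K (Q s))
    (hQ' : ∀ s, σ ≤ s → s ≤ S → UpReg s U K' (Q' s))
    (hσ : 0 ≤ σ) (hSU : S ≤ U) (hU : U ≤ T) {s t : ℝ} (hs : σ ≤ s) (hst : s < t) (ht : t ≤ S) :
    UpReg t U ((2 * convC ρ * Z₀ + 1) * (d * H) * (t - s) ^ ρ)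
      (fun p => (Y t p - Y s p) - (Y' t p - Y' s p)) := by
  have hx : 0 ≤ (t - s) ^ ρ := Real.rpow_nonneg (by linarith) _
  have hxH : (t - s) ^ ρ ≤ H :=
    (Real.rpow_le_rpow (by linarith) (by linarith) hz.exp_pos.le).trans hH
  have hr : UpReg t U (d * (t - s) ^ (2 * ρ)) (fun p => ((Y t p - Y s p) - (Y' t p - Y' s p)) -
      conv (fun r => z r p) (fun r => Q s r - Q' s r) s t) :=
    (h.rem s t hs hst ht).congr fun p hp hpU => by
      rw [conv_sub_right hz.exp_pos hst.le (hz.holder (by linarith) hp (by linarith))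
        ((hQ s hs (by linarith)).restrict le_rfl (by linarith))
        ((hQ' s hs (by linarith)).restrict le_rfl (by linarith))]
      abel
  refine (upReg_incr_of_rem hz (by linarith) hst hU ((h.upReg_deriv hd hz.exp_pos hH hH0 hs
    (by linarith)).restrict le_rfl (by linarith)) hr).mono ?_
  rw [rpow_two_mul (by linarith)]
  nlinarith [mul_nonneg (mul_nonneg hd hx) (sub_nonneg.2 hxH)]

theorem CtrlGap.upReg_val (hz : InnerDriver z T ρ Z₀) (h : CtrlGap z ρ σ S U d Y Y' Q Q')
    (hd : 0 ≤ d) (hH : (S - σ) ^ ρ ≤ H) (hH0 : 0 ≤ H) (hH1 : H ≤ 1)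
    {K K' : ℝ} (hQ : ∀ s, σ ≤ s → s ≤ S → UpReg s U K (Q s))
    (hQ' : ∀ s, σ ≤ s → s ≤ S → UpReg s U K' (Q' s))
    (hσ : 0 ≤ σ) (hSU : S ≤ U) (hU : U ≤ T) {s : ℝ} (hs : σ ≤ s) (hsS : s ≤ S) :
    UpReg s U ((2 * convC ρ * Z₀ + 1) * (d * H)) (fun p => Y s p - Y' s p) := by
  have hC := convC_pos hz.exp_pos
  have hZ := hz.nonneg
  have h0 : 0 ≤ (2 * convC ρ * Z₀ + 1) * (d * H) := by positivity
  rcases hs.eq_or_lt with rfl | hs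
  · exact (UpReg.zero h0).congr fun p hp hpU => by rw [h.start p hp hpU, sub_self]
  · refine ((h.upReg_incr hz hd hH hH0 hQ hQ' hσ hSU hU le_rfl hs hsS).mono ?_).congr
      fun p hp hpU => ?_
    · refine mul_le_of_le_one_right h0 ?_
      exact (Real.rpow_le_rpow (by linarith) (by linarith) hz.exp_pos.le).trans (hH.trans hH1)
    · rw [h.start p (by linarith) hpU]
      abel

theorem CtrlGap.ctrlDiff (hz : InnerDriver z T ρ Z₀) (h : CtrlGap z ρ σ S U d Y Y' Q Q')
    (hd : 0 ≤ d) (hH : (S - σ) ^ ρ ≤ H) (hH0 : 0 ≤ H) (hH1 : H ≤ 1)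
    {K K' : ℝ} (hQ : ∀ s, σ ≤ s → s ≤ S → UpReg s U K (Q s))
    (hQ' : ∀ s, σ ≤ s → s ≤ S → UpReg s U K' (Q' s))
    (hσ : 0 ≤ σ) (hSU : S ≤ U) (hU : U ≤ T) :
    CtrlDiff z ρ σ S U ((2 * convC ρ * Z₀ + 1) * d) Y Y' Q Q' := by
  have hC := convC_pos hz.exp_pos
  have hZ := hz.nonneg
  have h1 : d * H ≤ d := mul_le_of_le_one_right hd hH1
  have h2 : d ≤ (2 * convC ρ * Z₀ + 1) * d := by
    nlinarith [mul_nonneg (mul_nonneg hC.le hZ) hd]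
  refine ⟨fun s hs hsS => ?_, fun s hs hsS => ?_, fun s t hs hst ht => ?_,
    fun s t hs hst ht => ?_⟩
  · exact (h.upReg_val hz hd hH hH0 hH1 hQ hQ' hσ hSU hU hs hsS).mono (by gcongr)
  · exact (h.upReg_deriv hd hz.exp_pos hH hH0 hs hsS).mono (h1.trans h2)
  · exact (h.incr s t hs hst ht).mono
      (mul_le_mul_of_nonneg_right h2 (Real.rpow_nonneg (by linarith) _))
  · exact (h.rem s t hs hst ht).mono
      (mul_le_mul_of_nonneg_right h2 (Real.rpow_nonneg (by linarith) _))

/-- The Lipschitz constant of the solution map, up to a power of the length of the interval. -/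
noncomputable def gapC (T ρ Z₀ L K : ℝ) : ℝ :=
  (2 * (L * (1 + 2 * (K + pathC T ρ Z₀ * K * T ^ ρ)) * (2 * convC ρ * Z₀ + 1)) *
      (pathC T ρ Z₀ * K) +
    2 * (L * (1 + (K + pathC T ρ Z₀ * K * T ^ ρ))) * (2 * convC ρ * Z₀ + 1)) +
  (conv₂C ρ ρ Z₀ * (L * (1 + 2 * K) * (1 + K) * (2 * convC ρ * Z₀ + 1) * Z₀) +
    roughC ρ ρ Z₀ * (diffC T ρ Z₀ L K * (2 * convC ρ * Z₀ + 1) * Z₀))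

theorem diffC_nonneg (hz : InnerDriver z T ρ Z₀) (hT : 0 ≤ T) (hL : 0 ≤ L) (hK : 0 ≤ K) :
    0 ≤ diffC T ρ Z₀ L K := by
  have := pathC_nonneg hz hT
  unfold diffC
  positivity

/-- Each part of the image gains `H`. The new derivative is f(Y), whose increments follow those of
the path. In the new remainder, the second order convolution sees a difference of derivatives of
size `d * H`, and the sewing error has a spare power ρ of the length. -/
theorem CtrlGap.image (hz : RoughDriver z z2 T ρ Z₀) (F : Expansion L f f' m₁ m₂ n)
    (hK : 0 ≤ K) (hT : 0 ≤ T) (hd : 0 ≤ d) (hH : (S - σ) ^ ρ ≤ H) (hH0 : 0 ≤ H) (hH1 : H ≤ 1)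
    (hσ : 0 ≤ σ) (hSU : S ≤ U) (hU : U ≤ T)
    (h : CtrlData z ρ σ S U K Y Q) (h' : CtrlData z ρ σ S U K Y' Q')
    (hgap : CtrlGap z ρ σ S U d Y Y' Q Q')
    (hY : IsPrimitive z z2 σ S U (fun u p => f (Y u p)) (compDeriv f' Y Q) Ys)
    (hY' : IsPrimitive z z2 σ S U (fun u p => f (Y' u p)) (compDeriv f' Y' Q') Ys')
    (hstart : ∀ p, σ ≤ p → p ≤ U → Ys σ p = Ys' σ p) :
    CtrlGap z ρ σ S U (gapC T ρ Z₀ L K * H * d) Ys Ys' (fun u p => f (Y u p))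
      (fun u p => f (Y' u p)) := by
  have hL := F.lip.nonneg
  have hZ := hz.inner.nonneg
  have hρ := hz.inner.exp_pos
  have hC := convC_pos hρ
  have hB : 0 ≤ T ^ ρ := Real.rpow_nonneg hT _
  have hc := pathC_nonneg hz.inner hT
  have hC2 := conv₂C_pos hρ hρ hZ
  have hC3 := roughC_pos hρ hρ hz.exp_gt hZ
  have hdC := diffC_nonneg hz.inner hT hL hK
  set c := 2 * convC ρ * Z₀ + 1 with hcdef
  have hc0 : 0 ≤ c := by positivity
  have hc1 : 1 ≤ c := by
    have : 0 ≤ 2 * convC ρ * Z₀ := by positivity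
    linarith
  have hΔ := hgap.ctrlDiff hz.inner hd hH hH0 hH1 h.reg h'.reg hσ hSU hU
  have hI := h.intData hz.inner F hK hT hσ hSU hU
  have hI' := h'.intData hz.inner F hK hT hσ hSU hU
  have hID := hΔ.intData hz.inner F hK hT (by positivity) h h' hσ hSU hU
  set D := pathC T ρ Z₀ * K with hD
  have hD0 : 0 ≤ D := mul_nonneg hc hK
  set KA := K + D * T ^ ρ with hKA
  have hKA0 : 0 ≤ KA := by positivity
  set N₁ := 2 * (L * (1 + 2 * KA) * c) * D + 2 * (L * (1 + KA)) * c with hN₁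
  set N₂ := conv₂C ρ ρ Z₀ * (L * (1 + 2 * K) * (1 + K) * c * Z₀) +
    roughC ρ ρ Z₀ * (diffC T ρ Z₀ L K * c * Z₀) with hN₂
  have t1 : 0 ≤ N₁ := by positivity
  have t2 : 0 ≤ N₂ := by positivity
  have hN : gapC T ρ Z₀ L K = N₁ + N₂ := rfl
  have hHd : 0 ≤ H * d := mul_nonneg hH0 hd
  refine ⟨hstart, fun p hp hpU => by rw [hgap.start p hp hpU], fun s t hs hst ht => ?_,
    fun s t hs hst ht => ?_⟩
  · have hx : 0 ≤ (t - s) ^ ρ := Real.rpow_nonneg (by linarith) _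
    have hxH : (t - s) ^ ρ ≤ H := (Real.rpow_le_rpow (by linarith) (by linarith) hρ.le).trans hH
    have hxT : (t - s) ^ ρ ≤ T ^ ρ := Real.rpow_le_rpow (by linarith) (by linarith) hρ.le
    have hYs : UpOsc t U K (Y s) := (h.osc s hs (by linarith)).restrict hK hst.le le_rfl
    have hYs' : UpOsc t U K (Y' s) := (h'.osc s hs (by linarith)).restrict hK hst.le le_rfl
    have hi := h.incr_path hz.inner hσ hSU hU hs hst ht
    have hi' := h'.incr_path hz.inner hσ hSU hU hs hst ht
    have k1 : K ≤ KA := by rw [hKA]; linarith [mul_nonneg hD0 hB]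
    have k2 : D * (t - s) ^ ρ ≤ KA := by
      rw [hKA]; linarith [mul_le_mul_of_nonneg_left hxT hD0]
    have hinc := hgap.upReg_incr hz.inner hd hH hH0 h.reg h'.reg hσ hSU hU hs hst ht
    have hval := (hgap.upReg_val hz.inner hd hH hH0 hH1 h.reg h'.reg hσ hSU hU hs
      (by linarith)).restrict hst.le (le_refl U)
    have k := F.lip_m₁.upReg_apply_sub hKA0 ((hYs.mono k1).prodMk (hi.osc.mono k2))
      ((hYs'.mono k1).prodMk (hi'.osc.mono k2))
      ((hval.prodMk (hinc.mono (mul_le_of_le_one_right (by positivity)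
        (hxH.trans hH1)))).congr fun p _ _ => rfl) hi hinc
    refine (k.congr fun p _ _ => by rw [← F.eq_m₁, ← F.eq_m₁]).mono ?_
    calc _ = N₁ * (H * d) * (t - s) ^ ρ := by rw [hN₁]; ring
      _ ≤ (N₁ + N₂) * (H * d) * (t - s) ^ ρ := by gcongr; linarith
      _ = _ := by rw [hN]; ring
  · have hx2 : 0 ≤ (t - s) ^ (2 * ρ) := Real.rpow_nonneg (by linarith) _
    have hxH : (t - s) ^ ρ ≤ H := (Real.rpow_le_rpow (by linarith) (by linarith) hρ.le).trans hH
    have hφ := upReg₂_compDeriv_sub F hK (h.osc s hs (by linarith)) (h'.osc s hs (by linarith))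
      (h.reg s hs (by linarith))
      (hgap.upReg_val hz.inner hd hH hH0 hH1 h.reg h'.reg hσ hSU hU hs (by linarith))
      ((hgap.upReg_deriv hd hρ hH hH0 hs (by linarith)).mono
        (le_mul_of_one_le_left (mul_nonneg hd hH0) hc1))
    have k := hz.upReg_volInt_sub_conv (U := U) (by linarith : 0 ≤ s) hst.le hU
      (hID.restrict hs ht) (hφ.restrict le_rfl (by linarith))
    refine (k.congr fun p hp hpU => ?_).mono ?_
    · have e := roughInt_sub hz.inner hρ hz.exp_gt (by linarith : 0 ≤ s) hst.le (by linarith)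
        (hz.outer s t p (by linarith) hp (by linarith)) (hI.restrict hs ht)
        (hI'.restrict hs ht)
      have e2 := conv_sub_right (W := V) hρ hst.le
        (hz.inner.holder (by linarith : 0 ≤ s) hp (by linarith))
        ((hI.restrict hs ht).reg s le_rfl hst.le) ((hI'.restrict hs ht).reg s le_rfl hst.le)
      simp only [volInt]
      rw [e, e2]
      rw [hY s t p hs hst ht hp hpU, hY' s t p hs hst ht hp hpU]
      simp only [volInt]
      abel
    · refine mul_le_mul_of_nonneg_right ?_ hx2
      calc _ ≤ conv₂C ρ ρ Z₀ * (L * (1 + 2 * K) * (1 + K) * (c * (d * H)) * Z₀) +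
            roughC ρ ρ Z₀ * (diffC T ρ Z₀ L K * (c * d) * Z₀) * H := by gcongr
        _ = N₂ * (H * d) := by rw [hN₂]; ring
        _ ≤ (N₁ + N₂) * (H * d) := by gcongr; linarith
        _ = _ := by rw [hN]; ring

end Gap

end SolutionMap

/-! ### Limits of controlled paths -/

section Limit

variable {W : Type*} [NormedAddCommGroup W] {s U M : ℝ} {A : ℕ → ℝ → W} {B : ℝ → W}

theorem tendsto_shift {B : Type*} [TopologicalSpace B] (n : ℕ) {u : ℕ → B} {l : B}
    (h : Tendsto u atTop (𝓝 l)) : Tendsto (fun k => u (n + k)) atTop (𝓝 l) := by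
  simpa only [add_comm] using (tendsto_add_atTop_iff_nat n).2 h

theorem UpOsc.of_tendsto (h : ∀ n, UpOsc s U M (A n))
    (hA : ∀ p, s ≤ p → p ≤ U → Tendsto (fun n => A n p) atTop (𝓝 (B p))) : UpOsc s U M B :=
  fun p q hp hpq hq => le_of_tendsto
    ((hA q (by linarith) hq).sub (hA p hp (by linarith))).norm
    (Eventually.of_forall fun n => h n p q hp hpq hq)

theorem UpReg.of_tendsto (h : ∀ n, UpReg s U M (A n))
    (hA : ∀ p, s ≤ p → p ≤ U → Tendsto (fun n => A n p) atTop (𝓝 (B p))) : UpReg s U M B :=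
  ⟨fun p hp hq => le_of_tendsto (hA p hp hq).norm (Eventually.of_forall fun n =>
    (h n).bound p hp hq), UpOsc.of_tendsto (fun n => (h n).osc) hA⟩

variable {E V : Type*} [NormedAddCommGroup E] [NormedSpace ℝ E]
  [NormedAddCommGroup V] [NormedSpace ℝ V] [CompleteSpace V]
  {z : ℝ → ℝ → E} {z2 : ℝ → ℝ → ℝ → TensorSq E} {T ρ Z₀ σ S K d d' H L : ℝ}
  {f : V → E →L[ℝ] V} {f' : V → V →L[ℝ] E →L[ℝ] V} {m₁ : V × V → V →L[ℝ] E →L[ℝ] V}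
  {m₂ n : V × V → V →L[ℝ] V →L[ℝ] E →L[ℝ] V}

theorem CtrlGap.trans {Y Y' Y'' : ℝ → ℝ → V} {Q Q' Q'' : ℝ → ℝ → E →L[ℝ] V}
    (h : CtrlGap z ρ σ S U d Y Y' Q Q') (h' : CtrlGap z ρ σ S U d' Y' Y'' Q' Q'') :
    CtrlGap z ρ σ S U (d + d') Y Y'' Q Q'' :=
  ⟨fun p hp hq => (h.start p hp hq).trans (h'.start p hp hq),
    fun p hp hq => (h.start' p hp hq).trans (h'.start' p hp hq),
    fun s t hs hst ht => by
      rw [add_mul]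
      exact ((h.incr s t hs hst ht).add (h'.incr s t hs hst ht)).congr fun p _ _ => by abel,
    fun s t hs hst ht => by
      rw [add_mul]
      exact ((h.rem s t hs hst ht).add (h'.rem s t hs hst ht)).congr fun p _ _ => by abel⟩

theorem CtrlGap.mono {Y Y' : ℝ → ℝ → V} {Q Q' : ℝ → ℝ → E →L[ℝ] V}
    (h : CtrlGap z ρ σ S U d Y Y' Q Q') (hd : d ≤ d') : CtrlGap z ρ σ S U d' Y Y' Q Q' :=
  ⟨h.start, h.start', fun s t hs hst ht => (h.incr s t hs hst ht).mono
      (mul_le_mul_of_nonneg_right hd (Real.rpow_nonneg (by linarith) _)),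
    fun s t hs hst ht => (h.rem s t hs hst ht).mono
      (mul_le_mul_of_nonneg_right hd (Real.rpow_nonneg (by linarith) _))⟩

theorem CtrlData.gap {Y Y' : ℝ → ℝ → V} {Q Q' : ℝ → ℝ → E →L[ℝ] V}
    (h : CtrlData z ρ σ S U K Y Q) (h' : CtrlData z ρ σ S U K Y' Q')
    (h0 : ∀ p, σ ≤ p → p ≤ U → Y σ p = Y' σ p) (h1 : ∀ p, σ ≤ p → p ≤ U → Q σ p = Q' σ p) :
    CtrlGap z ρ σ S U (2 * K) Y Y' Q Q' :=
  ⟨h0, h1, fun s t hs hst ht => by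
      rw [two_mul, add_mul]
      exact (h.incr s t hs hst ht).sub (h'.incr s t hs hst ht),
    fun s t hs hst ht => by
      rw [two_mul, add_mul]
      exact (h.rem s t hs hst ht).sub (h'.rem s t hs hst ht)⟩

theorem tendsto_conv {ζ : ℝ → E} {β Z : ℝ} {s t : ℝ} {q : ℕ → ℝ → E →L[ℝ] V}
    {q' : ℝ → E →L[ℝ] V} {ε : ℕ → ℝ} {M M' : ℝ} (hβ : 0 < β) (hst : s ≤ t)
    (hζ : HolderInc ζ s t β Z) (hq : ∀ n, UpReg s t M (q n)) (hq' : UpReg s t M' q')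
    (hε : ∀ n, UpReg s t (ε n) (fun p => q n p - q' p)) (hε0 : Tendsto ε atTop (𝓝 0)) :
    Tendsto (fun n => conv ζ (q n) s t) atTop (𝓝 (conv ζ q' s t)) := by
  rw [tendsto_iff_norm_sub_tendsto_zero]
  refine squeeze_zero (fun _ => norm_nonneg _) (fun n => ?_)
    (g := fun n => convC β * (ε n * Z * (t - s) ^ β)) ?_
  · rw [← conv_sub_right hβ hst hζ (hq n) hq']
    exact norm_conv_le hβ hst hζ (hε n)
  · simpa using ((hε0.mul_const Z).mul_const ((t - s) ^ β)).const_mul (convC β)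

/-- Small gaps make the values pointwise Cauchy, and all bounds are closed under pointwise limits.
The derivatives converge to f of the limit because each is f of the previous iterate and f is
continuous. -/
theorem exists_ctrlData_limit (hz : InnerDriver z T ρ Z₀) (hf : Continuous f)
    (hσ : 0 ≤ σ) (hσS : σ ≤ S) (hSU : S ≤ U) (hU : U ≤ T) (hH : (S - σ) ^ ρ ≤ H) (hH0 : 0 ≤ H)
    (hH1 : H ≤ 1) {Y : ℕ → ℝ → ℝ → V} {Q : ℕ → ℝ → ℝ → E →L[ℝ] V} {ε : ℕ → ℝ}
    (hε : ∀ n, 0 ≤ ε n) (hε0 : Tendsto ε atTop (𝓝 0))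
    (hdata : ∀ n, CtrlData z ρ σ S U K (Y n) (Q n))
    (hgap : ∀ n k, CtrlGap z ρ σ S U (ε n) (Y n) (Y (n + k)) (Q n) (Q (n + k)))
    (hQ : ∀ n s p, Q (n + 1) s p = f (Y n s p)) :
    ∃ Y' : ℝ → ℝ → V, CtrlData z ρ σ S U K Y' (fun s p => f (Y' s p)) ∧
      ∀ n, CtrlGap z ρ σ S U (ε n) (Y n) Y' (Q n) (fun s p => f (Y' s p)) := by
  have hρ := hz.exp_pos
  have hC := convC_pos hρ
  have hZ := hz.nonneg
  have hval : ∀ n k s, σ ≤ s → s ≤ S →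
      UpReg s U ((2 * convC ρ * Z₀ + 1) * (ε n * H)) (fun p => Y n s p - Y (n + k) s p) :=
    fun n k s hs hsS => (hgap n k).upReg_val hz (hε n) hH hH0 hH1 (hdata n).reg
      (hdata (n + k)).reg hσ hSU hU hs hsS
  have hb : Tendsto (fun n => 2 * ((2 * convC ρ * Z₀ + 1) * (ε n * H))) atTop (𝓝 0) := by
    simpa using ((hε0.mul_const H).const_mul (2 * convC ρ * Z₀ + 1)).const_mul 2
  have hlim : ∀ s p, ∃ v, σ ≤ s → s ≤ S → s ≤ p → p ≤ U →
      Tendsto (fun n => Y n s p) atTop (𝓝 v) := by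
    intro s p
    by_cases h : σ ≤ s ∧ s ≤ S ∧ s ≤ p ∧ p ≤ U
    · obtain ⟨hs, hsS, hp, hpU⟩ := h
      have hc : CauchySeq (fun n => Y n s p) := by
        refine cauchySeq_of_le_tendsto_0 _ (fun n m N hn hm => ?_) hb
        obtain ⟨a, rfl⟩ := Nat.exists_eq_add_of_le hn
        obtain ⟨b, rfl⟩ := Nat.exists_eq_add_of_le hm
        have h1 := (hval N a s hs hsS).bound p hp hpU
        have h2 := (hval N b s hs hsS).bound p hp hpU
        rw [two_mul]
        refine (dist_triangle_left _ _ (Y N s p)).trans (add_le_add ?_ ?_)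
        · rwa [dist_eq_norm]
        · rwa [dist_eq_norm]
      obtain ⟨v, hv⟩ := cauchySeq_tendsto_of_complete hc
      exact ⟨v, fun _ _ _ _ => hv⟩
    -- Outside the domain the limit function takes a dummy value.
    · exact ⟨0, fun h1 h2 h3 h4 => absurd ⟨h1, h2, h3, h4⟩ h⟩
  choose Y' hY' using hlim
  have hQlim : ∀ s p, σ ≤ s → s ≤ S → s ≤ p → p ≤ U →
      Tendsto (fun n => Q n s p) atTop (𝓝 (f (Y' s p))) := by
    intro s p h1 h2 h3 h4
    rw [← tendsto_add_atTop_iff_nat 1]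
    simp only [hQ]
    exact (hf.tendsto _).comp (hY' s p h1 h2 h3 h4)
  have hreg : ∀ s, σ ≤ s → s ≤ S → UpReg s U K (fun p => f (Y' s p)) := fun s hs hsS =>
    UpReg.of_tendsto (fun n => (hdata n).reg s hs hsS) fun p hp hpU => hQlim s p hs hsS hp hpU
  have hQε : ∀ n s, σ ≤ s → s ≤ S → UpReg s U (ε n * H) (fun p => Q n s p - f (Y' s p)) := by
    intro n s hs hsS
    refine UpReg.of_tendsto (A := fun k p => Q n s p - Q (n + k) s p) (fun k =>
      (hgap n k).upReg_deriv (hε n) hρ hH hH0 hs hsS) fun p hp hpU => ?_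
    exact tendsto_const_nhds.sub (tendsto_shift n (hQlim s p hs hsS hp hpU))
  have hεH : Tendsto (fun n => ε n * H) atTop (𝓝 0) := by simpa using hε0.mul_const H
  have hconv : ∀ s t p, σ ≤ s → s < t → t ≤ S → t ≤ p → p ≤ U →
      Tendsto (fun n => conv (fun r => z r p) (Q n s) s t) atTop
        (𝓝 (conv (fun r => z r p) (fun p => f (Y' s p)) s t)) := by
    intro s t p hs hst ht hp hpU
    exact tendsto_conv hρ hst.le (hz.holder (by linarith) hp (by linarith))
      (fun n => ((hdata n).reg s hs (by linarith)).restrict le_rfl (by linarith))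
      ((hreg s hs (by linarith)).restrict le_rfl (by linarith))
      (fun n => (hQε n s hs (by linarith)).restrict le_rfl (by linarith)) hεH
  have hrem : ∀ s t p, σ ≤ s → s < t → t ≤ S → t ≤ p → p ≤ U →
      Tendsto (fun n => Y n t p - Y n s p - conv (fun r => z r p) (Q n s) s t) atTop
        (𝓝 (Y' t p - Y' s p - conv (fun r => z r p) (fun p => f (Y' s p)) s t)) := by
    intro s t p hs hst ht hp hpU
    exact ((hY' t p (by linarith) ht hp hpU).sub
      (hY' s p hs (by linarith) (by linarith) hpU)).sub (hconv s t p hs hst ht hp hpU)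
  have hincr : ∀ s t p, σ ≤ s → s < t → t ≤ S → t ≤ p → p ≤ U →
      Tendsto (fun n => Q n t p - Q n s p) atTop (𝓝 (f (Y' t p) - f (Y' s p))) := by
    intro s t p hs hst ht hp hpU
    exact (hQlim t p (by linarith) ht hp hpU).sub
      (hQlim s p hs (by linarith) (by linarith) hpU)
  refine ⟨Y', ⟨fun s hs hsS => ?_, hreg, fun s t hs hst ht => ?_, fun s t hs hst ht => ?_⟩,
    fun n => ⟨fun p hp hpU => ?_, fun p hp hpU => ?_, fun s t hs hst ht => ?_,
      fun s t hs hst ht => ?_⟩⟩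
  · exact UpOsc.of_tendsto (fun n => (hdata n).osc s hs hsS) fun p hp hpU =>
      hY' s p hs hsS hp hpU
  · exact UpReg.of_tendsto (fun n => (hdata n).incr s t hs hst ht) fun p hp hpU =>
      hincr s t p hs hst ht hp hpU
  · exact UpReg.of_tendsto (fun n => (hdata n).rem s t hs hst ht) fun p hp hpU =>
      hrem s t p hs hst ht hp hpU
  · refine tendsto_nhds_unique ?_ (tendsto_shift n (hY' σ p le_rfl hσS hp hpU))
    exact tendsto_const_nhds.congr fun k => (hgap n k).start p hp hpU
  · refine tendsto_nhds_unique ?_ (tendsto_shift n (hQlim σ p le_rfl hσS hp hpU))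
    exact tendsto_const_nhds.congr fun k => (hgap n k).start' p hp hpU
  · exact UpReg.of_tendsto (fun k => (hgap n k).incr s t hs hst ht) fun p hp hpU =>
      tendsto_const_nhds.sub (tendsto_shift n (hincr s t p hs hst ht hp hpU))
  · exact UpReg.of_tendsto (fun k => (hgap n k).rem s t hs hst ht) fun p hp hpU =>
      tendsto_const_nhds.sub (tendsto_shift n (hrem s t p hs hst ht hp hpU))

end Limit

/-! ### Solutions on short intervals -/

section Window

variable {E V : Type*} [NormedAddCommGroup E] [NormedSpace ℝ E]
  [NormedAddCommGroup V] [NormedSpace ℝ V] [CompleteSpace V]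
  {z : ℝ → ℝ → E} {z2 : ℝ → ℝ → ℝ → TensorSq E} {T ρ Z₀ σ S U K d d' H L : ℝ}
  {f : V → E →L[ℝ] V} {f' : V → V →L[ℝ] E →L[ℝ] V} {m₁ : V × V → V →L[ℝ] E →L[ℝ] V}
  {m₂ n : V × V → V →L[ℝ] V →L[ℝ] E →L[ℝ] V}

/-- The bound of the increments of the solution on a short interval. -/
noncomputable def winC (ρ Z₀ L : ℝ) : ℝ := 2 * convC ρ * Z₀ * (3 * L) + 1

/-- The size of the solution on a short interval, as a controlled path. -/
noncomputable def ctrlC (ρ Z₀ L : ℝ) : ℝ :=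
  2 + 3 * L + 6 * L * winC ρ Z₀ L + (conv₂C ρ ρ Z₀ * (3 * L * (3 * L) * Z₀) + 1)

/-- The interval is short: its length to the power `ρ` is at most `H`, and `H` is small. -/
structure ShortWindow (T ρ Z₀ L H : ℝ) : Prop where
  nonneg : 0 ≤ H
  le_one : H ≤ 1
  ctrl : ctrlC ρ Z₀ L * H ≤ 1
  win : winC ρ Z₀ L * H ≤ 1
  int : roughC ρ ρ Z₀ * (dataC T ρ Z₀ L (ctrlC ρ Z₀ L) * Z₀) * H ≤ 1
  gap : gapC T ρ Z₀ L (ctrlC ρ Z₀ L) * H ≤ 1 / 2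

/-- A controlled path with the bounds which the solution map preserves. -/
structure WinData (z : ℝ → ℝ → E) (ρ Z₀ L σ S U : ℝ) (Y : ℝ → ℝ → V) (Q : ℝ → ℝ → E →L[ℝ] V) :
    Prop where
  data : CtrlData z ρ σ S U (ctrlC ρ Z₀ L) Y Q
  osc : ∀ s, σ ≤ s → s ≤ S → UpOsc s U 2 (Y s)
  reg : ∀ s, σ ≤ s → s ≤ S → UpReg s U (3 * L) (Q s)

/-- The solution map, with starting values `ξ`. -/
noncomputable def solMap (z : ℝ → ℝ → E) (z2 : ℝ → ℝ → ℝ → TensorSq E) (f : V → E →L[ℝ] V)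
    (f' : V → V →L[ℝ] E →L[ℝ] V) (σ : ℝ) (ξ : ℝ → V) (Y : ℝ → ℝ → V) (Q : ℝ → ℝ → E →L[ℝ] V)
    (t p : ℝ) : V :=
  ξ p + volInt z z2 (fun u p => f (Y u p)) (compDeriv f' Y Q) σ t p

theorem winC_nonneg (hz : InnerDriver z T ρ Z₀) (hL : 0 ≤ L) : 0 ≤ winC ρ Z₀ L := by
  have h1 := convC_pos hz.exp_pos
  have h2 := hz.nonneg
  unfold winC
  positivity

theorem ctrlC_nonneg (hz : InnerDriver z T ρ Z₀) (hL : 0 ≤ L) : 0 ≤ ctrlC ρ Z₀ L := by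
  have h1 := winC_nonneg hz hL
  have h2 := hz.nonneg
  have h3 := conv₂C_pos hz.exp_pos hz.exp_pos h2
  unfold ctrlC
  positivity

/-- The invariant bounds do not grow: oscillation 2 comes as 1 from the starting value and 1 from
the increments on a short window, which gives 3L = L(1 + 2) for f(Y). The increments of f(Y) then
have constant 6Lw. The large constant `ctrlC` acts on the output only through terms made harmless by
`H`. -/
theorem WinData.image (hz : RoughDriver z z2 T ρ Z₀) (F : Expansion L f f' m₁ m₂ n)
    (hT : 0 ≤ T) (hw : ShortWindow T ρ Z₀ L H) (hH : (S - σ) ^ ρ ≤ H)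
    (hσ : 0 ≤ σ) (hSU : S ≤ U) (hU : U ≤ T) {ξ : ℝ → V} (hξ : UpOsc σ U 1 ξ)
    {Y : ℝ → ℝ → V} {Q : ℝ → ℝ → E →L[ℝ] V} (h : WinData z ρ Z₀ L σ S U Y Q) :
    WinData z ρ Z₀ L σ S U (solMap z z2 f f' σ ξ Y Q) (fun u p => f (Y u p)) := by
  have hL := F.lip.nonneg
  have hZ := hz.inner.nonneg
  have hρ := hz.inner.exp_pos
  have hC2 := conv₂C_pos hρ hρ hZ
  have hc := convC_pos hρ
  set K := ctrlC ρ Z₀ L with hKdef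
  have hK : 0 ≤ K := ctrlC_nonneg hz.inner hL
  set w := winC ρ Z₀ L with hwdef
  have hw0 : 0 ≤ w := winC_nonneg hz.inner hL
  set K₂ := conv₂C ρ ρ Z₀ * (3 * L * (3 * L) * Z₀) + 1 with hK₂
  have hK₂0 : 0 ≤ K₂ := by positivity
  have hKK : K = 2 + 3 * L + 6 * L * w + K₂ := rfl
  have hLw : 0 ≤ 6 * L * w := by positivity
  have hI := h.data.intData hz.inner F hK hT hσ hSU hU
  have hP := hz.isPrimitive (U := U) hσ hU hI ξ
  have hx : ∀ s t, σ ≤ s → s < t → t ≤ S → 0 ≤ (t - s) ^ ρ ∧ (t - s) ^ ρ ≤ H :=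
    fun s t hs hst ht => ⟨Real.rpow_nonneg (by linarith) _,
      (Real.rpow_le_rpow (by linarith) (by linarith) hρ.le).trans hH⟩
  have hreg : ∀ s, σ ≤ s → s ≤ S → UpReg s U (3 * L) (fun p => f (Y s p)) := fun s hs hsS =>
    (F.lip.upReg_comp zero_le_two (h.osc s hs hsS)).mono (by linarith)
  have hrem : ∀ s t, σ ≤ s → s < t → t ≤ S → UpReg t U (K₂ * (t - s) ^ (2 * ρ))
      (fun p => solMap z z2 f f' σ ξ Y Q t p - solMap z z2 f f' σ ξ Y Q s p -
        conv (fun r => z r p) (fun p => f (Y s p)) s t) := by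
    intro s t hs hst ht
    have hφ : UpReg₂ s U (L * (1 + 2) * (3 * L)) (compDeriv f' Y Q s) :=
      (F.lip'.upReg_comp zero_le_two (h.osc s hs (by linarith))).comp₂ (h.reg s hs (by linarith))
    refine (hz.upReg_rem_of_isPrimitive hσ hU hI hP hs hst ht (hφ.restrict le_rfl hSU)).mono ?_
    refine mul_le_mul_of_nonneg_right ?_ (Real.rpow_nonneg (by linarith) _)
    have h1 : roughC ρ ρ Z₀ * (dataC T ρ Z₀ L K * Z₀) * (t - s) ^ ρ ≤ 1 := by
      refine le_trans (mul_le_mul_of_nonneg_left (hx s t hs hst ht).2 ?_) hw.int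
      exact mul_nonneg (roughC_pos hρ hρ hz.exp_gt hZ).le
        (mul_nonneg (hI.nonneg (by linarith)) hZ)
    calc _ ≤ conv₂C ρ ρ Z₀ * (L * (1 + 2) * (3 * L) * Z₀) + 1 := by linarith
      _ = K₂ := by rw [hK₂]; ring
  -- A remainder of order 2ρ is absorbed into an increment of order ρ, since its constant times `H`
  -- is at most 1.
  have hsmall : ∀ {x k : ℝ}, 0 ≤ x → x ≤ H → k ≤ K → 0 ≤ k →
      2 * convC ρ * Z₀ * (3 * L) * x + k * (x * x) ≤ w * x := by
    intro x k hx0 hxH hk hk0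
    have h1 : k * x ≤ 1 := (mul_le_mul hk hxH hx0 hK).trans hw.ctrl
    have h2 : k * (x * x) ≤ x := by
      rw [← mul_assoc]; exact mul_le_of_le_one_left hx0 h1
    calc _ ≤ 2 * convC ρ * Z₀ * (3 * L) * x + x := by linarith
      _ = w * x := by rw [hwdef, winC]; ring
  have hwx : ∀ {x : ℝ}, x ≤ H → w * x ≤ 1 := fun hxH =>
    (mul_le_mul_of_nonneg_left hxH hw0).trans hw.win
  have hosc : ∀ s, σ ≤ s → s ≤ S → UpOsc s U 2 (solMap z z2 f f' σ ξ Y Q s) := by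
    intro s hs hsS
    rcases hs.eq_or_lt with rfl | hs
    · refine (hξ.mono one_le_two).congr fun p _ _ => ?_
      rw [solMap, volInt_self, add_zero]
    · have hxs := hx σ s le_rfl hs hsS
      have k := (upReg_incr_of_rem hz.inner hσ hs hU
        ((hreg σ le_rfl (by linarith)).restrict le_rfl (by linarith)) (hrem σ s le_rfl hs hsS)).mono
        (M' := 1) (by
          rw [rpow_two_mul (by linarith)]
          exact (hsmall hxs.1 hxs.2 (by linarith) hK₂0).trans (hwx hxs.2))
      have hξ' := hξ.restrict zero_le_one hs.le le_rfl
      refine ((hξ'.add k.osc).congr fun p _ _ => ?_).mono (by norm_num)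
      simp only [solMap, volInt_self]
      abel
  refine ⟨⟨fun s hs hsS => (hosc s hs hsS).mono (by linarith),
    fun s hs hsS => (hreg s hs hsS).mono (by linarith), fun s t hs hst ht => ?_,
    fun s t hs hst ht => (hrem s t hs hst ht).mono (mul_le_mul_of_nonneg_right (by linarith)
      (Real.rpow_nonneg (by linarith) _))⟩, hosc, hreg⟩
  have hxs := hx s t hs hst ht
  have k : UpReg t U (w * (t - s) ^ ρ) (fun p => Y t p - Y s p) :=
    (upReg_incr_of_rem hz.inner (by linarith) hst hU ((h.reg s hs (by linarith)).restrict le_rfl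
      (by linarith)) (h.data.rem s t hs hst ht)).mono (by
        rw [rpow_two_mul (by linarith)]
        exact hsmall hxs.1 hxs.2 le_rfl hK)
  have hA : UpOsc t U 2 (fun p => (Y s p, Y t p - Y s p)) :=
    ((h.osc s hs (by linarith)).restrict zero_le_two hst.le le_rfl).prodMk
      (k.osc.mono ((hwx hxs.2).trans one_le_two))
  refine (((F.lip_m₁.upReg_comp zero_le_two hA).clm_apply k).congr fun p _ _ =>
    (F.eq_m₁ _ _).symm).mono ?_
  calc _ = 6 * L * w * (t - s) ^ ρ := by ring
    _ ≤ K * (t - s) ^ ρ := mul_le_mul_of_nonneg_right (by linarith) hxs.1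

/-- Constant in the lower variable with derivative zero: the remainder vanishes, and the Picard
iteration can start here. -/
theorem WinData.const (hz : InnerDriver z T ρ Z₀) (hL : 0 ≤ L) {ξ : ℝ → V}
    (hξ : UpOsc σ U 1 ξ) :
    WinData z ρ Z₀ L σ S U (fun _ => ξ) (fun _ _ => (0 : E →L[ℝ] V)) := by
  have hK := ctrlC_nonneg (T := T) hz hL
  have h2 : 2 ≤ ctrlC ρ Z₀ L := by
    have h1 := winC_nonneg hz hL
    have h2 := hz.nonneg
    have h3 := conv₂C_pos hz.exp_pos hz.exp_pos h2
    have : 0 ≤ 3 * L + 6 * L * winC ρ Z₀ L +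
      (conv₂C ρ ρ Z₀ * (3 * L * (3 * L) * Z₀) + 1) := by positivity
    unfold ctrlC
    linarith
  have hosc : ∀ s, σ ≤ s → s ≤ S → UpOsc s U 2 ξ := fun s hs _ =>
    (hξ.restrict zero_le_one hs le_rfl).mono one_le_two
  refine ⟨⟨fun s hs hsS => (hosc s hs hsS).mono h2, fun _ _ _ => UpReg.zero hK,
    fun s t _ hst _ => ?_, fun s t _ hst _ => ?_⟩, hosc, fun _ _ _ => UpReg.zero (by positivity)⟩
  · exact (UpReg.zero (mul_nonneg hK (Real.rpow_nonneg (by linarith) _))).congr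
      fun p _ _ => (sub_self _).symm
  · refine (UpReg.zero (mul_nonneg hK (Real.rpow_nonneg (by linarith) _))).congr
      fun p _ _ => ?_
    rw [conv_const _ _ hst.le]
    simp

/-- The Picard iterates. -/
noncomputable def picard (z : ℝ → ℝ → E) (z2 : ℝ → ℝ → ℝ → TensorSq E) (f : V → E →L[ℝ] V)
    (f' : V → V →L[ℝ] E →L[ℝ] V) (σ : ℝ) (ξ : ℝ → V) :
    ℕ → (ℝ → ℝ → V) × (ℝ → ℝ → E →L[ℝ] V)
  | 0 => (fun _ => ξ, fun _ _ => 0)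
  | k + 1 => (solMap z z2 f f' σ ξ (picard z z2 f f' σ ξ k).1 (picard z z2 f f' σ ξ k).2,
      fun u p => f ((picard z z2 f f' σ ξ k).1 u p))

theorem solMap_start (ξ : ℝ → V) (Y : ℝ → ℝ → V) (Q : ℝ → ℝ → E →L[ℝ] V) (p : ℝ) :
    solMap z z2 f f' σ ξ Y Q σ p = ξ p := by
  rw [solMap, volInt_self, add_zero]

/-- Picard iteration inside the invariant class, where gaps between paths with the same starting
data are halved at each step. -/
theorem exists_solution_window (hz : RoughDriver z z2 T ρ Z₀) (F : Expansion L f f' m₁ m₂ n)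
    (hT : 0 ≤ T) (hw : ShortWindow T ρ Z₀ L H) (hH : (S - σ) ^ ρ ≤ H)
    (hσ : 0 ≤ σ) (hσS : σ ≤ S) (hSU : S ≤ U) (hU : U ≤ T) {ξ : ℝ → V} (hξ : UpOsc σ U 1 ξ) :
    ∃ Y : ℝ → ℝ → V, CtrlData z ρ σ S U (ctrlC ρ Z₀ L) Y (fun s p => f (Y s p)) ∧
      ∀ t p, σ ≤ t → t ≤ S → t ≤ p → p ≤ U →
        Y t p = solMap z z2 f f' σ ξ Y (fun s p => f (Y s p)) t p := by
  have hL := F.lip.nonneg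
  set K := ctrlC ρ Z₀ L with hKdef
  have hK : 0 ≤ K := ctrlC_nonneg hz.inner hL
  set P := picard z z2 f f' σ ξ with hP
  have hdata : ∀ k, WinData z ρ Z₀ L σ S U (P k).1 (P k).2 := by
    intro k
    induction k with
    | zero => exact WinData.const hz.inner hL hξ
    | succ k ih => exact ih.image hz F hT hw hH hσ hSU hU hξ
  have hprim : ∀ {Y : ℝ → ℝ → V} {Q : ℝ → ℝ → E →L[ℝ] V}, CtrlData z ρ σ S U K Y Q →
      IsPrimitive z z2 σ S U (fun u p => f (Y u p)) (compDeriv f' Y Q)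
        (solMap z z2 f f' σ ξ Y Q) := fun h =>
    hz.isPrimitive hσ hU (h.intData hz.inner F hK hT hσ hSU hU) ξ
  have himage : ∀ {Y Y' : ℝ → ℝ → V} {Q Q' : ℝ → ℝ → E →L[ℝ] V} {d : ℝ}, 0 ≤ d →
      CtrlData z ρ σ S U K Y Q → CtrlData z ρ σ S U K Y' Q' →
      CtrlGap z ρ σ S U d Y Y' Q Q' →
      CtrlGap z ρ σ S U (d / 2) (solMap z z2 f f' σ ξ Y Q) (solMap z z2 f f' σ ξ Y' Q')
        (fun u p => f (Y u p)) (fun u p => f (Y' u p)) := by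
    intro Y Y' Q Q' d hd h h' hg
    refine (hg.image hz F hK hT hd hH hw.nonneg hw.le_one hσ hSU hU h h' (hprim h) (hprim h')
      fun p _ _ => by rw [solMap_start, solMap_start]).mono ?_
    calc _ ≤ 1 / 2 * d := mul_le_mul_of_nonneg_right hw.gap hd
      _ = _ := by ring
  have hstart : ∀ k p, (P k).1 σ p = ξ p := by
    intro k p
    cases k with
    | zero => rfl
    | succ k => exact solMap_start ξ _ _ p
  have hε : ∀ k : ℕ, 0 ≤ 2 * K / 2 ^ k := fun k => by positivity
  -- The comparison starts at index 1: the derivative of the zeroth iterate is 0 and need not have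
  -- the value f(ξ) at σ, which all later ones share.
  have hstep : ∀ k, CtrlGap z ρ σ S U (2 * K / 2 ^ k) (P (k + 1)).1 (P (k + 2)).1
      (P (k + 1)).2 (P (k + 2)).2 := by
    intro k
    induction k with
    | zero =>
      refine ((hdata 1).data.gap (hdata 2).data (fun p _ _ => by rw [hstart, hstart])
        fun p _ _ => ?_).mono (by rw [pow_zero, div_one])
      change f ((P 0).1 σ p) = f ((P 1).1 σ p)
      rw [hstart, hstart]
    | succ k ih =>
      refine (himage (hε k) (hdata (k + 1)).data (hdata (k + 2)).data ih).mono (le_of_eq ?_)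
      rw [pow_succ]
      field_simp
  -- The geometric series of the steps sums to twice its first term.
  have hgap : ∀ j k, CtrlGap z ρ σ S U (2 * (2 * K / 2 ^ k)) (P (k + 1)).1 (P (k + j + 1)).1
      (P (k + 1)).2 (P (k + j + 1)).2 := by
    intro j
    induction j with
    | zero =>
      intro k
      refine ⟨fun _ _ _ => rfl, fun _ _ _ => rfl, fun s t _ hst _ => ?_, fun s t _ hst _ => ?_⟩
      · exact (UpReg.zero (mul_nonneg (mul_nonneg zero_le_two (hε k))
          (Real.rpow_nonneg (by linarith) _))).congr fun p _ _ => (sub_self _).symm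
      · exact (UpReg.zero (mul_nonneg (mul_nonneg zero_le_two (hε k))
          (Real.rpow_nonneg (by linarith) _))).congr fun p _ _ => (sub_self _).symm
    | succ j ih =>
      intro k
      have e : k + (j + 1) + 1 = (k + 1) + j + 1 := by ring
      rw [e]
      refine ((hstep k).trans (ih (k + 1))).mono (le_of_eq ?_)
      rw [pow_succ]
      field_simp
      ring
  have hlim : Tendsto (fun k : ℕ => 2 * (2 * K / 2 ^ k)) atTop (𝓝 0) := by
    have := (tendsto_const_nhds (x := 2 * K)).div_atTop
      (tendsto_pow_atTop_atTop_of_one_lt (one_lt_two (α := ℝ)))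
    simpa using this.const_mul 2
  obtain ⟨Y, hY, hYgap⟩ := exists_ctrlData_limit hz.inner F.lip.continuous hσ hσS hSU hU hH
    hw.nonneg hw.le_one (Y := fun k => (P (k + 1)).1) (Q := fun k => (P (k + 1)).2)
    (fun k => mul_nonneg zero_le_two (hε k)) hlim (fun k => (hdata (k + 1)).data)
    (fun k j => hgap j k) (fun k s p => rfl)
  refine ⟨Y, hY, fun t p ht htS hp hpU => ?_⟩
  -- The iterate `P (k + 2)` is close to the limit `Y`, and as the image of `P (k + 1)` it is also
  -- close to the image of `Y`.
  have hval : ∀ k, ‖Y t p - solMap z z2 f f' σ ξ Y (fun s p => f (Y s p)) t p‖ ≤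
      (2 * convC ρ * Z₀ + 1) * (2 * (2 * K / 2 ^ k) * H) := by
    intro k
    have h1 := ((hYgap (k + 1)).upReg_val hz.inner (mul_nonneg zero_le_two (hε _)) hH hw.nonneg
      hw.le_one (hdata _).data.reg hY.reg hσ hSU hU ht htS).bound p hp hpU
    have h2 := ((himage (mul_nonneg zero_le_two (hε k)) (hdata (k + 1)).data hY
      (hYgap k)).upReg_val hz.inner (div_nonneg (mul_nonneg zero_le_two (hε k)) zero_le_two) hH
      hw.nonneg hw.le_one (hdata (k + 2)).data.reg hY.reg hσ hSU hU ht htS).bound p hp hpU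
    rw [← norm_neg] at h1
    refine le_trans (le_of_eq ?_) ((norm_add_le_of_le h1 h2).trans (le_of_eq ?_))
    · congr 1
      change _ = -((P (k + 2)).1 t p - Y t p) + ((P (k + 2)).1 t p - _)
      abel
    · rw [pow_succ]
      field_simp
      ring
  have h0 : Tendsto (fun k : ℕ => (2 * convC ρ * Z₀ + 1) * (2 * (2 * K / 2 ^ k) * H)) atTop
      (𝓝 0) := by
    simpa using (hlim.mul_const H).const_mul (2 * convC ρ * Z₀ + 1)
  exact sub_eq_zero.1 (norm_le_zero_iff.1 (ge_of_tendsto' h0 hval))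

end Window

/-! ### Gluing solutions -/

section Glue

variable {E V : Type*} [NormedAddCommGroup E] [NormedSpace ℝ E]
  [NormedAddCommGroup V] [NormedSpace ℝ V] [CompleteSpace V]
  {z : ℝ → ℝ → E} {z2 : ℝ → ℝ → ℝ → TensorSq E} {T ρ Z₀ σ S U K K' d H L : ℝ}
  {f : V → E →L[ℝ] V} {f' : V → V →L[ℝ] E →L[ℝ] V} {m₁ : V × V → V →L[ℝ] E →L[ℝ] V}
  {m₂ n : V × V → V →L[ℝ] V →L[ℝ] E →L[ℝ] V}
  {Y Y' : ℝ → ℝ → V} {Q Q' : ℝ → ℝ → E →L[ℝ] V}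

theorem CtrlData.mono (h : CtrlData z ρ σ S U K Y Q) (hK : K ≤ K') :
    CtrlData z ρ σ S U K' Y Q :=
  ⟨fun s hs hsS => (h.osc s hs hsS).mono hK, fun s hs hsS => (h.reg s hs hsS).mono hK,
    fun s t hs hst ht => (h.incr s t hs hst ht).mono
      (mul_le_mul_of_nonneg_right hK (Real.rpow_nonneg (by linarith) _)),
    fun s t hs hst ht => (h.rem s t hs hst ht).mono
      (mul_le_mul_of_nonneg_right hK (Real.rpow_nonneg (by linarith) _))⟩

theorem CtrlData.restrict {σ' S' U' : ℝ} (h : CtrlData z ρ σ S U K Y Q) (hK : 0 ≤ K)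
    (hσ : σ ≤ σ') (hS : S' ≤ S) (hU : U' ≤ U) : CtrlData z ρ σ' S' U' K Y Q :=
  ⟨fun s hs hsS => (h.osc s (hσ.trans hs) (hsS.trans hS)).restrict hK le_rfl hU,
    fun s hs hsS => (h.reg s (hσ.trans hs) (hsS.trans hS)).restrict le_rfl hU,
    fun s t hs hst ht => (h.incr s t (hσ.trans hs) hst (ht.trans hS)).restrict le_rfl hU,
    fun s t hs hst ht => (h.rem s t (hσ.trans hs) hst (ht.trans hS)).restrict le_rfl hU⟩

theorem CtrlData.congr (h : CtrlData z ρ σ S U K Y Q) (hSU : S ≤ U)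
    (hY : ∀ s p, σ ≤ s → s ≤ S → s ≤ p → p ≤ U → Y s p = Y' s p)
    (hQ : ∀ s p, σ ≤ s → s ≤ S → s ≤ p → p ≤ U → Q s p = Q' s p) :
    CtrlData z ρ σ S U K Y' Q' :=
  ⟨fun s hs hsS => (h.osc s hs hsS).congr fun p hp hpU => hY s p hs hsS hp hpU,
    fun s hs hsS => (h.reg s hs hsS).congr fun p hp hpU => hQ s p hs hsS hp hpU,
    fun s t hs hst ht => (h.incr s t hs hst ht).congr fun p hp hpU => by
      rw [hQ t p (by linarith) ht hp hpU, hQ s p hs (by linarith) (by linarith) hpU],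
    fun s t hs hst ht => (h.rem s t hs hst ht).congr fun p hp hpU => by
      rw [hY t p (by linarith) ht hp hpU, hY s p hs (by linarith) (by linarith) hpU,
        conv_congr (fun _ _ _ _ _ => rfl) fun a ha hat => hQ s a hs (by linarith) ha
          (by linarith)]⟩

/-- For s < m < t the remainder over [s, t] is the sum of the two remainders and of the convolution
of `Q m - Q s` over [m, t], which has order ρ + ρ. -/
theorem CtrlData.glue (hz : InnerDriver z T ρ Z₀) {m : ℝ} (hK : 0 ≤ K) (hσ : 0 ≤ σ)
    (hSU : S ≤ U) (hU : U ≤ T)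
    (h : CtrlData z ρ σ m U K Y Q) (h' : CtrlData z ρ m S U K Y Q) :
    CtrlData z ρ σ S U ((2 + 2 * convC ρ * Z₀) * K) Y Q := by
  have hC := convC_pos hz.exp_pos
  have hZ := hz.nonneg
  have hk : 0 ≤ 2 * convC ρ * Z₀ * K := by positivity
  have hKK : K ≤ (2 + 2 * convC ρ * Z₀) * K := by linarith
  have g := h.mono hKK
  have g' := h'.mono hKK
  refine ⟨fun s hs hsS => ?_, fun s hs hsS => ?_, fun s t hs hst ht => ?_,
    fun s t hs hst ht => ?_⟩
  · rcases le_total s m with hsm | hsm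
    · exact g.osc s hs hsm
    · exact g'.osc s hsm hsS
  · rcases le_total s m with hsm | hsm
    · exact g.reg s hs hsm
    · exact g'.reg s hsm hsS
  · rcases le_or_gt m s with hms | hsm
    · exact g'.incr s t hms hst ht
    rcases le_or_gt t m with htm | hmt
    · exact g.incr s t hs hst htm
    have h1 := (h.incr s m hs hsm le_rfl).restrict hmt.le le_rfl
    have h2 := h'.incr m t le_rfl hmt ht
    refine ((h1.add h2).congr fun p _ _ => by abel).mono ?_
    have e1 : (m - s) ^ ρ ≤ (t - s) ^ ρ :=
      Real.rpow_le_rpow (by linarith) (by linarith) hz.exp_pos.le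
    have e2 : (t - m) ^ ρ ≤ (t - s) ^ ρ :=
      Real.rpow_le_rpow (by linarith) (by linarith) hz.exp_pos.le
    have e3 : 0 ≤ (t - s) ^ ρ := Real.rpow_nonneg (by linarith) _
    nlinarith [mul_le_mul_of_nonneg_left e1 hK, mul_le_mul_of_nonneg_left e2 hK,
      mul_nonneg hk e3]
  · rcases le_or_gt m s with hms | hsm
    · exact g'.rem s t hms hst ht
    rcases le_or_gt t m with htm | hmt
    · exact g.rem s t hs hst htm
    have h1 := (h.rem s m hs hsm le_rfl).restrict hmt.le le_rfl
    have h2 := h'.rem m t le_rfl hmt ht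
    have hQs := (h.reg s hs hsm.le).restrict hsm.le (show t ≤ U by linarith)
    have hQm := (h'.reg m le_rfl (by linarith)).restrict (le_refl m) (show t ≤ U by linarith)
    have h3 := hz.upReg_conv_const (U := U) (by linarith : 0 ≤ m) hmt.le hU
      ((h.incr s m hs hsm le_rfl).restrict le_rfl (show t ≤ U by linarith))
    refine (((h1.add h2).add h3).congr fun p hp hpU => ?_).mono ?_
    · have hζ := hz.holder (s := s) (by linarith) hp (by linarith : p ≤ T)
      rw [conv_sub_right hz.exp_pos hmt.le (hζ.restrict hsm.le le_rfl) hQm hQs,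
        conv_concat hz.exp_pos hsm.le hmt.le hζ ((h.reg s hs hsm.le).restrict le_rfl
          (by linarith))]
      abel
    · rw [rpow_two_mul (by linarith), rpow_two_mul (by linarith), rpow_two_mul (by linarith)]
      have e1 : (m - s) ^ ρ ≤ (t - s) ^ ρ :=
        Real.rpow_le_rpow (by linarith) (by linarith) hz.exp_pos.le
      have e2 : (t - m) ^ ρ ≤ (t - s) ^ ρ :=
        Real.rpow_le_rpow (by linarith) (by linarith) hz.exp_pos.le
      have e3 : 0 ≤ (m - s) ^ ρ := Real.rpow_nonneg (by linarith) _
      have e4 : 0 ≤ (t - m) ^ ρ := Real.rpow_nonneg (by linarith) _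
      calc _ = K * ((m - s) ^ ρ * (m - s) ^ ρ) + K * ((t - m) ^ ρ * (t - m) ^ ρ) +
            2 * convC ρ * Z₀ * K * ((m - s) ^ ρ * (t - m) ^ ρ) := by ring
        _ ≤ K * ((t - s) ^ ρ * (t - s) ^ ρ) + K * ((t - s) ^ ρ * (t - s) ^ ρ) +
            2 * convC ρ * Z₀ * K * ((t - s) ^ ρ * (t - s) ^ ρ) := by gcongr
        _ = _ := by ring

/-- The bound of the remainder of a solution, for all upper variables. -/
noncomputable def remC (T ρ Z₀ L K : ℝ) : ℝ :=
  conv₂C ρ ρ Z₀ * (L * (1 + K) * K * Z₀) + roughC ρ ρ Z₀ * (dataC T ρ Z₀ L K * Z₀) * T ^ ρ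

/-- The bound of the increments of a solution, for all upper variables. -/
noncomputable def stepC (T ρ Z₀ L K : ℝ) : ℝ :=
  2 * convC ρ * Z₀ * K + remC T ρ Z₀ L K * T ^ ρ

/-- The integral over [s, t] evaluates its integrand only at upper variables at most t ≤ S; the
upper variable `p` enters through the driver alone. Data on [σ, S] therefore control the remainder
for all p up to T. -/
theorem CtrlData.upReg_rem_extend (hz : RoughDriver z z2 T ρ Z₀) (F : Expansion L f f' m₁ m₂ n)
    (hK : 0 ≤ K) (hσ : 0 ≤ σ) (hST : S ≤ T) (h : CtrlData z ρ σ S S K Y Q)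
    (hP : IsPrimitive z z2 σ S T (fun u p => f (Y u p)) (compDeriv f' Y Q) Y')
    {s t : ℝ} (hs : σ ≤ s) (hst : s < t) (ht : t ≤ S) :
    UpReg t T (remC T ρ Z₀ L K * (t - s) ^ (2 * ρ))
      (fun p => Y' t p - Y' s p - conv (fun r => z r p) (fun q => f (Y s q)) s t) := by
  have hZ := hz.inner.nonneg
  have hρ := hz.inner.exp_pos
  have hI := h.intData hz.inner F hK (by linarith) hσ le_rfl hST
  refine (hz.upReg_rem_of_isPrimitive hσ le_rfl hI hP hs hst ht (upReg₂_compDeriv F hK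
    (h.osc s hs (by linarith)) (h.reg s hs (by linarith)))).mono ?_
  refine mul_le_mul_of_nonneg_right ?_ (Real.rpow_nonneg (by linarith) _)
  rw [remC]
  refine add_le_add_right (mul_le_mul_of_nonneg_left
    (Real.rpow_le_rpow (by linarith) (by linarith) hρ.le) ?_) _
  exact mul_nonneg (roughC_pos hρ hρ hz.exp_gt hZ).le
    (mul_nonneg (hI.nonneg (by linarith)) hZ)

theorem dataC_nonneg (hz : InnerDriver z T ρ Z₀) (hT : 0 ≤ T) (hL : 0 ≤ L) (hK : 0 ≤ K) :
    0 ≤ dataC T ρ Z₀ L K := by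
  have := pathC_nonneg hz hT
  unfold dataC
  positivity

theorem remC_nonneg (hz : RoughDriver z z2 T ρ Z₀) (hT : 0 ≤ T) (hL : 0 ≤ L) (hK : 0 ≤ K) :
    0 ≤ remC T ρ Z₀ L K := by
  have h2 := dataC_nonneg hz.inner hT hL hK
  have h4 := conv₂C_pos hz.inner.exp_pos hz.inner.exp_pos hz.inner.nonneg
  have h5 := roughC_pos hz.inner.exp_pos hz.inner.exp_pos hz.exp_gt hz.inner.nonneg
  have h6 := hz.inner.nonneg
  unfold remC
  positivity

theorem stepC_nonneg (hz : RoughDriver z z2 T ρ Z₀) (hT : 0 ≤ T) (hL : 0 ≤ L) (hK : 0 ≤ K) :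
    0 ≤ stepC T ρ Z₀ L K := by
  have h2 := remC_nonneg hz hT hL hK
  have h3 := convC_pos hz.inner.exp_pos
  have h6 := hz.inner.nonneg
  unfold stepC
  positivity

/-- The constant involves only the bound `K` on the window, and not the oscillation of the starting
value beyond `S`. The continuation argument rests on this. -/
theorem upReg_incr_extend (hz : RoughDriver z z2 T ρ Z₀)
    (F : Expansion L f f' m₁ m₂ n) (hK : 0 ≤ K) (hσ : 0 ≤ σ) (hST : S ≤ T)
    (h : CtrlData z ρ σ S S K Y (fun u p => f (Y u p)))
    (hP : IsPrimitive z z2 σ S T (fun u p => f (Y u p)) (compDeriv f' Y (fun u p => f (Y u p)))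
      Y) {s t : ℝ} (hs : σ ≤ s) (hst : s < t) (ht : t ≤ S) :
    UpReg t T (stepC T ρ Z₀ L K * (t - s) ^ ρ) (fun p => Y t p - Y s p) := by
  have hx : 0 ≤ (t - s) ^ ρ := Real.rpow_nonneg (by linarith) _
  have hxT : (t - s) ^ ρ ≤ T ^ ρ :=
    Real.rpow_le_rpow (by linarith) (by linarith) hz.inner.exp_pos.le
  refine (upReg_incr_of_rem hz.inner (by linarith) hst le_rfl ((h.reg s hs
    (by linarith)).restrict le_rfl ht) (h.upReg_rem_extend hz F hK hσ hST hP hs hst ht)).mono ?_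
  rw [rpow_two_mul (by linarith), stepC]
  have h0 := remC_nonneg hz (by linarith) F.lip.nonneg hK
  nlinarith [mul_nonneg (mul_nonneg h0 hx) (sub_nonneg.2 hxT)]

/-- For a path whose derivative is f(Y), oscillation and remainder suffice: oscillation makes f(Y)
regular, the remainder then bounds the increments of Y, and the coefficient `m₁` carries these over
to f(Y). -/
theorem exists_ctrlData_of_rem (hz : InnerDriver z T ρ Z₀) (F : Expansion L f f' m₁ m₂ n)
    {A B : ℝ} (hA : 0 ≤ A) (hB : 0 ≤ B) (hσ : 0 ≤ σ) (hσS : σ ≤ S) (hSU : S ≤ U) (hU : U ≤ T)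
    (hosc : ∀ s, σ ≤ s → s ≤ S → UpOsc s U A (Y s))
    (hrem : ∀ s t, σ ≤ s → s < t → t ≤ S → UpReg t U (B * (t - s) ^ (2 * ρ))
      (fun p => Y t p - Y s p - conv (fun r => z r p) (fun q => f (Y s q)) s t)) :
    ∃ K, 0 ≤ K ∧ CtrlData z ρ σ S U K Y (fun u p => f (Y u p)) := by
  have hL := F.lip.nonneg
  have hC := convC_pos hz.exp_pos
  have hZ := hz.nonneg
  have hT : 0 ≤ T ^ ρ := Real.rpow_nonneg (by linarith) _
  have t1 : 0 ≤ L * (1 + A) := by positivity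
  set c := 2 * convC ρ * Z₀ * (L * (1 + A)) + B * T ^ ρ with hc
  have hc0 : 0 ≤ c := by positivity
  set A' := A + c * T ^ ρ with hA'
  have hcT : 0 ≤ c * T ^ ρ := by positivity
  have hAA' : A ≤ A' := by linarith
  have hA'0 : 0 ≤ A' := hA.trans hAA'
  have hreg : ∀ s, σ ≤ s → s ≤ S → UpReg s U (L * (1 + A)) (fun p => f (Y s p)) :=
    fun s hs hsS => F.lip.upReg_comp hA (hosc s hs hsS)
  have t2 : 0 ≤ 2 * (L * (1 + A')) * c := by positivity
  refine ⟨A + L * (1 + A) + 2 * (L * (1 + A')) * c + B, by positivity,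
    fun s hs hsS => (hosc s hs hsS).mono (by linarith),
    fun s hs hsS => (hreg s hs hsS).mono (by linarith),
    fun s t hs hst ht => ?_, fun s t hs hst ht => (hrem s t hs hst ht).mono
      (mul_le_mul_of_nonneg_right (by linarith) (Real.rpow_nonneg (by linarith) _))⟩
  have hx : 0 ≤ (t - s) ^ ρ := Real.rpow_nonneg (by linarith) _
  have hxT : (t - s) ^ ρ ≤ T ^ ρ := Real.rpow_le_rpow (by linarith) (by linarith) hz.exp_pos.le
  have k : UpReg t U (c * (t - s) ^ ρ) (fun p => Y t p - Y s p) := by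
    refine (upReg_incr_of_rem hz (by linarith) hst hU ((hreg s hs (by linarith)).restrict le_rfl
      (by linarith)) (hrem s t hs hst ht)).mono ?_
    rw [rpow_two_mul (by linarith), hc]
    nlinarith [mul_nonneg (mul_nonneg hB hx) (sub_nonneg.2 hxT)]
  have hpair : UpOsc t U A' (fun p => (Y s p, Y t p - Y s p)) :=
    (((hosc s hs (by linarith)).restrict hA hst.le le_rfl).mono hAA').prodMk
      (k.osc.mono (by linarith [mul_le_mul_of_nonneg_left hxT hc0]))
  refine (((F.lip_m₁.upReg_comp hA'0 hpair).clm_apply k).congr fun p _ _ =>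
    (F.eq_m₁ _ _).symm).mono ?_
  calc _ = 2 * (L * (1 + A')) * c * (t - s) ^ ρ := by ring
    _ ≤ _ := mul_le_mul_of_nonneg_right (by linarith) hx

theorem exists_ctrlData_extend (hz : RoughDriver z z2 T ρ Z₀)
    (F : Expansion L f f' m₁ m₂ n) (hK : 0 ≤ K) (hσ : 0 ≤ σ) (hσS : σ ≤ S) (hST : S ≤ T)
    (h : CtrlData z ρ σ S S K Y (fun u p => f (Y u p)))
    (hP : IsPrimitive z z2 σ S T (fun u p => f (Y u p)) (compDeriv f' Y (fun u p => f (Y u p)))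
      Y) (hK' : 0 ≤ K') (hξ : UpOsc σ T K' (Y σ)) :
    ∃ K'', 0 ≤ K'' ∧ CtrlData z ρ σ S T K'' Y (fun u p => f (Y u p)) := by
  have hL := F.lip.nonneg
  have hT : 0 ≤ T := by linarith
  have hB : 0 ≤ T ^ ρ := Real.rpow_nonneg hT _
  have hs0 := stepC_nonneg hz hT hL hK
  refine exists_ctrlData_of_rem hz.inner F (A := K' + stepC T ρ Z₀ L K * T ^ ρ) (by positivity)
    (remC_nonneg hz hT hL hK) hσ hσS hST le_rfl (fun s hs hsS => ?_)
    fun s t hs hst ht => h.upReg_rem_extend hz F hK hσ hST hP hs hst ht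
  rcases hs.eq_or_lt with rfl | hs
  · exact hξ.mono (by linarith [mul_nonneg hs0 hB])
  · refine (((hξ.restrict hK' hs.le le_rfl).add (upReg_incr_extend hz F hK hσ hST h hP le_rfl hs
      hsS).osc).congr fun p _ _ => by abel).mono ?_
    exact add_le_add_right (mul_le_mul_of_nonneg_left (Real.rpow_le_rpow (by linarith)
      (by linarith) hz.inner.exp_pos.le) hs0) _

theorem IsPrimitive.congr {G G' : ℝ → ℝ → E →L[ℝ] V} {φ φ' : ℝ → ℝ → ℝ → E →L[ℝ] E →L[ℝ] V}
    (h : IsPrimitive z z2 σ S U G φ Y)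
    (hG : ∀ u q, σ ≤ u → u ≤ q → q ≤ S → G u q = G' u q)
    (hφ : ∀ u q r, σ ≤ u → u ≤ r → r ≤ q → q ≤ S → φ u q r = φ' u q r)
    (hY : ∀ s p, σ ≤ s → s ≤ S → s ≤ p → p ≤ U → Y s p = Y' s p) :
    IsPrimitive z z2 σ S U G' φ' Y' := fun s t p hs hst ht hp hpU => by
  rw [← hY t p (by linarith) ht hp hpU, ← hY s p hs (by linarith) (by linarith) hpU,
    h s t p hs hst ht hp hpU]
  exact volInt_congr (fun u q hu huq hq => hG u q (by linarith) huq (by linarith))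
    fun u q r hu hur hrq hq => hφ u q r (by linarith) hur hrq (by linarith)

theorem IsPrimitive.glue (hz : RoughDriver z z2 T ρ Z₀) {m N : ℝ} {G : ℝ → ℝ → E →L[ℝ] V}
    {φ : ℝ → ℝ → ℝ → E →L[ℝ] E →L[ℝ] V} (hσ : 0 ≤ σ) (hU : U ≤ T) (hI : IntData z ρ σ S N G φ)
    (h : IsPrimitive z z2 σ m U G φ Y) (h' : IsPrimitive z z2 m S U G φ Y) :
    IsPrimitive z z2 σ S U G φ Y := fun s t p hs hst ht hp hpU => by
  rcases le_or_gt m s with hms | hsm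
  · exact h' s t p hms hst ht hp hpU
  rcases le_or_gt t m with htm | hmt
  · exact h s t p hs hst htm hp hpU
  rw [hz.volInt_concat (by linarith) hsm.le hmt.le hp (by linarith) (hI.restrict hs ht),
    ← h s m p hs hsm le_rfl (by linarith) hpU, ← h' m t p le_rfl hmt ht hp hpU]
  abel

/-- The window length requires oscillation at most 1 of ξ on [σ, S] only; the bound `K'` up to T
enters just the qualitative constant `K''`. -/
theorem exists_solution_window_extend (hz : RoughDriver z z2 T ρ Z₀)
    (F : Expansion L f f' m₁ m₂ n) (hw : ShortWindow T ρ Z₀ L H) (hH : (S - σ) ^ ρ ≤ H)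
    (hσ : 0 ≤ σ) (hσS : σ ≤ S) (hST : S ≤ T) {ξ : ℝ → V} (hξ : UpOsc σ S 1 ξ)
    (hK' : 0 ≤ K') (hξ' : UpOsc σ T K' ξ) :
    ∃ Y : ℝ → ℝ → V, (∀ p, Y σ p = ξ p) ∧
      (∃ K'', 0 ≤ K'' ∧ CtrlData z ρ σ S T K'' Y (fun s p => f (Y s p))) ∧
      IsPrimitive z z2 σ S T (fun u p => f (Y u p)) (compDeriv f' Y (fun u p => f (Y u p))) Y ∧
      ∀ s t, σ ≤ s → s < t → t ≤ S →
        UpReg t T (stepC T ρ Z₀ L (ctrlC ρ Z₀ L) * (t - s) ^ ρ) (fun p => Y t p - Y s p) := by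
  have hT : 0 ≤ T := by linarith
  have hK := ctrlC_nonneg hz.inner F.lip.nonneg
  obtain ⟨X, hX, hfix⟩ := exists_solution_window hz F hT hw hH hσ hσS le_rfl hST hξ
  -- The fixed point is known for upper variables up to `S`. Applying the solution map once more
  -- defines it up to `T`, without changing it on the window.
  set Y := solMap z z2 f f' σ ξ X (fun s p => f (X s p)) with hY
  have hXY : ∀ s p, σ ≤ s → s ≤ S → s ≤ p → p ≤ S → X s p = Y s p := hfix
  have hYdata : CtrlData z ρ σ S S (ctrlC ρ Z₀ L) Y (fun s p => f (Y s p)) :=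
    hX.congr le_rfl hXY fun s p h1 h2 h3 h4 => by rw [hXY s p h1 h2 h3 h4]
  have hstart : ∀ p, Y σ p = ξ p := fun p => solMap_start ξ _ _ p
  have hP : IsPrimitive z z2 σ S T (fun u p => f (Y u p))
      (compDeriv f' Y (fun u p => f (Y u p))) Y := by
    refine (hz.isPrimitive hσ le_rfl (hX.intData hz.inner F hK hT hσ le_rfl hST) ξ).congr
      (fun u q h1 h2 h3 => ?_) (fun u q r h1 h2 h3 h4 => ?_) (fun _ _ _ _ _ _ => rfl)
    · rw [hXY u q h1 (by linarith) h2 h3]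
    · simp only [compDeriv]
      rw [hXY u q h1 (by linarith) (by linarith) h4, hXY u r h1 (by linarith) h2 (by linarith)]
  exact ⟨Y, hstart, exists_ctrlData_extend hz F hK hσ hσS hST hYdata hP hK'
    (hξ'.congr fun p _ _ => (hstart p).symm), hP, fun s t hs hst ht =>
      upReg_incr_extend hz F hK hσ hST hYdata hP hs hst ht⟩

end Glue

/-! ### Existence and uniqueness for regular drivers -/

section Global

variable {E V : Type*} [NormedAddCommGroup E] [NormedSpace ℝ E]
  [NormedAddCommGroup V] [NormedSpace ℝ V] [CompleteSpace V]
  {z : ℝ → ℝ → E} {z2 : ℝ → ℝ → ℝ → TensorSq E} {T ρ Z₀ σ S U K K' d H L : ℝ}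
  {f : V → E →L[ℝ] V} {f' : V → V →L[ℝ] E →L[ℝ] V} {m₁ : V × V → V →L[ℝ] E →L[ℝ] V}
  {m₂ n : V × V → V →L[ℝ] V →L[ℝ] E →L[ℝ] V}

/-- An increment over a cell ending ih before kh is singular there, so for p < q in [kh, (k+1)h] its
oscillation involves (q-p)/(q-kh+ih). As q - kh ≤ h, this is at most (q-p)/(q-kh) divided by i+1,
and the cells sum to a harmonic number instead of to k. -/
theorem upOsc_grid {W : Type*} [NormedAddCommGroup W] {y : ℝ → ℝ → W} {D h : ℝ} {k : ℕ}
    (hD : 0 ≤ D) (hh : 0 < h) (hT : (k + 1) * h ≤ T) (y₀ : W) (h0 : ∀ p, y 0 p = y₀)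
    (hinc : ∀ j : ℕ, j < k →
      UpReg ((j + 1) * h) T D (fun p => y ((j + 1) * h) p - y (j * h) p)) :
    UpOsc (k * h) ((k + 1) * h) (D * ∑ i ∈ Finset.range k, ((i + 1 : ℕ) : ℝ)⁻¹) (y (k * h)) := by
  intro p q hp hpq hq
  have hsum : ∀ r, y (k * h) r = y₀ + ∑ j ∈ Finset.range k,
      (y ((j + 1) * h) r - y (j * h) r) := by
    intro r
    have := Finset.sum_range_sub (fun j : ℕ => y (j * h) r) k
    push_cast at this
    rw [this, zero_mul, h0]
    abel
  -- Here `k - 1 - j` counts the cells between the end of cell `j` and the current window.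
  have hterm : ∀ j ∈ Finset.range k,
      ‖(y ((j + 1) * h) q - y (j * h) q) - (y ((j + 1) * h) p - y (j * h) p)‖ ≤
        D * (((k - 1 - j + 1 : ℕ) : ℝ)⁻¹ * ((q - p) / (q - k * h))) := by
    intro j hj
    rw [Finset.mem_range] at hj
    obtain ⟨i, rfl⟩ : ∃ i, k = j + 1 + i := Nat.exists_eq_add_of_le hj
    have e : j + 1 + i - 1 - j + 1 = i + 1 := by omega
    rw [e]
    push_cast at hp hT hq ⊢
    have hi : (0 : ℝ) ≤ i := i.cast_nonneg
    have hih : 0 ≤ i * h := by positivity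
    refine ((hinc j hj).osc p q (by linarith) hpq (by linarith)).trans
      (mul_le_mul_of_nonneg_left ?_ hD)
    rw [← one_div, div_mul_div_comm, one_mul]
    refine div_le_div_of_nonneg_left (by linarith) (mul_pos (by linarith) (by linarith)) ?_
    nlinarith [mul_nonneg hi (show 0 ≤ (j + 1 + i + 1) * h - q by linarith)]
  rw [hsum, hsum, add_sub_add_left_eq_sub, ← Finset.sum_sub_distrib]
  refine (norm_sum_le_of_le _ hterm).trans (le_of_eq ?_)
  rw [← Finset.mul_sum, ← Finset.sum_mul,
    Finset.sum_range_reflect (fun i => ((i + 1 : ℕ) : ℝ)⁻¹) k, mul_assoc]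

theorem sum_inv_le_one_add_log {k N : ℕ} (h : k ≤ N) :
    ∑ i ∈ Finset.range k, ((i + 1 : ℕ) : ℝ)⁻¹ ≤ 1 + Real.log N := by
  refine (Finset.sum_le_sum_of_subset_of_nonneg (Finset.range_mono h)
    fun _ _ _ => by positivity).trans ?_
  refine le_trans (le_of_eq ?_) (harmonic_le_one_add_log N)
  simp [harmonic]

theorem tendsto_rpow_div_nat (hρ : 0 < ρ) :
    Tendsto (fun N : ℕ => (T / N) ^ ρ) atTop (𝓝 0) := by
  have := ((tendsto_const_div_atTop_nhds_zero_nat T).rpow_const (p := ρ) (Or.inr hρ.le))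
  rwa [Real.zero_rpow hρ.ne'] at this

theorem tendsto_rpow_div_nat_mul_log (hT : 0 ≤ T) (hρ : 0 < ρ) :
    Tendsto (fun N : ℕ => (T / N) ^ ρ * (1 + Real.log N)) atTop (𝓝 0) := by
  have h1 := ((isLittleO_log_rpow_atTop hρ).tendsto_div_nhds_zero.comp
    tendsto_natCast_atTop_atTop).const_mul (T ^ ρ)
  have h2 := (tendsto_rpow_div_nat (T := T) hρ).add h1
  rw [mul_zero, add_zero] at h2
  refine h2.congr fun N => ?_
  simp only [Function.comp]
  rw [Real.div_rpow hT N.cast_nonneg]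
  ring

theorem eventually_shortWindow (hT : 0 ≤ T) (hρ : 0 < ρ) :
    ∀ᶠ N : ℕ in atTop, ShortWindow T ρ Z₀ L ((T / N) ^ ρ) := by
  have h := tendsto_rpow_div_nat (T := T) hρ
  have key : ∀ c e : ℝ, 0 < e → ∀ᶠ N : ℕ in atTop, c * (T / N) ^ ρ ≤ e := by
    intro c e he
    have := h.const_mul c
    rw [mul_zero] at this
    exact this.eventually_le_const he
  filter_upwards [key 1 1 one_pos, key (ctrlC ρ Z₀ L) 1 one_pos, key (winC ρ Z₀ L) 1 one_pos,
    key (roughC ρ ρ Z₀ * (dataC T ρ Z₀ L (ctrlC ρ Z₀ L) * Z₀)) 1 one_pos,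
    key (gapC T ρ Z₀ L (ctrlC ρ Z₀ L)) (1 / 2) (by norm_num)] with N h1 h2 h3 h4 h5
  exact ⟨Real.rpow_nonneg (by positivity) _, by simpa using h1, h2, h3, h4, h5⟩

/-- `y` solves the equation on `[0, S]`, for all upper variables up to `T`. -/
structure IsRegularSolution (z : ℝ → ℝ → E) (z2 : ℝ → ℝ → ℝ → TensorSq E) (T ρ : ℝ)
    (f : V → E →L[ℝ] V) (f' : V → V →L[ℝ] E →L[ℝ] V) (y₀ : V) (S : ℝ) (y : ℝ → ℝ → V) :
    Prop where
  start : ∀ p, 0 ≤ p → p ≤ T → y 0 p = y₀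
  data : ∃ K, 0 ≤ K ∧ CtrlData z ρ 0 S T K y (fun u p => f (y u p))
  primitive : IsPrimitive z z2 0 S T (fun u p => f (y u p))
    (compDeriv f' y (fun u p => f (y u p))) y

/-- The last conclusion bounds the new increment by a constant independent of `y`, as the harmonic
estimate for the following windows demands; the constants in `CtrlData` may grow from window to
window. -/
theorem IsRegularSolution.extend (hz : RoughDriver z z2 T ρ Z₀) (F : Expansion L f f' m₁ m₂ n)
    (hw : ShortWindow T ρ Z₀ L H) {y₀ : V} {y : ℝ → ℝ → V}
    (hy : IsRegularSolution z z2 T ρ f f' y₀ σ y) (hH : (S - σ) ^ ρ ≤ H)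
    (hσ : 0 ≤ σ) (hσS : σ < S) (hST : S ≤ T) (hosc : UpOsc σ S 1 (y σ)) :
    ∃ y' : ℝ → ℝ → V, IsRegularSolution z z2 T ρ f f' y₀ S y' ∧
      (∀ s p, s ≤ σ → y' s p = y s p) ∧
      UpReg S T (stepC T ρ Z₀ L (ctrlC ρ Z₀ L) * (S - σ) ^ ρ) (fun p => y' S p - y' σ p) := by
  have hT : 0 ≤ T := by linarith
  obtain ⟨K, hK, hdata⟩ := hy.data
  obtain ⟨Y, hstart, ⟨K', hK', hYdata⟩, hP, hinc⟩ := exists_solution_window_extend hz F hw hH hσ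
    hσS.le hST hosc hK (hdata.osc σ hσ le_rfl)
  set y' : ℝ → ℝ → V := fun t p => if t ≤ σ then y t p else Y t p with hy'
  have hl : ∀ s p, s ≤ σ → y' s p = y s p := fun s p hs => if_pos hs
  have hr : ∀ s p, σ ≤ s → y' s p = Y s p := by
    intro s p hs
    rcases hs.eq_or_lt with rfl | hs
    · rw [hl _ _ le_rfl, hstart]
    · exact if_neg (not_le.2 hs)
  have hKM := le_max_left K K'
  have hKM' := le_max_right K K'
  have d1 : CtrlData z ρ 0 σ T (max K K') y' (fun u p => f (y' u p)) :=
    (hdata.mono hKM).congr (hσS.le.trans hST) (fun s p _ hs _ _ => (hl s p hs).symm)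
      fun s p _ hs _ _ => by rw [hl s p hs]
  have d2 : CtrlData z ρ σ S T (max K K') y' (fun u p => f (y' u p)) :=
    (hYdata.mono hKM').congr hST (fun s p hs _ _ _ => (hr s p hs).symm)
      fun s p hs _ _ _ => by rw [hr s p hs]
  have hC := convC_pos hz.inner.exp_pos
  have hZ := hz.inner.nonneg
  have hM : 0 ≤ max K K' := hK.trans hKM
  have d3 := d1.glue hz.inner hM le_rfl hST le_rfl d2
  have hM' : 0 ≤ (2 + 2 * convC ρ * Z₀) * max K K' := by positivity
  have p1 : IsPrimitive z z2 0 σ T (fun u p => f (y' u p))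
      (compDeriv f' y' (fun u p => f (y' u p))) y' :=
    hy.primitive.congr (fun u q h1 h2 h3 => by rw [hl u q (by linarith)])
      (fun u q r h1 h2 h3 h4 => by
        simp only [compDeriv]; rw [hl u q (by linarith), hl u r (by linarith)])
      fun s p _ hs _ _ => (hl s p hs).symm
  have p2 : IsPrimitive z z2 σ S T (fun u p => f (y' u p))
      (compDeriv f' y' (fun u p => f (y' u p))) y' :=
    hP.congr (fun u q h1 h2 h3 => by rw [hr u q h1])
      (fun u q r h1 h2 h3 h4 => by
        simp only [compDeriv]; rw [hr u q h1, hr u r h1])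
      fun s p hs _ _ _ => (hr s p hs).symm
  refine ⟨y', ⟨fun p hp hpT => by rw [hl 0 p hσ, hy.start p hp hpT], ⟨_, hM', d3⟩,
    p1.glue hz le_rfl le_rfl (d3.intData hz.inner F hM' hT le_rfl hST le_rfl) p2⟩, hl, ?_⟩
  exact (hinc σ S le_rfl hσS le_rfl).congr fun p _ _ => by rw [hr S p hσS.le, hr σ p le_rfl]

/-- A single N makes every window short and D h^ρ (1 + log N) ≤ 1. By `upOsc_grid` the starting
value of each window then oscillates by at most 1, so the step never has to shrink. -/
theorem exists_isRegularSolution (hz : RoughDriver z z2 T ρ Z₀) (F : Expansion L f f' m₁ m₂ n)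
    (hT : 0 < T) (y₀ : V) : ∃ y, IsRegularSolution z z2 T ρ f f' y₀ T y := by
  have hρ := hz.inner.exp_pos
  have hL := F.lip.nonneg
  set D := stepC T ρ Z₀ L (ctrlC ρ Z₀ L) with hDdef
  have hD : 0 ≤ D := stepC_nonneg hz hT.le hL (ctrlC_nonneg hz.inner hL)
  have hlog : ∀ᶠ N : ℕ in atTop, D * ((T / N) ^ ρ * (1 + Real.log N)) ≤ 1 := by
    have := (tendsto_rpow_div_nat_mul_log hT.le hρ).const_mul D
    rw [mul_zero] at this
    exact this.eventually_le_const one_pos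
  obtain ⟨N, hw, hN, hN0⟩ := ((eventually_shortWindow (Z₀ := Z₀) (L := L) hT.le hρ).and
    (hlog.and (eventually_gt_atTop 0))).exists
  have hN0' : (0 : ℝ) < N := by exact_mod_cast hN0
  set h := T / N with hh
  have hh0 : 0 < h := by positivity
  have hNh : N * h = T := by rw [hh]; field_simp
  have main : ∀ k : ℕ, k ≤ N → ∃ y, IsRegularSolution z z2 T ρ f f' y₀ (k * h) y ∧
      (∀ p, y 0 p = y₀) ∧ ∀ j : ℕ, j < k →
        UpReg ((j + 1) * h) T (D * h ^ ρ) (fun p => y ((j + 1) * h) p - y (j * h) p) := by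
    intro k
    induction k with
    | zero =>
      intro _
      refine ⟨fun _ _ => y₀, ⟨fun _ _ _ => rfl, ⟨L, hL, ?_⟩, ?_⟩, fun _ => rfl,
        fun j hj => absurd hj (Nat.not_lt_zero j)⟩
      · rw [Nat.cast_zero, zero_mul]
        refine ⟨fun s _ _ p q hp hpq _ => ?_, fun s _ _ => (UpReg.const (f y₀)).mono
          (F.lip.bound y₀), fun s t hs hst ht => absurd hst (by linarith),
          fun s t hs hst ht => absurd hst (by linarith)⟩
        simpa using mul_nonneg hL (ratio_nonneg hp hpq)
      · intro s t p hs hst ht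
        rw [Nat.cast_zero, zero_mul] at ht
        linarith
    | succ k ih =>
      intro hk
      obtain ⟨y, hy, hy0, hinc⟩ := ih (by omega)
      have hkN : ((k : ℝ) + 1) * h ≤ T := by
        rw [← hNh]
        exact mul_le_mul_of_nonneg_right (by exact_mod_cast hk) hh0.le
      have hkh : 0 ≤ k * h := by positivity
      have e : ((k : ℝ) + 1) * h - k * h = h := by ring
      have hDh : 0 ≤ D * h ^ ρ := mul_nonneg hD (Real.rpow_nonneg hh0.le _)
      have hosc : UpOsc (k * h) ((k + 1) * h) 1 (y (k * h)) := by
        refine (upOsc_grid hDh hh0 hkN y₀ hy0 hinc).mono ?_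
        calc _ ≤ D * h ^ ρ * (1 + Real.log N) := mul_le_mul_of_nonneg_left
              (sum_inv_le_one_add_log (by omega)) hDh
          _ = _ := by ring
          _ ≤ 1 := hN
      obtain ⟨y', hy', hl, hstep⟩ := hy.extend hz F hw (S := (k + 1) * h) (by rw [e]) hkh
        (by linarith) hkN hosc
      rw [e] at hstep
      refine ⟨y', by push_cast; exact hy', fun p => by rw [hl 0 p hkh, hy0], fun j hj => ?_⟩
      rcases (Nat.lt_succ_iff.1 hj).eq_or_lt with rfl | hj
      · exact hstep
      · have hjk : ((j : ℝ) + 1) * h ≤ k * h :=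
          mul_le_mul_of_nonneg_right (by exact_mod_cast hj) hh0.le
        exact (hinc j hj).congr fun p _ _ => by
          rw [hl _ p hjk, hl _ p (by linarith)]
  obtain ⟨y, hy, -⟩ := main N le_rfl
  exact ⟨y, hNh ▸ hy⟩

/-- Both paths are fixed points of the solution map, so a gap between them implies half that gap;
iterating, it is zero. -/
theorem eq_on_window (hz : RoughDriver z z2 T ρ Z₀) (F : Expansion L f f' m₁ m₂ n)
    (hK : 0 ≤ K) (hH : (S - σ) ^ ρ ≤ H) (hH0 : 0 ≤ H) (hH1 : H ≤ 1)
    (hgapC : gapC T ρ Z₀ L K * H ≤ 1 / 2) (hσ : 0 ≤ σ) (hST : S ≤ T) {y y' : ℝ → ℝ → V}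
    (h : CtrlData z ρ σ S T K y (fun u p => f (y u p)))
    (h' : CtrlData z ρ σ S T K y' (fun u p => f (y' u p)))
    (hp : IsPrimitive z z2 σ S T (fun u p => f (y u p)) (compDeriv f' y (fun u p => f (y u p))) y)
    (hp' : IsPrimitive z z2 σ S T (fun u p => f (y' u p))
      (compDeriv f' y' (fun u p => f (y' u p))) y')
    (h0 : ∀ p, σ ≤ p → p ≤ T → y σ p = y' σ p) {t p : ℝ} (ht : σ ≤ t) (htS : t ≤ S)
    (htp : t ≤ p) (hpT : p ≤ T) : y t p = y' t p := by
  have hT : 0 ≤ T := by linarith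
  have hgap : ∀ k : ℕ, CtrlGap z ρ σ S T (2 * K / 2 ^ k) y y' (fun u p => f (y u p))
      (fun u p => f (y' u p)) := by
    intro k
    induction k with
    | zero =>
      exact (h.gap h' h0 fun p hp hpT => by rw [h0 p hp hpT]).mono (by rw [pow_zero, div_one])
    | succ k ih =>
      have hd : 0 ≤ 2 * K / 2 ^ k := by positivity
      refine (ih.image hz F hK hT hd hH hH0 hH1 hσ hST le_rfl h h' hp hp' h0).mono ?_
      calc _ ≤ 1 / 2 * (2 * K / 2 ^ k) := mul_le_mul_of_nonneg_right hgapC hd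
        _ = _ := by rw [pow_succ]; field_simp
  have hlim : Tendsto (fun k : ℕ => (2 * convC ρ * Z₀ + 1) * (2 * K / 2 ^ k * H)) atTop
      (𝓝 0) := by
    have := (tendsto_const_nhds (x := 2 * K)).div_atTop
      (tendsto_pow_atTop_atTop_of_one_lt (one_lt_two (α := ℝ)))
    simpa using (this.mul_const H).const_mul (2 * convC ρ * Z₀ + 1)
  refine sub_eq_zero.1 (norm_le_zero_iff.1 (ge_of_tendsto' hlim fun k => ?_))
  exact ((hgap k).upReg_val hz.inner (by positivity) hH hH0 hH1 h.reg h'.reg hσ hST le_rfl ht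
    htS).bound p htp hpT

/-- The two given solutions have a common bound `K` on all of [0, T], so the window length may
depend on it and no harmonic sum is needed. -/
theorem IsRegularSolution.unique (hz : RoughDriver z z2 T ρ Z₀) (F : Expansion L f f' m₁ m₂ n)
    (hT : 0 < T) {y₀ : V} {y y' : ℝ → ℝ → V} (hy : IsRegularSolution z z2 T ρ f f' y₀ T y)
    (hy' : IsRegularSolution z z2 T ρ f f' y₀ T y') {t p : ℝ} (ht : 0 ≤ t) (htp : t ≤ p)
    (hpT : p ≤ T) : y t p = y' t p := by
  have hρ := hz.inner.exp_pos
  obtain ⟨K₁, hK₁, h₁⟩ := hy.data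
  obtain ⟨K₂, hK₂, h₂⟩ := hy'.data
  set K := max K₁ K₂
  have hK : 0 ≤ K := hK₁.trans (le_max_left _ _)
  have hlim := tendsto_rpow_div_nat (T := T) hρ
  have e1 : ∀ᶠ N : ℕ in atTop, gapC T ρ Z₀ L K * (T / N) ^ ρ ≤ 1 / 2 := by
    have := hlim.const_mul (gapC T ρ Z₀ L K)
    rw [mul_zero] at this
    exact this.eventually_le_const (by norm_num)
  obtain ⟨N, hN1, hN2, hN0⟩ := ((hlim.eventually_le_const one_pos).and
    (e1.and (eventually_gt_atTop 0))).exists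
  have hN0' : (0 : ℝ) < N := by exact_mod_cast hN0
  set h := T / N with hh
  have hh0 : 0 < h := by positivity
  have hNh : N * h = T := by rw [hh]; field_simp
  have main : ∀ k : ℕ, k ≤ N → ∀ t p, 0 ≤ t → t ≤ k * h → t ≤ p → p ≤ T → y t p = y' t p := by
    intro k
    induction k with
    | zero =>
      intro _ t p ht htk htp hpT
      rw [Nat.cast_zero, zero_mul] at htk
      obtain rfl : t = 0 := le_antisymm htk ht
      rw [hy.start p htp hpT, hy'.start p htp hpT]
    | succ k ih =>
      intro hk t p ht htk htp hpT
      rcases le_total t (k * h) with hle | hle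
      · exact ih (by omega) t p ht hle htp hpT
      have hkN : ((k : ℝ) + 1) * h ≤ T := by
        rw [← hNh]
        exact mul_le_mul_of_nonneg_right (by exact_mod_cast hk) hh0.le
      have hkh : 0 ≤ k * h := by positivity
      push_cast at htk
      refine eq_on_window hz F hK (σ := k * h) (S := (k + 1) * h) (H := h ^ ρ)
        (by rw [show ((k : ℝ) + 1) * h - k * h = h by ring])
        (Real.rpow_nonneg hh0.le _) hN1 hN2 hkh hkN
        ((h₁.mono (le_max_left _ _)).restrict hK hkh hkN le_rfl)
        ((h₂.mono (le_max_right _ _)).restrict hK hkh hkN le_rfl)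
        (fun s t p hs hst ht => hy.primitive s t p (hkh.trans hs) hst (ht.trans hkN))
        (fun s t p hs hst ht => hy'.primitive s t p (hkh.trans hs) hst (ht.trans hkN))
        (fun p hp hpT => ih (by omega) _ p hkh le_rfl hp hpT) hle htk htp hpT
  exact main N le_rfl t p ht (by rw [hNh]; linarith) htp hpT

end Global

/-! ### Volterra weights -/

section Weight

variable {W : Type*} [NormedAddCommGroup W] {T a c s t τ τ' : ℝ}

theorem volterraWeight_nonneg (hst : s < t) (htτ : t ≤ τ) : 0 ≤ volterraWeight a c s t τ := by
  have h1 : 0 ≤ (τ - s) ^ (a - c) := Real.rpow_nonneg (by linarith) _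
  unfold volterraWeight
  split_ifs
  · exact le_min (mul_nonneg (Real.rpow_nonneg (by linarith) _)
      (Real.rpow_nonneg (by linarith) _)) h1
  · exact h1

theorem volterraWeight_le_far (htτ : t < τ) :
    volterraWeight a c s t τ ≤ (τ - t) ^ (-c) * (t - s) ^ a := by
  rw [volterraWeight, if_pos htτ]
  exact min_le_left _ _

/-- If t - s ≤ τ - t, the singular factor is at most (t-s)^(-c); otherwise τ - s ≤ 2(t - s), and the
second term of the minimum is used. -/
theorem volterraWeight_le_near (hc : 0 ≤ c) (hac : c ≤ a) (hst : s < t) (htτ : t ≤ τ) :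
    volterraWeight a c s t τ ≤ 2 ^ (a - c) * (t - s) ^ (a - c) := by
  have h0 : 0 ≤ a - c := by linarith
  have h1 : (1 : ℝ) ≤ 2 ^ (a - c) := Real.one_le_rpow one_le_two h0
  have hx : 0 ≤ (t - s) ^ (a - c) := Real.rpow_nonneg (by linarith) _
  rcases htτ.eq_or_lt with rfl | htτ
  · rw [volterraWeight, if_neg (lt_irrefl _)]
    exact le_mul_of_one_le_left hx h1
  rcases le_total (t - s) (τ - t) with h | h
  · refine (volterraWeight_le_far htτ).trans (le_trans ?_ (le_mul_of_one_le_left hx h1))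
    calc _ ≤ (t - s) ^ (-c) * (t - s) ^ a := mul_le_mul_of_nonneg_right
          (Real.rpow_le_rpow_of_nonpos (by linarith) h (by linarith))
          (Real.rpow_nonneg (by linarith) _)
      _ = _ := by rw [← Real.rpow_add (by linarith)]; congr 1; ring
  · rw [volterraWeight, if_pos htτ, ← Real.mul_rpow zero_le_two (by linarith)]
    exact (min_le_right _ _).trans (Real.rpow_le_rpow (by linarith) (by linarith) h0)

/-- The converse passage: an estimate of order a - c up to the diagonal and one of order a away from
it recover the full weight, since t - s ≤ τ - s. -/
theorem le_mul_volterraWeight {X B B' : ℝ} (hB : 0 ≤ B) (hac : c ≤ a) (hst : s < t)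
    (htτ : t ≤ τ) (hnear : X ≤ B * (t - s) ^ (a - c))
    (hfar : t < τ → X ≤ B' * ((τ - t) ^ (-c) * (t - s) ^ a)) :
    X ≤ max B B' * volterraWeight a c s t τ := by
  have h0 : 0 ≤ max B B' := hB.trans (le_max_left _ _)
  have h1 : X ≤ max B B' * (τ - s) ^ (a - c) :=
    hnear.trans (mul_le_mul (le_max_left _ _) (Real.rpow_le_rpow (by linarith) (by linarith)
      (by linarith)) (Real.rpow_nonneg (by linarith) _) h0)
  unfold volterraWeight
  split_ifs with h
  · rw [mul_min_of_nonneg _ _ h0]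
    exact le_min ((hfar h).trans (mul_le_mul_of_nonneg_right (le_max_right _ _)
      (mul_nonneg (Real.rpow_nonneg (by linarith) _) (Real.rpow_nonneg (by linarith) _)))) h1
  · exact h1

/-- This is min(1, x/y) ≤ 2x/(x + y) with x = q - p and y = p - t. -/
theorem min_one_ratio_le {M X p q : ℝ} (hM : 0 ≤ M) (htp : t < p) (hpq : p < q) (h0 : X ≤ M)
    (h1 : X ≤ M * ((q - p) / (p - t))) : X ≤ 2 * M * ((q - p) / (q - t)) := by
  rcases le_total (q - p) (p - t) with h | h
  · refine h1.trans ?_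
    rw [mul_comm 2 M, mul_assoc]
    refine mul_le_mul_of_nonneg_left ?_ hM
    rw [← mul_div_assoc, div_le_div_iff₀ (by linarith) (by linarith)]
    nlinarith
  · refine h0.trans ?_
    rw [mul_comm 2 M, mul_assoc]
    refine le_mul_of_one_le_right hM ?_
    rw [← mul_div_assoc, le_div_iff₀ (by linarith)]
    linarith

/-- Only η = 0 and η = 1 are used: their minimum is comparable with the ratio. At p = t the
increment bound is not available, but the ratio is 1 and the triangle inequality suffices. -/
theorem MemV.upReg {g : ℝ → ℝ → ℝ → W} (hg : MemV T a c g) (hc : 0 ≤ c) (hac : c ≤ a) :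
    ∃ C, 0 ≤ C ∧ ∀ s t, 0 ≤ s → s < t → t ≤ T → UpReg t T (C * (t - s) ^ (a - c)) (g s t) := by
  obtain ⟨⟨C₁, h1⟩, C₂, h2⟩ := hg
  set C := max 0 (max C₁ C₂) with hC
  have hC0 : 0 ≤ C := le_max_left _ _
  have hC1 : C₁ ≤ C := (le_max_left _ _).trans (le_max_right _ _)
  have hC2 : C₂ ≤ C := (le_max_right _ _).trans (le_max_right _ _)
  have h20 : (0 : ℝ) ≤ 2 ^ (a - c) := by positivity
  refine ⟨2 * (C * 2 ^ (a - c)), by positivity, fun s t hs hst ht => ?_⟩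
  have hx : 0 ≤ (t - s) ^ (a - c) := Real.rpow_nonneg (by linarith) _
  set M := C * (2 ^ (a - c) * (t - s) ^ (a - c)) with hM
  have hM0 : 0 ≤ M := by positivity
  have e : 2 * (C * 2 ^ (a - c)) * (t - s) ^ (a - c) = 2 * M := by rw [hM]; ring
  rw [e]
  have hw : ∀ p, t ≤ p → C * volterraWeight a c s t p ≤ M := fun p hp =>
    mul_le_mul_of_nonneg_left (volterraWeight_le_near hc hac hst hp) hC0
  have hb : ∀ p, t ≤ p → p ≤ T → ‖g s t p‖ ≤ M := fun p hp hpT =>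
    ((h1 s t p hs hst hp hpT).trans (mul_le_mul_of_nonneg_right hC1
      (volterraWeight_nonneg hst hp))).trans (hw p hp)
  refine ⟨fun p hp hpT => (hb p hp hpT).trans (by linarith), fun p q hp hpq hq => ?_⟩
  rcases hp.eq_or_lt with rfl | hp
  · rw [div_self (by linarith), mul_one, two_mul]
    exact norm_sub_le_of_le (hb q (by linarith) hq) (hb t le_rfl ht)
  · have h3 : ∀ η ∈ Icc (0 : ℝ) 1, ‖g s t q - g s t p‖ ≤ M * ((q - p) ^ η * (p - t) ^ (-η)) := by
      intro η hη
      have hn : 0 ≤ (q - p) ^ η * (p - t) ^ (-η) :=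
        mul_nonneg (Real.rpow_nonneg (by linarith) _) (Real.rpow_nonneg (by linarith) _)
      calc _ ≤ _ := h2 s t p q hs hst hp hpq hq η hη
        _ ≤ C * ((q - p) ^ η * (p - t) ^ (-η) * volterraWeight a c s t p) :=
          mul_le_mul_of_nonneg_right hC2 (mul_nonneg hn (volterraWeight_nonneg hst hp.le))
        _ = C * volterraWeight a c s t p * ((q - p) ^ η * (p - t) ^ (-η)) := by ring
        _ ≤ _ := mul_le_mul_of_nonneg_right (hw p hp.le) hn
    refine min_one_ratio_le hM0 hp hpq ?_ ?_
    · simpa using h3 0 (by simp)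
    · have := h3 1 (by simp)
      rwa [Real.rpow_one, Real.rpow_neg_one, ← div_eq_mul_inv] at this

end Weight

/-! ### Volterra rough paths as drivers -/

section Driver

variable {E : Type*} [NormedAddCommGroup E] [NormedSpace ℝ E]
  {z : ℝ → ℝ → E} {z2 : ℝ → ℝ → ℝ → TensorSq E} {T α γ : ℝ}

theorem IsVolterraRoughPath.chen_sub (h : IsVolterraRoughPath T α γ z z2) {a m b p q : ℝ}
    (ha : 0 ≤ a) (ham : a < m) (hmb : m < b) (hbp : b ≤ p) (hp : p ≤ T) (hbq : b ≤ q)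
    (hq : q ≤ T) :
    HasSewing (fun u v => tensorRight (incr z a m u) (z v q - z v p - (z u q - z u p))) m b
      (z2 a b q - z2 a b p - (z2 m b q - z2 m b p) - (z2 a m q - z2 a m p)) := by
  have h1 := HasSewing.sub (h.chen a m b q ha ham hmb hbq hq) (h.chen a m b p ha ham hmb hbp hp)
  have e : z2 a b q - z2 a b p - (z2 m b q - z2 m b p) - (z2 a m q - z2 a m p) =
      z2 a b q - z2 m b q - z2 a m q - (z2 a b p - z2 m b p - z2 a m p) := by abel
  rw [e]
  refine h1.congr fun u v _ _ _ => ?_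
  rw [← map_sub]
  congr 1
  simp only [incr]
  abel

/-- Near the diagonal the two levels have orders ρ and (2ρ + γ) - γ = 2ρ, and ρ > 1/3 is the
condition 3ρ > 1. -/
theorem IsVolterraRoughPath.exists_roughDriver (h : IsVolterraRoughPath T α γ z z2)
    (hγ : 0 ≤ γ) (hρ : 1 / 3 < α - γ) : ∃ Z₀, RoughDriver z z2 T (α - γ) Z₀ := by
  obtain ⟨C₁, hC₁, h1⟩ := h.first.upReg hγ (by linarith)
  obtain ⟨C₂, hC₂, h2⟩ := h.second.upReg hγ (by linarith)
  set Z := max C₁ C₂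
  have hZ : 0 ≤ Z := hC₁.trans (le_max_left _ _)
  have h1' : ∀ a b, 0 ≤ a → a < b → b ≤ T → UpReg b T (Z * (b - a) ^ (α - γ)) (incr z a b) :=
    fun a b ha hab hb => (h1 a b ha hab hb).mono
      (mul_le_mul_of_nonneg_right (le_max_left _ _) (Real.rpow_nonneg (by linarith) _))
  have h2' : ∀ a b, 0 ≤ a → a < b → b ≤ T →
      UpReg b T (Z * (b - a) ^ (α - γ + (α - γ))) (z2 a b) := by
    intro a b ha hab hb
    have := (h2 a b ha hab hb).mono
      (mul_le_mul_of_nonneg_right (le_max_right C₁ C₂) (Real.rpow_nonneg (by linarith) _))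
    rwa [show 2 * (α - γ) + γ - γ = α - γ + (α - γ) by ring] at this
  have hin : InnerDriver z T (α - γ) Z := ⟨by linarith, hZ, h1'⟩
  refine ⟨Z, hin, by linarith, fun s t p hs htp hp => ⟨hin.holder hs htp hp, ?_, ?_⟩,
    fun s t p q hs htp hpq hq => ⟨hin.holder_sub hs htp hpq hq, ?_, ?_⟩⟩
  · exact fun a b ha hab hb => (h2' a b (by linarith) hab (by linarith)).bound p (by linarith) hp
  · exact fun a m b ha ham hmb hb => h.chen a m b p (by linarith) ham hmb (by linarith) hp
  · intro a b ha hab hb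
    refine ((h2' a b (by linarith) hab (by linarith)).osc p q (by linarith) hpq hq).trans ?_
    have hx : 0 ≤ (b - a) ^ (α - γ + (α - γ)) := Real.rpow_nonneg (by linarith) _
    calc _ ≤ Z * (b - a) ^ (α - γ + (α - γ)) * ((q - p) / (q - t)) :=
          mul_le_mul_of_nonneg_left (ratio_mono_start hb htp hpq) (mul_nonneg hZ hx)
      _ = _ := by ring
  · exact fun a m b ha ham hmb hb => h.chen_sub (by linarith) ham hmb (by linarith)
      (by linarith) (by linarith) hq

/-- A driver which satisfies, up to the factor `κ`, the Volterra bounds with upper variable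
`τ`. -/
structure WeightedDriver (z : ℝ → ℝ → E) (α γ C s t τ κ : ℝ) (ζ : ℝ → E)
    (ζ₂ : ℝ → ℝ → TensorSq E) : Prop where
  near : OuterDriver z (α - γ) s t (α - γ) (C * κ) ζ ζ₂
  far : t < τ → OuterDriver z (α - γ) s t α (C * κ * (τ - t) ^ (-γ)) ζ ζ₂

/-- On a subinterval ending at b ≤ t the singular factor (τ-b)^(-γ) is at most (τ-t)^(-γ), so away
from the diagonal the driver has the full orders α and α + ρ. The factor 2^(2ρ) covers the constants
1, 2^ρ and 2^(2ρ) of all cases. -/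
theorem weightedDriver_of_le {C s t τ κ : ℝ} {ζ : ℝ → E} {ζ₂ : ℝ → ℝ → TensorSq E}
    (hγ : 0 ≤ γ) (hρ : 0 < α - γ) (hC : 0 ≤ C) (hκ : 0 ≤ κ) (htτ : t ≤ τ)
    (h1 : ∀ a b, s ≤ a → a < b → b ≤ t → ‖ζ b - ζ a‖ ≤ C * κ * volterraWeight α γ a b τ)
    (h2 : ∀ a b, s ≤ a → a < b → b ≤ t →
      ‖ζ₂ a b‖ ≤ C * κ * volterraWeight (2 * (α - γ) + γ) γ a b τ)
    (hchen : ∀ a m b, s ≤ a → a < m → m < b → b ≤ t →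
      HasSewing (fun u v => tensorRight (incr z a m u) (ζ v - ζ u)) m b
        (ζ₂ a b - ζ₂ m b - ζ₂ a m)) :
    WeightedDriver z α γ (2 ^ (2 * (α - γ)) * C) s t τ κ ζ ζ₂ := by
  have hCκ : 0 ≤ C * κ := mul_nonneg hC hκ
  have two1 : (1 : ℝ) ≤ 2 ^ (2 * (α - γ)) := Real.one_le_rpow one_le_two (by linarith)
  have two2 : (2 : ℝ) ^ (α - γ) ≤ 2 ^ (2 * (α - γ)) :=
    Real.rpow_le_rpow_of_exponent_le one_le_two (by linarith)
  have two0 : (0 : ℝ) ≤ 2 ^ (2 * (α - γ)) := by positivity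
  refine ⟨⟨⟨by positivity, fun a b ha hab hb => ?_⟩, fun a b ha hab hb => ?_, hchen⟩,
    fun hlt => ⟨⟨?_, fun a b ha hab hb => ?_⟩, fun a b ha hab hb => ?_, hchen⟩⟩
  · have hx : 0 ≤ (b - a) ^ (α - γ) := Real.rpow_nonneg (by linarith) _
    calc _ ≤ _ := h1 a b ha hab hb
      _ ≤ C * κ * (2 ^ (α - γ) * (b - a) ^ (α - γ)) := mul_le_mul_of_nonneg_left
        (volterraWeight_le_near hγ (by linarith) hab (by linarith)) hCκ
      _ ≤ C * κ * (2 ^ (2 * (α - γ)) * (b - a) ^ (α - γ)) := by gcongr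
      _ = _ := by ring
  · calc _ ≤ _ := h2 a b ha hab hb
      _ ≤ C * κ * (2 ^ (2 * (α - γ) + γ - γ) * (b - a) ^ (2 * (α - γ) + γ - γ)) :=
        mul_le_mul_of_nonneg_left
          (volterraWeight_le_near hγ (by linarith) hab (by linarith)) hCκ
      _ = _ := by
        rw [show 2 * (α - γ) + γ - γ = 2 * (α - γ) by ring,
          show α - γ + (α - γ) = 2 * (α - γ) by ring]
        ring
  · have := Real.rpow_nonneg (show 0 ≤ τ - t by linarith) (-γ)
    positivity
  all_goals
    have hτ : (τ - b) ^ (-γ) ≤ (τ - t) ^ (-γ) :=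
      Real.rpow_le_rpow_of_nonpos (by linarith) (by linarith) (by linarith)
    have hτ0 : 0 ≤ (τ - t) ^ (-γ) := Real.rpow_nonneg (by linarith) _
  · have hx : 0 ≤ (b - a) ^ α := Real.rpow_nonneg (by linarith) _
    calc _ ≤ _ := h1 a b ha hab hb
      _ ≤ C * κ * ((τ - b) ^ (-γ) * (b - a) ^ α) :=
        mul_le_mul_of_nonneg_left (volterraWeight_le_far (by linarith)) hCκ
      _ ≤ 1 * (C * κ * ((τ - t) ^ (-γ) * (b - a) ^ α)) := by rw [one_mul]; gcongr
      _ ≤ 2 ^ (2 * (α - γ)) * (C * κ * ((τ - t) ^ (-γ) * (b - a) ^ α)) := by gcongr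
      _ = _ := by ring
  · have hx : 0 ≤ (b - a) ^ (2 * (α - γ) + γ) := Real.rpow_nonneg (by linarith) _
    calc _ ≤ _ := h2 a b ha hab hb
      _ ≤ C * κ * ((τ - b) ^ (-γ) * (b - a) ^ (2 * (α - γ) + γ)) :=
        mul_le_mul_of_nonneg_left (volterraWeight_le_far (by linarith)) hCκ
      _ ≤ 1 * (C * κ * ((τ - t) ^ (-γ) * (b - a) ^ (2 * (α - γ) + γ))) := by
        rw [one_mul]; gcongr
      _ ≤ 2 ^ (2 * (α - γ)) * (C * κ * ((τ - t) ^ (-γ) * (b - a) ^ (2 * (α - γ) + γ))) := by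
        gcongr
      _ = _ := by rw [show α + (α - γ) = 2 * (α - γ) + γ by ring]; ring

theorem IsVolterraRoughPath.exists_weightedDriver (h : IsVolterraRoughPath T α γ z z2)
    (hγ : 0 ≤ γ) (hρ : 0 < α - γ) : ∃ C, 0 ≤ C ∧
      (∀ s t τ, 0 ≤ s → t ≤ τ → τ ≤ T →
        WeightedDriver z α γ C s t τ 1 (fun r => z r τ) (fun a b => z2 a b τ)) ∧
      ∀ s t τ' τ, 0 ≤ s → t < τ' → τ' < τ → τ ≤ T → ∀ η ∈ Icc (0 : ℝ) 1,
        WeightedDriver z α γ C s t τ' ((τ - τ') ^ η * (τ' - t) ^ (-η))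
          (fun r => z r τ - z r τ') (fun a b => z2 a b τ - z2 a b τ') := by
  obtain ⟨⟨C₁, h1⟩, C₂, h2⟩ := h.first
  obtain ⟨⟨C₃, h3⟩, C₄, h4⟩ := h.second
  set C := max 0 (max (max C₁ C₂) (max C₃ C₄)) with hC
  have hC0 : 0 ≤ C := le_max_left _ _
  have hC1 : C₁ ≤ C := ((le_max_left _ _).trans (le_max_left _ _)).trans (le_max_right _ _)
  have hC2 : C₂ ≤ C := ((le_max_right _ _).trans (le_max_left _ _)).trans (le_max_right _ _)
  have hC3 : C₃ ≤ C := ((le_max_left _ _).trans (le_max_right _ _)).trans (le_max_right _ _)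
  have hC4 : C₄ ≤ C := ((le_max_right _ _).trans (le_max_right _ _)).trans (le_max_right _ _)
  refine ⟨2 ^ (2 * (α - γ)) * C, by positivity, fun s t τ hs htτ hτ => ?_,
    fun s t τ' τ hs htτ' hττ hτ η hη => ?_⟩
  · refine weightedDriver_of_le hγ hρ hC0 zero_le_one htτ (fun a b ha hab hb => ?_)
      (fun a b ha hab hb => ?_) fun a m b ha ham hmb hb =>
        h.chen a m b τ (by linarith) ham hmb (by linarith) hτ
    · rw [mul_one]
      exact (h1 a b τ (by linarith) hab (by linarith) hτ).trans
        (mul_le_mul_of_nonneg_right hC1 (volterraWeight_nonneg hab (by linarith)))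
    · rw [mul_one]
      exact (h3 a b τ (by linarith) hab (by linarith) hτ).trans
        (mul_le_mul_of_nonneg_right hC3 (volterraWeight_nonneg hab (by linarith)))
  · have hκ : 0 ≤ (τ - τ') ^ η * (τ' - t) ^ (-η) :=
      mul_nonneg (Real.rpow_nonneg (by linarith) _) (Real.rpow_nonneg (by linarith) _)
    have key : ∀ {D w b : ℝ}, D ≤ C → 0 ≤ w → b ≤ t →
        D * ((τ - τ') ^ η * (τ' - b) ^ (-η) * w) ≤
          C * ((τ - τ') ^ η * (τ' - t) ^ (-η)) * w := by
      intro D w b hD hw hb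
      have e1 : 0 ≤ (τ - τ') ^ η := Real.rpow_nonneg (by linarith) _
      have e2 : 0 ≤ (τ' - b) ^ (-η) := Real.rpow_nonneg (by linarith) _
      have e3 : (τ' - b) ^ (-η) ≤ (τ' - t) ^ (-η) :=
        Real.rpow_le_rpow_of_nonpos (by linarith) (by linarith) (by linarith [hη.1])
      rw [mul_assoc C]
      gcongr
    refine weightedDriver_of_le hγ hρ hC0 hκ htτ'.le (fun a b ha hab hb => ?_)
      (fun a b ha hab hb => ?_) fun a m b ha ham hmb hb =>
        h.chen_sub (by linarith) ham hmb (by linarith) (by linarith) (by linarith) hτ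
    · have e : z b τ - z b τ' - (z a τ - z a τ') = incr z a b τ - incr z a b τ' := by
        simp only [incr]; abel
      rw [e]
      exact (h2 a b τ' τ (by linarith) hab (by linarith) hττ hτ η hη).trans
        (key hC2 (volterraWeight_nonneg hab (by linarith)) hb)
    · exact (h4 a b τ' τ (by linarith) hab (by linarith) hττ hτ η hη).trans
        (key hC4 (volterraWeight_nonneg hab (by linarith)) hb)

end Driver

/-! ### Volterra bounds for the rough Volterra integral -/

section WeightedBounds

variable {E V : Type*} [NormedAddCommGroup E] [NormedSpace ℝ E]
  [NormedAddCommGroup V] [NormedSpace ℝ V] [CompleteSpace V]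
  {z : ℝ → ℝ → E} {z2 : ℝ → ℝ → ℝ → TensorSq E} {T α γ ρ Z₀ N C s t τ κ β Z : ℝ}
  {G : ℝ → ℝ → E →L[ℝ] V} {φ : ℝ → ℝ → ℝ → E →L[ℝ] E →L[ℝ] V}
  {ζ : ℝ → E} {ζ₂ : ℝ → ℝ → TensorSq E}

/-- The constant in the bound of the second order part of the rough Volterra integral. -/
noncomputable def intRemC (T β ρ Z₀ N : ℝ) : ℝ :=
  N * (roughC β ρ Z₀ * T ^ ρ + conv₂C β ρ Z₀)

/-- The constant in the bound of the rough Volterra integral. -/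
noncomputable def intC (T β ρ Z₀ N : ℝ) : ℝ := convC β * N + intRemC T β ρ Z₀ N * T ^ ρ

theorem intRemC_nonneg (hz : InnerDriver z T ρ Z₀) (hβ : 0 < β) (hβρ : 1 < β + 2 * ρ)
    (hT : 0 ≤ T) (hN : 0 ≤ N) : 0 ≤ intRemC T β ρ Z₀ N := by
  have h1 := roughC_pos hβ hz.exp_pos hβρ hz.nonneg
  have h2 := conv₂C_pos hβ hz.exp_pos hz.nonneg
  unfold intRemC
  positivity

theorem intC_nonneg (hz : InnerDriver z T ρ Z₀) (hβ : 0 < β) (hβρ : 1 < β + 2 * ρ)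
    (hT : 0 ≤ T) (hN : 0 ≤ N) : 0 ≤ intC T β ρ Z₀ N := by
  have h1 := intRemC_nonneg hz hβ hβρ hT hN
  have h2 := convC_pos hβ
  unfold intC
  positivity

/-- The outer order β is kept free: the estimate serves with β = ρ near the diagonal and with β = α
away from it. -/
theorem norm_roughInt_sub_conv_le (hz : InnerDriver z T ρ Z₀) (hβ : 0 < β)
    (hβρ : 1 < β + 2 * ρ) (hs : 0 ≤ s) (hst : s < t) (ht : t ≤ T)
    (hζ : OuterDriver z ρ s t β Z ζ ζ₂) (h : IntData z ρ s t N G φ) :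
    ‖roughInt z ζ ζ₂ G φ s t - conv ζ (G s) s t‖ ≤
      intRemC T β ρ Z₀ N * (Z * (t - s) ^ (β + ρ)) := by
  have hN := h.nonneg hst.le
  have hZ := hζ.holder.nonneg
  have hρ := hz.exp_pos
  have hx : 0 ≤ (t - s) ^ (β + ρ) := Real.rpow_nonneg (by linarith) _
  have hxT : (t - s) ^ ρ ≤ T ^ ρ := Real.rpow_le_rpow (by linarith) (by linarith) hρ.le
  have h1 := (roughInt_spec hz hβ hβρ hs hst.le ht hζ h).2
  have h2 := (conv₂_spec hz hβ hs hst.le ht hζ (h.reg₂ s le_rfl hst.le)).2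
  have hC := roughC_pos hβ hρ hβρ hz.nonneg
  have e : roughInt z ζ ζ₂ G φ s t - conv ζ (G s) s t =
      (roughInt z ζ ζ₂ G φ s t - roughGerm z ζ ζ₂ G φ s t) + conv₂ z ζ ζ₂ (φ s) s t := by
    rw [roughGerm]; abel
  rw [e]
  refine (norm_add_le_of_le h1 h2).trans ?_
  have e2 : (t - s) ^ (β + 2 * ρ) = (t - s) ^ (β + ρ) * (t - s) ^ ρ := by
    rw [← Real.rpow_add (by linarith)]; congr 1; ring
  rw [e2, intRemC]
  calc _ = roughC β ρ Z₀ * (N * Z * (t - s) ^ (β + ρ)) * (t - s) ^ ρ +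
        conv₂C β ρ Z₀ * (N * Z * (t - s) ^ (β + ρ)) := by ring
    _ ≤ roughC β ρ Z₀ * (N * Z * (t - s) ^ (β + ρ)) * T ^ ρ +
        conv₂C β ρ Z₀ * (N * Z * (t - s) ^ (β + ρ)) := by gcongr
    _ = _ := by ring

theorem norm_roughInt_le (hz : InnerDriver z T ρ Z₀) (hβ : 0 < β)
    (hβρ : 1 < β + 2 * ρ) (hs : 0 ≤ s) (hst : s < t) (ht : t ≤ T)
    (hζ : OuterDriver z ρ s t β Z ζ ζ₂) (h : IntData z ρ s t N G φ) :
    ‖roughInt z ζ ζ₂ G φ s t‖ ≤ intC T β ρ Z₀ N * (Z * (t - s) ^ β) := by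
  have hN := h.nonneg hst.le
  have hZ := hζ.holder.nonneg
  have hρ := hz.exp_pos
  have hx : 0 ≤ (t - s) ^ β := Real.rpow_nonneg (by linarith) _
  have hxT : (t - s) ^ ρ ≤ T ^ ρ := Real.rpow_le_rpow (by linarith) (by linarith) hρ.le
  have h1 := norm_roughInt_sub_conv_le hz hβ hβρ hs hst ht hζ h
  have h2 := norm_conv_le hβ hst.le hζ.holder (h.reg s le_rfl hst.le)
  have hC := intRemC_nonneg hz hβ hβρ (by linarith) hN
  rw [← sub_add_cancel (roughInt z ζ ζ₂ G φ s t) (conv ζ (G s) s t)]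
  refine (norm_add_le_of_le h1 h2).trans ?_
  rw [Real.rpow_add (by linarith), intC]
  calc _ = intRemC T β ρ Z₀ N * (Z * (t - s) ^ β) * (t - s) ^ ρ +
        convC β * (N * Z * (t - s) ^ β) := by ring
    _ ≤ intRemC T β ρ Z₀ N * (Z * (t - s) ^ β) * T ^ ρ +
        convC β * (N * Z * (t - s) ^ β) := by gcongr
    _ = _ := by ring

theorem WeightedDriver.norm_roughInt_sub_conv_le (hz : InnerDriver z T (α - γ) Z₀)
    (hγ : 0 ≤ γ) (hρ : 1 < α - γ + 2 * (α - γ)) (hs : 0 ≤ s) (hst : s < t) (htτ : t ≤ τ)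
    (ht : t ≤ T) (hC : 0 ≤ C) (hκ : 0 ≤ κ) (hζ : WeightedDriver z α γ C s t τ κ ζ ζ₂)
    (h : IntData z (α - γ) s t N G φ) :
    ‖roughInt z ζ ζ₂ G φ s t - conv ζ (G s) s t‖ ≤
      max (intRemC T (α - γ) (α - γ) Z₀ N * C) (intRemC T α (α - γ) Z₀ N * C) *
        (κ * volterraWeight (2 * (α - γ) + γ) γ s t τ) := by
  have h0 := hz.exp_pos
  have hB := intRemC_nonneg hz h0 hρ (by linarith) (h.nonneg hst.le)
  have k := le_mul_volterraWeight (a := 2 * (α - γ) + γ) (c := γ) (τ := τ)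
    (X := ‖roughInt z ζ ζ₂ G φ s t - conv ζ (G s) s t‖)
    (B := intRemC T (α - γ) (α - γ) Z₀ N * C * κ) (B' := intRemC T α (α - γ) Z₀ N * C * κ)
    (by positivity) (by linarith) hst htτ ?_ fun hlt => ?_
  · rw [← max_mul_of_nonneg _ _ hκ] at k
    exact k.trans (le_of_eq (by ring))
  · refine (RoughVolterra.norm_roughInt_sub_conv_le hz h0 hρ hs hst ht hζ.near h).trans
      (le_of_eq ?_)
    rw [show 2 * (α - γ) + γ - γ = α - γ + (α - γ) by ring]
    ring
  · refine (RoughVolterra.norm_roughInt_sub_conv_le hz (by linarith) (by linarith) hs hst ht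
      (hζ.far hlt) h).trans (le_of_eq ?_)
    rw [show 2 * (α - γ) + γ = α + (α - γ) by ring]
    ring

theorem WeightedDriver.norm_roughInt_le (hz : InnerDriver z T (α - γ) Z₀)
    (hγ : 0 ≤ γ) (hρ : 1 < α - γ + 2 * (α - γ)) (hs : 0 ≤ s) (hst : s < t) (htτ : t ≤ τ)
    (ht : t ≤ T) (hC : 0 ≤ C) (hκ : 0 ≤ κ) (hζ : WeightedDriver z α γ C s t τ κ ζ ζ₂)
    (h : IntData z (α - γ) s t N G φ) :
    ‖roughInt z ζ ζ₂ G φ s t‖ ≤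
      max (intC T (α - γ) (α - γ) Z₀ N * C) (intC T α (α - γ) Z₀ N * C) *
        (κ * volterraWeight α γ s t τ) := by
  have h0 := hz.exp_pos
  have hB := intC_nonneg hz h0 hρ (by linarith) (h.nonneg hst.le)
  have k := le_mul_volterraWeight (a := α) (c := γ) (τ := τ)
    (X := ‖roughInt z ζ ζ₂ G φ s t‖)
    (B := intC T (α - γ) (α - γ) Z₀ N * C * κ) (B' := intC T α (α - γ) Z₀ N * C * κ)
    (by positivity) (by linarith) hst htτ ?_ fun hlt => ?_
  · rw [← max_mul_of_nonneg _ _ hκ] at k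
    exact k.trans (le_of_eq (by ring))
  · exact (RoughVolterra.norm_roughInt_le hz h0 hρ hs hst ht hζ.near h).trans
      (le_of_eq (by ring))
  · exact (RoughVolterra.norm_roughInt_le hz (by linarith) (by linarith) hs hst ht
      (hζ.far hlt) h).trans (le_of_eq (by ring))

end WeightedBounds

/-! ### Rough Volterra integrals and their germs -/

section Integral

variable {E V : Type*} [NormedAddCommGroup E] [NormedSpace ℝ E]
  [NormedAddCommGroup V] [NormedSpace ℝ V] [CompleteSpace V]
  {z : ℝ → ℝ → E} {z2 : ℝ → ℝ → ℝ → TensorSq E} {T ρ Z₀ N M s t τ : ℝ}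

theorem HasConvTwo.congr {φ φ' : ℝ → ℝ → E →L[ℝ] E →L[ℝ] V} {I : V}
    (h : HasConvTwo z z2 τ φ s t I)
    (hφ : ∀ p q, s ≤ q → q ≤ p → p ≤ t → φ p q = φ' p q) : HasConvTwo z z2 τ φ' s t I := by
  obtain ⟨J, D, hJ, hD, hI⟩ := h
  refine ⟨J, D, fun a p hsa hap hp => (hJ a p hsa hap hp).congr fun u v hu huv hv => ?_, hD,
    hI.congr fun a b ha hab hb => ?_⟩
  · beta_reduce
    rw [hφ p u hu (by linarith) hp]
  · rw [hφ a a ha le_rfl (by linarith)]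

theorem HasRoughVolterraIntegral.congr {G : ℝ → ℝ → E →L[ℝ] V}
    {φ φ' : ℝ → ℝ → ℝ → E →L[ℝ] E →L[ℝ] V} {I : V}
    (h : HasRoughVolterraIntegral z z2 G φ s t τ I)
    (hφ : ∀ u p q, s ≤ u → u ≤ q → q ≤ p → p ≤ t → φ u p q = φ' u p q) :
    HasRoughVolterraIntegral z z2 G φ' s t τ I := by
  obtain ⟨A, B, hAB, hI⟩ := h
  exact ⟨A, B, fun u v hu huv hv => ⟨(hAB u v hu huv hv).1, (hAB u v hu huv hv).2.congr
    fun p q hq hqp hp => hφ u p q hu hq hqp (by linarith)⟩, hI⟩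

/-- All auxiliary limits exist and limits are unique, so any witnesses `J` and `D` agree with the
constructed convolutions wherever they are used. -/
theorem RoughDriver.hasConvTwo_iff (hz : RoughDriver z z2 T ρ Z₀)
    {φ : ℝ → ℝ → E →L[ℝ] E →L[ℝ] V} {I : V} (hs : 0 ≤ s) (hst : s ≤ t) (htτ : t ≤ τ)
    (hτ : τ ≤ T) (hφ : UpReg₂ s t M φ) :
    HasConvTwo z z2 τ φ s t I ↔
      I = conv₂ z (fun r => z r τ) (fun a b => z2 a b τ) φ s t := by
  have hρ := hz.inner.exp_pos
  have hJ : ∀ a p, s ≤ a → a ≤ p → p ≤ t →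
      HasConvOne z p (fun q => φ p q) s a (innerConv z φ s a p) := fun a p ha hap hp =>
    (conv_spec hρ ha (hz.inner.holder hs hap (by linarith))
      ((hφ.upper p (by linarith) hp).restrict le_rfl hap)).1
  have hD : ∀ a b, s ≤ a → a < b → b ≤ t → HasConvOne z τ (innerConv z φ s a) a b
      (conv (fun r => z r τ) (innerConv z φ s a) a b) := fun a b ha hab hb =>
    (conv_spec hρ hab.le (hz.inner.holder (by linarith) (by linarith) hτ)
      (hz.inner.upReg_conv₂ hs ha (by linarith) (hφ.restrict le_rfl hb))).1
  have hI := (conv₂_spec hz.inner hρ hs hst (by linarith) (hz.outer s t τ hs htτ hτ) hφ).1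
  constructor
  · rintro ⟨J, D, hJ', hD', hI'⟩
    refine (hI'.congr fun a b ha hab hb => ?_).unique hst hI
    rw [germ₂]
    congr 1
    refine ((hD' a b ha hab hb).congr fun u v hu huv hv => ?_).unique hab.le (hD a b ha hab hb)
    rw [(hJ' a u ha hu (by linarith)).unique ha (hJ a u ha hu (by linarith))]
  · rintro rfl
    exact ⟨innerConv z φ s, _, hJ, hD, hI⟩

theorem RoughDriver.hasRoughVolterraIntegral_iff (hz : RoughDriver z z2 T ρ Z₀)
    {G : ℝ → ℝ → E →L[ℝ] V} {φ : ℝ → ℝ → ℝ → E →L[ℝ] E →L[ℝ] V} {I : V} (hs : 0 ≤ s)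
    (hst : s ≤ t) (htτ : t ≤ τ) (hτ : τ ≤ T) (h : IntData z ρ s t N G φ) :
    HasRoughVolterraIntegral z z2 G φ s t τ I ↔ I = volInt z z2 G φ s t τ := by
  have hρ := hz.inner.exp_pos
  have hA : ∀ u v, s ≤ u → u < v → v ≤ t →
      HasConvOne z τ (G u) u v (conv (fun r => z r τ) (G u) u v) := fun u v hu huv hv =>
    (conv_spec hρ huv.le (hz.inner.holder (by linarith) (by linarith) hτ)
      ((h.reg u hu (by linarith)).restrict le_rfl hv)).1
  have hB : ∀ u v, s ≤ u → u < v → v ≤ t → ∀ J, HasConvTwo z z2 τ (φ u) u v J ↔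
      J = conv₂ z (fun r => z r τ) (fun a b => z2 a b τ) (φ u) u v := fun u v hu huv hv J =>
    hz.hasConvTwo_iff (by linarith) huv.le (by linarith) hτ
      ((h.reg₂ u hu (by linarith)).restrict le_rfl hv)
  have hI := (roughInt_spec hz.inner hρ hz.exp_gt hs hst (by linarith)
    (hz.outer s t τ hs htτ hτ) h).1
  constructor
  · rintro ⟨A, B, hAB, hI'⟩
    refine (hI'.congr fun u v hu huv hv => ?_).unique hst hI
    rw [roughGerm, (hAB u v hu huv hv).1.unique huv.le (hA u v hu huv hv),
      (hB u v hu huv hv _).1 (hAB u v hu huv hv).2]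
  · rintro rfl
    exact ⟨_, _, fun u v hu huv hv => ⟨hA u v hu huv hv, (hB u v hu huv hv _).2 rfl⟩, hI⟩

end Integral

/-! ### Regular solutions and solutions -/

section Solution

variable {E V : Type*} [NormedAddCommGroup E] [NormedSpace ℝ E]
  [NormedAddCommGroup V] [NormedSpace ℝ V] [CompleteSpace V]
  {z : ℝ → ℝ → E} {z2 : ℝ → ℝ → ℝ → TensorSq E} {T α γ Z₀ L : ℝ}
  {f : V → E →L[ℝ] V} {m₁ : V × V → V →L[ℝ] E →L[ℝ] V}
  {m₂ n : V × V → V →L[ℝ] V →L[ℝ] E →L[ℝ] V} {y₀ : V} {y : ℝ → ℝ → V}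

/-- With x = (q-p)/(p-s) the ratio is at most min(1, x), and min(1, x) ≤ x^η for every η in [0, 1];
one constant serves for all η. -/
theorem ratio_le_rpow {s p q η : ℝ} (hsp : s < p) (hpq : p < q) (hη : η ∈ Icc (0 : ℝ) 1) :
    (q - p) / (q - s) ≤ (q - p) ^ η * (p - s) ^ (-η) := by
  have h0 : 0 < p - s := by linarith
  have h1 : 0 ≤ q - p := by linarith
  rw [Real.rpow_neg h0.le, ← div_eq_mul_inv, ← Real.div_rpow h1 h0.le]
  rcases le_total (q - p) (p - s) with h | h
  · calc _ ≤ (q - p) / (p - s) := div_le_div_of_nonneg_left h1 h0 (by linarith)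
      _ = ((q - p) / (p - s)) ^ (1 : ℝ) := (Real.rpow_one _).symm
      _ ≤ _ := Real.rpow_le_rpow_of_exponent_ge (div_pos (by linarith) h0)
        ((div_le_one h0).2 h) hη.2
  · exact (ratio_le_one hsp.le hpq).trans (Real.one_le_rpow ((one_le_div h0).2 h) hη.1)

theorem IsRegularSolution.isControlled (hz2 : IsVolterraRoughPath T α γ z z2)
    (hz : RoughDriver z z2 T (α - γ) Z₀) (hγ : 0 ≤ γ) (hT : 0 ≤ T)
    (F : Expansion L f (fderiv ℝ f) m₁ m₂ n)
    (h : IsRegularSolution z z2 T (α - γ) f (fderiv ℝ f) y₀ T y) :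
    IsControlled T α γ z y (fun s _ q => f (y s q)) := by
  have hL := F.lip.nonneg
  have hρ := hz.inner.exp_pos
  obtain ⟨K, hK, hdata⟩ := h.data
  have hI := hdata.intData hz.inner F hK hT le_rfl le_rfl le_rfl
  obtain ⟨C, hC, hW, hW'⟩ := hz2.exists_weightedDriver hγ hρ
  set N := dataC T (α - γ) Z₀ L K
  have hN : 0 ≤ N := hI.nonneg hT
  -- The derivative f(y_s^q) is independent of the larger upper variable, so that regularity
  -- condition holds with constant 0.
  refine ⟨⟨y₀, h.start⟩, ⟨f y₀, fun p q hq hqp hp => by rw [h.start q hq (by linarith)]⟩,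
    ⟨⟨L * max (intC T (α - γ) (α - γ) Z₀ N * C) (intC T α (α - γ) Z₀ N * C),
      fun s t τ hs hst htτ hτ => ?_⟩, ⟨0, fun s r' r₁ r₂ hs h1 h2 h3 hr η hη => by simp⟩,
      ⟨L * (pathC T (α - γ) Z₀ * K * (1 + T ^ (α - γ))),
        fun s r₁ r₂ r' hs h1 h2 h3 hr η hη => ?_⟩⟩,
    ⟨fun s t τ => incr y s t τ - conv (fun r => z r τ) (fun q => f (y s q)) s t,
      ⟨⟨max (intRemC T (α - γ) (α - γ) Z₀ N * C) (intRemC T α (α - γ) Z₀ N * C),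
        fun s t τ hs hst htτ hτ => ?_⟩,
      ⟨max (intRemC T (α - γ) (α - γ) Z₀ N * C) (intRemC T α (α - γ) Z₀ N * C),
        fun s t τ' τ hs hst htτ' hττ hτ η hη => ?_⟩⟩, fun s t τ hs hst htτ hτ => ?_⟩⟩
  · refine (F.lip.lip _ _).trans ?_
    rw [mul_assoc]
    refine mul_le_mul_of_nonneg_left ?_ hL
    rw [h.primitive s t τ hs hst (by linarith) htτ hτ]
    simpa only [one_mul, volInt] using (hW s t τ hs htτ hτ).norm_roughInt_le hz.inner hγ hz.exp_gt hs
      hst htτ (by linarith) hC zero_le_one (hI.restrict hs (by linarith))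
  · have hc := pathC_nonneg hz.inner hT
    have hTρ : 0 ≤ T ^ (α - γ) := Real.rpow_nonneg hT _
    have hs0 : 0 ≤ s ^ (α - γ) := Real.rpow_nonneg hs _
    have hsT : s ^ (α - γ) ≤ T ^ (α - γ) := Real.rpow_le_rpow hs (by linarith) hρ.le
    have hmin : 0 ≤ (r₂ - r₁) ^ η * (r₁ - s) ^ (-η) :=
      mul_nonneg (Real.rpow_nonneg (by linarith) _) (Real.rpow_nonneg (by linarith) _)
    rw [mul_assoc]
    refine (F.lip.lip _ _).trans (mul_le_mul_of_nonneg_left ?_ hL)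
    set D := pathC T (α - γ) Z₀ * K with hD
    have hD0 : 0 ≤ D := mul_nonneg hc hK
    -- The path at time 0 is constant in the upper variable, so the oscillation of y_s is that of
    -- the increment over [0, s]; this is the source of the factor s^ρ.
    have key : ‖y s r₂ - y s r₁‖ ≤ D * s ^ (α - γ) * ((r₂ - r₁) / (r₂ - s)) := by
      rcases hs.eq_or_lt with rfl | hs
      · rw [h.start r₂ (by linarith) (by linarith), h.start r₁ (by linarith) (by linarith),
          sub_self, norm_zero]
        exact mul_nonneg (mul_nonneg hD0 hs0) (ratio_nonneg h1.le h2)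
      · have := (hdata.incr_path hz.inner le_rfl le_rfl le_rfl le_rfl hs (by linarith)).osc r₁ r₂
          h1.le h2 (by linarith)
        rwa [h.start r₂ (by linarith) (by linarith), h.start r₁ (by linarith) (by linarith),
          sub_sub_sub_cancel_right, sub_zero] at this
    have hr1 := ratio_le_one h1.le h2
    have hr0 := ratio_nonneg h1.le h2
    have hrη := ratio_le_rpow h1 h2 hη
    rw [mul_min_of_nonneg _ _ (by positivity)]
    refine le_min (key.trans ?_) (key.trans ?_)
    · calc _ ≤ D * T ^ (α - γ) * ((r₂ - r₁) ^ η * (r₁ - s) ^ (-η)) := by gcongr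
        _ ≤ _ := mul_le_mul_of_nonneg_right (by nlinarith) hmin
    · calc _ ≤ D * s ^ (α - γ) * 1 := by gcongr
        _ ≤ D * s ^ (α - γ) * (1 + T ^ (α - γ)) := by gcongr; linarith
        _ = _ := by ring
  · simp only [incr]
    rw [h.primitive s t τ hs hst (by linarith) htτ hτ]
    simpa only [one_mul, volInt] using (hW s t τ hs htτ hτ).norm_roughInt_sub_conv_le hz.inner hγ
      hz.exp_gt hs hst htτ (by linarith) hC zero_le_one (hI.restrict hs (by linarith))
  · have hκ : 0 ≤ (τ - τ') ^ η * (τ' - t) ^ (-η) :=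
      mul_nonneg (Real.rpow_nonneg (by linarith) _) (Real.rpow_nonneg (by linarith) _)
    have hIr := hI.restrict hs (show t ≤ T by linarith)
    have o1 := hz.outer s t τ hs (by linarith) hτ
    have o2 := hz.outer s t τ' hs (by linarith) (by linarith)
    have k := (hW' s t τ' τ hs htτ' hττ hτ η hη).norm_roughInt_sub_conv_le hz.inner hγ
      hz.exp_gt hs hst htτ'.le (by linarith) hC hκ hIr
    rw [roughInt_driver_sub hz.inner hρ hz.exp_gt hs hst.le (by linarith) o1 o2 hIr,
      conv_sub_left hρ hst.le o1.holder o2.holder (hIr.reg s le_rfl hst.le)] at k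
    simp only [incr]
    rw [h.primitive s t τ hs hst (by linarith) (by linarith) hτ,
      h.primitive s t τ' hs hst (by linarith) (by linarith) (by linarith)]
    rw [sub_sub_sub_comm]
    exact k
  · rw [sub_sub_cancel]
    exact (conv_spec hρ hst.le (hz.inner.holder hs htτ hτ)
      ((hI.restrict hs (show t ≤ T by linarith)).reg s le_rfl hst.le)).1

theorem IsRegularSolution.isSolution (hz2 : IsVolterraRoughPath T α γ z z2)
    (hz : RoughDriver z z2 T (α - γ) Z₀) (hγ : 0 ≤ γ) (hT : 0 ≤ T)
    (F : Expansion L f (fderiv ℝ f) m₁ m₂ n)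
    (h : IsRegularSolution z z2 T (α - γ) f (fderiv ℝ f) y₀ T y) :
    IsSolution T α γ z z2 f y₀ y (fun s _ q => f (y s q)) := by
  refine ⟨h.isControlled hz2 hz hγ hT F, fun _ _ _ _ _ _ _ => rfl, fun t τ ht htτ hτ => ?_⟩
  obtain ⟨K, hK, hdata⟩ := h.data
  have hI := (hdata.intData hz.inner F hK hT le_rfl le_rfl le_rfl).restrict le_rfl
    (show t ≤ T by linarith)
  refine (hz.hasRoughVolterraIntegral_iff le_rfl ht htτ hτ hI).2 ?_
  rw [← h.start τ (by linarith) hτ]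
  rcases ht.eq_or_lt with rfl | ht
  · rw [sub_self, volInt_self]
  · exact h.primitive 0 t τ le_rfl ht (by linarith) htτ hτ

/-- The bounds are bootstrapped. At time 0 the path and f(y₀) are constant, so the remainder over
[0, s] bounds the oscillation of y_s; then f(y_s) is regular, all convolutions exist, and the
remainder bounds give the controlled path data. -/
theorem IsSolution.isRegularSolution {y' : ℝ → ℝ → ℝ → E →L[ℝ] V}
    (hz : RoughDriver z z2 T (α - γ) Z₀) (hγ : 0 ≤ γ) (hT : 0 ≤ T)
    (F : Expansion L f (fderiv ℝ f) m₁ m₂ n) (h : IsSolution T α γ z z2 f y₀ y y') :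
    IsRegularSolution z z2 T (α - γ) f (fderiv ℝ f) y₀ T y := by
  have hρ := hz.inner.exp_pos
  have hZ := hz.inner.nonneg
  -- At t = 0 the equation contains an integral over a degenerate interval, which is 0.
  have hstart : ∀ p, 0 ≤ p → p ≤ T → y 0 p = y₀ := by
    intro p hp hpT
    obtain ⟨A, B, -, hI⟩ := h.equation 0 p le_rfl hp hpT
    exact sub_eq_zero.1 (hI.unique le_rfl (hasSewing_self _ _))
  obtain ⟨R, hR, hyR⟩ := h.controlled.remainder
  obtain ⟨C, hC, hRreg⟩ := hR.upReg hγ (by linarith)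
  simp only [add_sub_cancel_right] at hRreg
  -- The controlled relation only says that y - R is a limit of sums; once f(y_s) is known to be
  -- regular, uniqueness identifies that limit with the constructed convolution.
  have hconv : ∀ s t p, 0 ≤ s → s < t → t ≤ p → p ≤ T → ∀ {M : ℝ},
      UpReg s t M (fun q => f (y s q)) →
      y t p - y s p - conv (fun r => z r p) (fun q => f (y s q)) s t = R s t p := by
    intro s t p hs hst hp hpT M hM
    have h1 := (conv_spec hρ hst.le (hz.inner.holder hs hp hpT) hM).1
    have h2 : HasSewing (fun a b => f (y s a) (z b p - z a p)) s t (incr y s t p - R s t p) :=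
      (hyR s t p hs hst hp hpT).congr fun a b ha hab hb => by
        beta_reduce
        rw [h.deriv_eq s p a hs ha (by linarith) hpT]
        rfl
    have e : incr y s t p - R s t p = conv (fun r => z r p) (fun q => f (y s q)) s t :=
      h2.unique hst.le h1
    rw [← e, incr]
    abel
  have hTρ : 0 ≤ T ^ (α - γ) := Real.rpow_nonneg hT _
  have hTρ2 : 0 ≤ T ^ (2 * (α - γ)) := Real.rpow_nonneg hT _
  have hc := convC_pos hρ
  have hf0 : UpReg 0 T ‖f y₀‖ (fun q => f (y 0 q)) :=
    (UpReg.const (f y₀)).congr fun p hp hpT => by rw [hstart p hp hpT]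
  set A := 2 * convC (α - γ) * Z₀ * ‖f y₀‖ * T ^ (α - γ) + C * T ^ (2 * (α - γ)) with hAdef
  have hA : 0 ≤ A := by positivity
  have hosc : ∀ s, 0 ≤ s → s ≤ T → UpOsc s T A (y s) := by
    intro s hs hsT p q hp hpq hq
    rcases hs.eq_or_lt with rfl | hs
    · rw [hstart q (by linarith) hq, hstart p hp (by linarith), sub_self, norm_zero]
      exact mul_nonneg hA (ratio_nonneg hp hpq)
    · have k := (upReg_incr_of_rem (y := fun p => y s p - y 0 p) hz.inner le_rfl hs le_rfl
        (hf0.restrict le_rfl hsT) ((hRreg 0 s le_rfl hs hsT).congr fun p hp hpT =>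
          (hconv 0 s p le_rfl hs hp hpT (hf0.restrict le_rfl hsT)).symm)).osc p q hp hpq hq
      simp only [sub_zero] at k
      rw [hstart q (by linarith) hq, hstart p (by linarith) (by linarith),
        sub_sub_sub_cancel_right] at k
      refine k.trans (mul_le_mul_of_nonneg_right ?_ (ratio_nonneg hp hpq))
      have e1 : s ^ (α - γ) ≤ T ^ (α - γ) := Real.rpow_le_rpow hs.le hsT hρ.le
      have e2 : s ^ (2 * (α - γ)) ≤ T ^ (2 * (α - γ)) :=
        Real.rpow_le_rpow hs.le hsT (by linarith)
      rw [hAdef]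
      gcongr
  have hdata := exists_ctrlData_of_rem hz.inner F hA hC le_rfl hT le_rfl le_rfl hosc
    fun s t hs hst ht => (hRreg s t hs hst ht).congr fun p hp hpT =>
      (hconv s t p hs hst hp hpT ((F.lip.upReg_comp hA (hosc s hs (by linarith))).restrict le_rfl
        ht)).symm
  refine ⟨hstart, hdata, ?_⟩
  obtain ⟨K, hK, hdata⟩ := hdata
  have hI := hdata.intData hz.inner F hK hT le_rfl le_rfl le_rfl
  refine (hz.isPrimitive le_rfl le_rfl hI fun _ => y₀).congr (fun _ _ _ _ _ => rfl)
    (fun _ _ _ _ _ _ _ => rfl) fun t p ht htT htp hpT => ?_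
  have k := (hz.hasRoughVolterraIntegral_iff le_rfl ht htp hpT (hI.restrict le_rfl htT)).1
    ((h.equation t p ht htp hpT).congr fun u p' q hu huq hqp hp' => by
      rw [h.deriv_eq u p' q hu huq hqp (by linarith)]
      rfl)
  rw [← k]
  abel

end Solution

end RoughVolterra

/-! ### Existence and uniqueness -/

theorem mainTheorem1 {E V : Type*} [NormedAddCommGroup E] [NormedSpace ℝ E] [CompleteSpace E]
    [NormedAddCommGroup V] [NormedSpace ℝ V] [CompleteSpace V]
    (T α γ : ℝ) (hT : 0 < T) (hα : α ∈ Set.Ioo (0 : ℝ) 1) (hγ : γ ∈ Set.Ioo (0 : ℝ) 1)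
    (hρ : 1 / 3 < α - γ)
    (x : ℝ → E) (hx : RoughVolterra.IsHolderPath T α x)
    (k : ℝ → ℝ → ℝ) (hk : RoughVolterra.IsVolterraKernel T γ k)
    (z : ℝ → ℝ → E) (hz : RoughVolterra.IsVolterraIntegral T k x z)
    (z2 : ℝ → ℝ → ℝ → RoughVolterra.TensorSq E)
    (hz2 : RoughVolterra.IsVolterraRoughPath T α γ z z2)
    (f : V → E →L[ℝ] V) (hf : RoughVolterra.IsCb 4 f) (y₀ : V) :
    (∃ (y : ℝ → ℝ → V) (y' : ℝ → ℝ → ℝ → E →L[ℝ] V),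
      RoughVolterra.IsSolution T α γ z z2 f y₀ y y') ∧
    ∀ (y₁ y₂ : ℝ → ℝ → V) (y₁' y₂' : ℝ → ℝ → ℝ → E →L[ℝ] V),
      RoughVolterra.IsSolution T α γ z z2 f y₀ y₁ y₁' →
      RoughVolterra.IsSolution T α γ z z2 f y₀ y₂ y₂' →
      (∀ t τ, 0 ≤ t → t ≤ τ → τ ≤ T → y₁ t τ = y₂ t τ) ∧
      (∀ s p q, 0 ≤ s → s ≤ q → q ≤ p → p ≤ T → y₁' s p q = y₂' s p q) := by
  obtain ⟨L, m₁, m₂, n, F⟩ := hf.exists_expansion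
  obtain ⟨Z₀, hZ⟩ := hz2.exists_roughDriver hγ.1.le hρ
  obtain ⟨y, hy⟩ := RoughVolterra.exists_isRegularSolution hZ F hT y₀
  refine ⟨⟨y, _, hy.isSolution hz2 hZ hγ.1.le hT.le F⟩, fun y₁ y₂ y₁' y₂' h₁ h₂ => ?_⟩
  have h : ∀ t τ, 0 ≤ t → t ≤ τ → τ ≤ T → y₁ t τ = y₂ t τ := fun t τ ht htτ hτ =>
    (h₁.isRegularSolution hZ hγ.1.le hT.le F).unique hZ F hT
      (h₂.isRegularSolution hZ hγ.1.le hT.le F) ht htτ hτ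
  refine ⟨h, fun s p q hs hsq hqp hp => ?_⟩
  rw [h₁.deriv_eq s p q hs hsq hqp hp, h₂.deriv_eq s p q hs hsq hqp hp,
    h s q hs hsq (hqp.trans hp)]
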